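/- Let $k$ be a field of characteristic different from $2$ and let $(W,\mathcal S)$ be a Coxeter system. For a finite-dimensional $k$-linear representation $U$ of $W$ let $R(U)=S(U^*)$ be the algebra of regular functions on $U$, graded so that $U^*$ has degree $2$, with the induced action of $W$. For $s\in\mathcal S$ put $\theta_s=R(U)\otimes_{R(U)^s}R(U)$. The Soergel category $\mathbf B_k(U)$ is the category of $\mathbb Z$-graded $(R(U),R(U))$-bimodules (with degree-preserving bimodule morphisms, on which $k$ acts in the same way from both sides) whose objects are the direct factors of finite direct sums of bimodules $\theta_{s_1}\otimes_{R(U)}\cdots\otimes_{R(U)}\theta_{s_n}(d)$ with $n\ge 0$, $s_1,\dots,s_n\in\mathcal S$, $d\in\mathbb Z$, where $M(d)_i=M_{i+d}$ and the empty product is $R(U)$. An object is indecomposable if it is nonzero and is not isomorphic to a direct sum of two nonzero objects. Let $V$ be a finite-dimensional representation of $W$ over $k$ and $V'\subseteq V$ a subrepresentation such that: 1. every $s\in\mathcal S$ acts as a reflection (its fixed space is a hyperplane) on $V$ and on $V'$; 2. for all $n\ge 0$ and $s_1,\dots,s_n\in\mathcal S$, if $\tau\big((1+T_{s_1})\cdots(1+T_{s_n})\big)=\sum_i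 n_iq^i$, then there is an isomorphism of graded right $R(V)$-modules $\mathrm{Hom}(\theta_{s_1}\cdots\theta_{s_n},R(V))\simeq\bigoplus_i R(V)(2i)^{\oplus n_i}$, where $\mathrm{Hom}$ consists of the bimodule morphisms of all degrees. Here $T_s$ ($s\in\mathcal S$) are the standard generators of the Hecke algebra of $(W,\mathcal S)$ over $\mathbb Z[v,v^{-1}]$, with $q=v^{-2}$ and $T_s^2=q+(q-1)T_s$, and $\tau(\sum_x p_xT_x)=p_1$; 3. $W$ acts faithfully on $V'$. Write $R=R(V)$, $R'=R(V')$, regard $R'$ as an $R$-algebra through the restriction of functions, and put $\mathfrak X(M)=R'\otimes_R M\otimes_R R'$. Then for every $M$ in $\mathbf B_k(V)$ the bimodule $\mathfrak X(M)$ belongs to $\mathbf B_k(V')$, and $M$ is indecomposable in $\mathbf B_k(V)$ if and only if $\mathfrak X(M)$ is indecomposable in $\mathbf B_k(V')$. -/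

import Mathlib

noncomputable section

open scoped TensorProduct LaurentPolynomial

namespace Soergel


/-! ### Exchange property, used to let the Hecke algebra act on the free module on `W` -/

section Coxeter

open CoxeterSystem

variable {B W : Type*} [Group W] {C : CoxeterMatrix B} (cs : CoxeterSystem C W)

open scoped Classical in
def reflStep (i : B) (p : W × ZMod 2) : W × ZMod 2 :=
  (cs.simple i * p.1 * cs.simple i, p.2 + if p.1 = cs.simple i then 1 else 0)

theorem reflStep_invol (i : B) (p : W × ZMod 2) : reflStep cs i (reflStep cs i p) = p := by
  classical
  obtain ⟨t, e⟩ := p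
  have h : cs.simple i * t * cs.simple i = cs.simple i ↔ t = cs.simple i := by
    constructor
    · intro h
      have := congrArg (fun z => cs.simple i * z * cs.simple i) h
      simpa [mul_assoc] using this
    · rintro rfl; simp
  simp only [reflStep, h]
  refine Prod.ext (by simp [mul_assoc]) ?_
  by_cases ht : t = cs.simple i
  · simp [ht, add_assoc]; exact (by decide : (1 : ZMod 2) + 1 = 0)
  · simp [ht]

def reflPerm (i : B) : Equiv.Perm (W × ZMod 2) where
  toFun := reflStep cs i
  invFun := reflStep cs i
  left_inv := reflStep_invol cs i
  right_inv := reflStep_invol cs i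

open scoped Classical in
theorem reflPerm_pow (i j : B) (n : ℕ) (t : W) (e : ZMod 2) :
    ((reflPerm cs i * reflPerm cs j) ^ n) (t, e) =
      ((cs.simple i * cs.simple j) ^ n * t * ((cs.simple i * cs.simple j) ^ n)⁻¹,
        e + ∑ l ∈ Finset.range (2 * n),
          if t = cs.simple j * (cs.simple i * cs.simple j) ^ l then 1 else 0) := by
  induction n with
  | zero => simp
  | succ n ih =>
    set c := cs.simple i * cs.simple j with hc
    have hconj : ∀ l : ℕ, cs.simple j * c ^ l = (c ^ l)⁻¹ * cs.simple j := by
      intro l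
      induction l with
      | zero => simp
      | succ l ihl =>
        rw [pow_succ, ← mul_assoc, ihl, mul_inv_rev, mul_assoc, mul_assoc]
        have : cs.simple j * c = c⁻¹ * cs.simple j := by simp [hc, mul_assoc]
        rw [this, ← mul_assoc, ← mul_assoc, ← mul_inv_rev, ← mul_inv_rev, ← pow_succ, ← pow_succ']
    rw [pow_succ', Equiv.Perm.mul_apply, ih, Equiv.Perm.mul_apply]
    have e1 : c ^ n * t * (c ^ n)⁻¹ = cs.simple j ↔ t = cs.simple j * c ^ (2 * n) := by
      rw [two_mul, pow_add, ← mul_assoc, hconj, mul_inv_eq_iff_eq_mul, mul_assoc, ← eq_inv_mul_iff_mul_eq]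
    have e2 : cs.simple j * (c ^ n * t * (c ^ n)⁻¹) * cs.simple j = cs.simple i ↔
        t = cs.simple j * c ^ (2 * n + 1) := by
      have : cs.simple j * (c ^ n * t * (c ^ n)⁻¹) * cs.simple j = cs.simple i ↔
          c ^ n * t * (c ^ n)⁻¹ = cs.simple j * c := by
        constructor
        · intro h
          have := congrArg (fun z => cs.simple j * z * cs.simple j) h
          simpa [mul_assoc, hc] using this
        · intro h; rw [h]; simp [hc, mul_assoc]
      rw [this, mul_inv_eq_iff_eq_mul, mul_assoc, ← pow_succ', ← eq_inv_mul_iff_mul_eq,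
        ← mul_assoc, ← hconj, mul_assoc, ← pow_add]
      ring_nf
    refine Prod.ext ?_ ?_
    · simp [reflPerm, reflStep, hc, pow_succ', mul_assoc]
    · have : 2 * (n + 1) = 2 * n + 1 + 1 := by ring
      rw [this, Finset.sum_range_succ, Finset.sum_range_succ]
      simp only [reflPerm, reflStep, Equiv.coe_fn_mk, e1, e2]
      ring

theorem reflPerm_isLiftable : C.IsLiftable (reflPerm cs) := by
  classical
  intro i j
  ext1 p
  obtain ⟨t, e⟩ := p
  have hc : (cs.simple i * cs.simple j) ^ C i j = 1 := cs.simple_mul_simple_pow i j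
  rw [reflPerm_pow, two_mul, Finset.sum_range_add]
  simp only [pow_add, hc, one_mul]
  refine Prod.ext (by simp) ?_
  simp only [Equiv.Perm.coe_one, id_eq]
  rw [← two_mul, show (2 : ZMod 2) = 0 from rfl, zero_mul, add_zero]

open scoped Classical in
theorem lift_reflPerm_wordProd (ω : List B) (t : W) (e : ZMod 2) :
    cs.lift ⟨_, reflPerm_isLiftable cs⟩ (cs.wordProd ω) (t, e) =
      (cs.wordProd ω * t * (cs.wordProd ω)⁻¹, e + ((cs.rightInvSeq ω).count t : ZMod 2)) := by
  induction ω with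
  | nil => simp
  | cons i ω ih =>
    rw [cs.wordProd_cons, map_mul, Equiv.Perm.mul_apply, ih, cs.lift_apply_simple]
    refine Prod.ext ?_ ?_
    · simp [reflPerm, reflStep, mul_assoc]
    · have h : cs.wordProd ω * t * (cs.wordProd ω)⁻¹ = cs.simple i ↔
          (cs.wordProd ω)⁻¹ * cs.simple i * cs.wordProd ω = t := by
        rw [mul_inv_eq_iff_eq_mul, mul_assoc, inv_mul_eq_iff_eq_mul, eq_comm]
      simp only [reflPerm, reflStep, Equiv.coe_fn_mk, rightInvSeq, h, List.count_cons, beq_iff_eq]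
      push_cast
      ring

/-- Parity of the number of occurrences of `t` among the right inversions of `w`. -/
def invParity (w t : W) : ZMod 2 := (cs.lift ⟨_, reflPerm_isLiftable cs⟩ w (t, 0)).2

open scoped Classical in
theorem invParity_wordProd (ω : List B) (t : W) :
    invParity cs (cs.wordProd ω) t = ((cs.rightInvSeq ω).count t : ZMod 2) := by
  rw [invParity, lift_reflPerm_wordProd]; simp

open scoped Classical in
theorem invParity_simple_mul (i : B) (w t : W) :
    invParity cs (cs.simple i * w) t =
      invParity cs w t + if cs.simple i * w = w * t then 1 else 0 := by
  obtain ⟨ω, -, rfl⟩ := cs.exists_isReduced w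
  rw [← cs.wordProd_cons, invParity_wordProd, invParity_wordProd, rightInvSeq, List.count_cons]
  simp only [beq_iff_eq, mul_assoc, inv_mul_eq_iff_eq_mul]
  push_cast; rfl

theorem invParity_mul_simple (i : B) (w : W) :
    invParity cs (w * cs.simple i) (cs.simple i) = invParity cs w (cs.simple i) + 1 := by
  classical
  obtain ⟨ω, -, rfl⟩ := cs.exists_isReduced w
  rw [← cs.wordProd_concat, invParity_wordProd, invParity_wordProd, rightInvSeq_concat,
    List.concat_eq_append, List.count_append]
  have h := List.count_map_of_injective (cs.rightInvSeq ω) (MulAut.conj (cs.simple i))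
    (MulAut.conj (cs.simple i)).injective (cs.simple i)
  rw [MulAut.conj_apply, cs.inv_simple, cs.simple_mul_simple_cancel_right] at h
  rw [h]
  simp

theorem mul_simple_lt_iff (w : W) (i : B) :
    cs.length (w * cs.simple i) < cs.length w ↔ invParity cs w (cs.simple i) = 1 := by
  classical
  have key : ∀ w : W, invParity cs w (cs.simple i) = 1 →
      cs.length (w * cs.simple i) < cs.length w := by
    intro w h
    obtain ⟨ω, hω, rfl⟩ := cs.exists_isReduced w
    rw [invParity_wordProd] at h
    have hm : cs.simple i ∈ cs.rightInvSeq ω := by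
      by_contra hn
      rw [List.count_eq_zero_of_not_mem hn] at h
      exact absurd h (by decide)
    exact (cs.isRightInversion_of_mem_rightInvSeq hω hm).2
  refine ⟨fun h => ?_, key w⟩
  by_contra hne
  have h2 := invParity_mul_simple cs i w
  have h0 : invParity cs w (cs.simple i) = 0 := by
    revert hne; generalize invParity cs w (cs.simple i) = a; revert a; decide
  rw [h0, zero_add] at h2
  have := key _ h2
  simp [mul_assoc] at this
  omega

theorem right_compat (w : W) (i j : B) (h : cs.simple i * w ≠ w * cs.simple j) :
    cs.length (cs.simple i * w * cs.simple j) < cs.length (cs.simple i * w) ↔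
      cs.length (w * cs.simple j) < cs.length w := by
  rw [mul_simple_lt_iff, mul_simple_lt_iff, invParity_simple_mul, if_neg h, add_zero]

theorem left_compat (w : W) (i j : B) (h : cs.simple i * w ≠ w * cs.simple j) :
    cs.length (cs.simple i * w * cs.simple j) < cs.length (w * cs.simple j) ↔
      cs.length (cs.simple i * w) < cs.length w := by
  have := right_compat cs w⁻¹ j i (by
    intro h'; apply h
    have := congrArg (fun z => z⁻¹) h'
    simpa using this.symm)
  rw [← cs.length_inv (cs.simple j * w⁻¹ * cs.simple i), ← cs.length_inv (cs.simple j * w⁻¹),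
    ← cs.length_inv (w⁻¹ * cs.simple i), cs.length_inv w] at this
  simpa [mul_assoc] using this

/-- The word with `m` alternating letters is reduced if `m` is at most the order of the product. -/
theorem isReduced_alternatingWord (i j : B) (m : ℕ)
    (hm : ∀ l, 0 < l → l < m → (cs.simple i * cs.simple j) ^ l ≠ 1) :
    cs.IsReduced (alternatingWord i j m) := by
  classical
  have hris : ∀ (i j : B) (p : ℕ), ∀ t ∈ cs.rightInvSeq (alternatingWord i j p), ∃ l < p,
      t = cs.simple j * (cs.simple i * cs.simple j) ^ l := by
    intro i j p
    induction p generalizing i j with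
    | zero => simp [alternatingWord]
    | succ p ih =>
      intro t ht
      rw [alternatingWord, rightInvSeq_concat, List.concat_eq_append, List.mem_append] at ht
      rcases ht with ht | ht
      · obtain ⟨u, hu, rfl⟩ := List.mem_map.1 ht
        obtain ⟨l, hl, rfl⟩ := ih j i u hu
        refine ⟨l + 1, by omega, ?_⟩
        have : ∀ l : ℕ, cs.simple i * (cs.simple j * cs.simple i) ^ l =
            (cs.simple i * cs.simple j) ^ l * cs.simple i := by
          intro l
          induction l with
          | zero => simp
          | succ l ih => rw [pow_succ, ← mul_assoc, ih, pow_succ]; simp [mul_assoc]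
        rw [this, MulAut.conj_apply, cs.inv_simple, mul_assoc, mul_assoc, ← pow_succ]
      · exact ⟨0, by omega, by simpa using ht⟩
  induction m generalizing i j with
  | zero => simp [alternatingWord, CoxeterSystem.IsReduced]
  | succ m ih =>
    have hm' : ∀ l, 0 < l → l < m + 1 → (cs.simple j * cs.simple i) ^ l ≠ 1 := by
      intro l h0 hl h
      refine hm l h0 hl ?_
      have := congrArg (fun z => z⁻¹) h
      simpa [← inv_pow] using this
    have hred := ih j i fun l h0 hl => hm' l h0 (by omega)
    rw [alternatingWord, CoxeterSystem.IsReduced, cs.wordProd_concat, List.length_concat, ← hred.eq]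
    rcases cs.length_mul_simple (cs.wordProd (alternatingWord j i m)) j with h | h
    · exact h
    · exfalso
      have hlt := (mul_simple_lt_iff cs (cs.wordProd (alternatingWord j i m)) j).1 (by omega)
      rw [invParity_wordProd] at hlt
      have hmem : cs.simple j ∈ cs.rightInvSeq (alternatingWord j i m) := by
        by_contra hn
        rw [List.count_eq_zero_of_not_mem hn] at hlt
        exact absurd hlt (by decide)
      obtain ⟨l, hl, h⟩ := hris j i m _ hmem
      refine hm' (l + 1) (by omega) (by omega) ?_
      rw [pow_succ', mul_assoc, ← h]; simp

theorem wordProd_alternatingWord_comm (i j : B) (m : ℕ)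
    (h : (cs.simple i * cs.simple j) ^ m = 1) :
    cs.wordProd (alternatingWord i j m) = cs.wordProd (alternatingWord j i m) := by
  have hinv : cs.simple j * cs.simple i = (cs.simple i * cs.simple j)⁻¹ := by simp
  rw [cs.prod_alternatingWord_eq_mul_pow, cs.prod_alternatingWord_eq_mul_pow, hinv, inv_pow]
  rcases Nat.even_or_odd' m with ⟨n, rfl | rfl⟩
  · simp only [even_two, Even.mul_right, if_true, one_mul]
    rw [Nat.mul_div_cancel_left _ (by norm_num), eq_inv_iff_mul_eq_one, ← pow_add, ← two_mul, h]
  · have h1 : ¬ Even (2 * n + 1) := by simp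
    have h2 : (2 * n + 1) / 2 = n := by omega
    rw [if_neg h1, if_neg h1, h2, eq_mul_inv_iff_mul_eq, mul_assoc, ← pow_add, ← two_mul]
    have h3 : (cs.simple i * cs.simple j) ^ (2 * n) = (cs.simple i * cs.simple j)⁻¹ := by
      rw [eq_inv_iff_mul_eq_one, ← pow_succ, h]
    rw [h3]; simp

end Coxeter

/-! ### The Hecke algebra and its trace -/

section Hecke

open CoxeterSystem

/-- `q = v⁻²` in `ℤ[v, v⁻¹]`; the variable `T` of Laurent polynomials is `v`. -/
def heckeQ : ℤ[T;T⁻¹] := LaurentPolynomial.T (-2)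

variable {B W : Type*} [Group W] {C : CoxeterMatrix B} (cs : CoxeterSystem C W)

/-- Relations of the Hecke algebra: `T_s² = q + (q - 1) T_s`, and the braid relation with `m`
factors on both sides whenever `s r` has finite order `m`. -/
inductive HeckeRel : FreeAlgebra ℤ[T;T⁻¹] B → FreeAlgebra ℤ[T;T⁻¹] B → Prop
  | quadratic (i : B) : HeckeRel (FreeAlgebra.ι _ i * FreeAlgebra.ι _ i)
      (heckeQ • 1 + (heckeQ - 1) • FreeAlgebra.ι _ i)
  | braid (i j : B) (m : ℕ) (hm : 0 < m) (h : orderOf (cs.simple i * cs.simple j) = m) :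
      HeckeRel ((alternatingWord i j m).map (FreeAlgebra.ι _)).prod
        ((alternatingWord j i m).map (FreeAlgebra.ι _)).prod

/-- The Hecke algebra of a Coxeter system, by generators and relations over `ℤ[v, v⁻¹]`. -/
abbrev HeckeAlgebra : Type _ := RingQuot (HeckeRel cs)

/-- The generator `T_s`. -/
def heckeT (i : B) : HeckeAlgebra cs := RingQuot.mkAlgHom ℤ[T;T⁻¹] (HeckeRel cs) (FreeAlgebra.ι _ i)

open scoped Classical in
/-- Left multiplication by `T_s` in the basis `(T_x)`. -/
def leftOp (i : B) : Module.End ℤ[T;T⁻¹] (W →₀ ℤ[T;T⁻¹]) :=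
  Finsupp.linearCombination ℤ[T;T⁻¹] fun x =>
    if cs.length (cs.simple i * x) < cs.length x then
      heckeQ • Finsupp.single (cs.simple i * x) 1 + (heckeQ - 1) • Finsupp.single x 1
    else Finsupp.single (cs.simple i * x) 1

open scoped Classical in
/-- Right multiplication by `T_s` in the basis `(T_x)`. -/
def rightOp (i : B) : Module.End ℤ[T;T⁻¹] (W →₀ ℤ[T;T⁻¹]) :=
  Finsupp.linearCombination ℤ[T;T⁻¹] fun x =>
    if cs.length (x * cs.simple i) < cs.length x then
      heckeQ • Finsupp.single (x * cs.simple i) 1 + (heckeQ - 1) • Finsupp.single x 1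
    else Finsupp.single (x * cs.simple i) 1

theorem leftOp_neg {i : B} {x : W} (h : cs.length (cs.simple i * x) < cs.length x) :
    leftOp cs i (Finsupp.single x 1) =
      heckeQ • Finsupp.single (cs.simple i * x) 1 + (heckeQ - 1) • Finsupp.single x 1 := by
  simp [leftOp, h]

theorem leftOp_pos {i : B} {x : W} (h : ¬ cs.length (cs.simple i * x) < cs.length x) :
    leftOp cs i (Finsupp.single x 1) = Finsupp.single (cs.simple i * x) 1 := by
  simp [leftOp, h]

theorem rightOp_neg {i : B} {x : W} (h : cs.length (x * cs.simple i) < cs.length x) :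
    rightOp cs i (Finsupp.single x 1) =
      heckeQ • Finsupp.single (x * cs.simple i) 1 + (heckeQ - 1) • Finsupp.single x 1 := by
  simp [rightOp, h]

theorem rightOp_pos {i : B} {x : W} (h : ¬ cs.length (x * cs.simple i) < cs.length x) :
    rightOp cs i (Finsupp.single x 1) = Finsupp.single (x * cs.simple i) 1 := by
  simp [rightOp, h]

theorem leftOp_sq (i : B) :
    leftOp cs i * leftOp cs i = heckeQ • 1 + (heckeQ - 1) • leftOp cs i := by
  refine Finsupp.lhom_ext' fun x => LinearMap.ext_ring ?_
  change leftOp cs i (leftOp cs i (Finsupp.single x 1)) =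
    heckeQ • Finsupp.single x 1 + (heckeQ - 1) • leftOp cs i (Finsupp.single x 1)
  have hss : cs.simple i * (cs.simple i * x) = x := by simp
  rcases cs.length_simple_mul x i with h | h
  · have h2 : cs.length (cs.simple i * (cs.simple i * x)) < cs.length (cs.simple i * x) := by
      rw [hss]; omega
    rw [leftOp_pos cs (by omega : ¬ _), leftOp_neg cs h2, hss]
  · have h2 : ¬ cs.length (cs.simple i * (cs.simple i * x)) < cs.length (cs.simple i * x) := by
      rw [hss]; omega
    have h1 : cs.length (cs.simple i * x) < cs.length x := by omega
    conv_lhs => rw [leftOp_neg cs h1, map_add, map_smul, map_smul, leftOp_pos cs h2, hss]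

theorem leftOp_rightOp_comm (i j : B) :
    Commute (leftOp cs i) (rightOp cs j) := by
  refine Finsupp.lhom_ext' fun x => LinearMap.ext_ring ?_
  change leftOp cs i (rightOp cs j (Finsupp.single x 1)) =
    rightOp cs j (leftOp cs i (Finsupp.single x 1))
  by_cases hx : cs.simple i * x = x * cs.simple j
  · have e1 : cs.simple i * (x * cs.simple j) = x := by rw [← hx]; simp
    have e2 : cs.simple i * x * cs.simple j = x := by rw [hx]; simp [mul_assoc]
    rcases cs.length_simple_mul x i with h | h
    · rw [leftOp_pos cs (by omega : ¬ _), rightOp_pos cs (by rw [← hx]; omega),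
        leftOp_neg cs (by rw [e1, ← hx]; omega), rightOp_neg cs (by rw [e2]; omega), e1, e2, hx]
    · rw [leftOp_neg cs (by omega), rightOp_neg cs (by rw [← hx]; omega), map_add, map_add,
        map_smul, map_smul, map_smul, map_smul,
        leftOp_pos cs (by rw [e1, ← hx]; omega), rightOp_pos cs (by rw [e2]; omega), e1, e2,
        leftOp_neg cs (by omega), rightOp_neg cs (by rw [← hx]; omega), hx]
  · have hr := right_compat cs x i j hx
    have hl := left_compat cs x i j hx
    rw [mul_assoc] at hl
    have ha : cs.simple i * (x * cs.simple j) = cs.simple i * x * cs.simple j := (mul_assoc _ _ _).symm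
    by_cases a : cs.length (cs.simple i * x) < cs.length x <;>
    by_cases b : cs.length (x * cs.simple j) < cs.length x
    · rw [rightOp_neg cs b, leftOp_neg cs a]
      simp only [map_add, map_smul]
      rw [leftOp_neg cs (hl.2 a), rightOp_neg cs (hr.2 b), rightOp_neg cs b, leftOp_neg cs a, ha]
      module
    · rw [rightOp_pos cs b, leftOp_neg cs a]
      simp only [map_add, map_smul]
      rw [leftOp_neg cs (hl.2 a), rightOp_pos cs (mt hr.1 b), rightOp_pos cs b, ha]
    · rw [rightOp_neg cs b, leftOp_pos cs a]
      simp only [map_add, map_smul]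
      rw [leftOp_pos cs (mt hl.1 a), rightOp_neg cs (hr.2 b), leftOp_pos cs a, ha]
    · rw [rightOp_pos cs b, leftOp_pos cs a, leftOp_pos cs (mt hl.1 a),
        rightOp_pos cs (mt hr.1 b), ha]

theorem leftOp_word {ω : List B} (h : cs.IsReduced ω) :
    (ω.map (leftOp cs)).prod (Finsupp.single 1 1) = Finsupp.single (cs.wordProd ω) 1 := by
  induction ω with
  | nil => simp
  | cons i ω ih =>
    have h' : cs.IsReduced ω := h.drop 1
    have e := h.eq
    rw [cs.wordProd_cons, List.length_cons, ← h'.eq] at e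
    rw [List.map_cons, List.prod_cons, Module.End.mul_apply, ih h', leftOp_pos cs (by omega),
      cs.wordProd_cons]

theorem eq_of_commute {P Q : Module.End ℤ[T;T⁻¹] (W →₀ ℤ[T;T⁻¹])}
    (hP : ∀ j, Commute P (rightOp cs j)) (hQ : ∀ j, Commute Q (rightOp cs j))
    (h : P (Finsupp.single 1 1) = Q (Finsupp.single 1 1)) : P = Q := by
  refine Finsupp.lhom_ext' fun x => LinearMap.ext_ring ?_
  change P (Finsupp.single x 1) = Q (Finsupp.single x 1)
  obtain ⟨ω, hω, rfl⟩ := cs.exists_isReduced x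
  induction ω using List.reverseRecOn with
  | nil => simpa using h
  | append_singleton ω j ih =>
    have h' : cs.IsReduced ω := by simpa using hω.take ω.length
    have e := hω.eq
    rw [cs.wordProd_append, List.length_append, ← h'.eq] at e
    simp only [wordProd_singleton, List.length_singleton] at e
    have e2 : Finsupp.single (cs.wordProd (ω ++ [j])) (1 : ℤ[T;T⁻¹]) =
        rightOp cs j (Finsupp.single (cs.wordProd ω) 1) := by
      rw [rightOp_pos cs (by omega), cs.wordProd_append, wordProd_singleton]
    rw [e2]
    have p1 := LinearMap.congr_fun (hP j).eq (Finsupp.single (cs.wordProd ω) 1)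
    have q1 := LinearMap.congr_fun (hQ j).eq (Finsupp.single (cs.wordProd ω) 1)
    simp only [Module.End.mul_apply] at p1 q1
    rw [p1, q1, ih h']

theorem leftOp_braid (i j : B) (m : ℕ) (h : orderOf (cs.simple i * cs.simple j) = m) :
    ((alternatingWord i j m).map (leftOp cs)).prod =
      ((alternatingWord j i m).map (leftOp cs)).prod := by
  have hcomm : ∀ (ω : List B) (j : B), Commute (ω.map (leftOp cs)).prod (rightOp cs j) := by
    intro ω j
    refine Commute.list_prod_left _ _ fun x hx => ?_
    obtain ⟨i, -, rfl⟩ := List.mem_map.1 hx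
    exact leftOp_rightOp_comm cs i j
  have hlt : ∀ l, 0 < l → l < m → (cs.simple i * cs.simple j) ^ l ≠ 1 := fun l h0 hl =>
    pow_ne_one_of_lt_orderOf h0.ne' (h ▸ hl)
  have hlt' : ∀ l, 0 < l → l < m → (cs.simple j * cs.simple i) ^ l ≠ 1 := by
    intro l h0 hl h'
    refine hlt l h0 hl ?_
    have := congrArg (fun z => z⁻¹) h'
    simpa [← inv_pow] using this
  refine eq_of_commute cs (hcomm _) (hcomm _) ?_
  rw [leftOp_word cs (isReduced_alternatingWord cs i j m hlt),
    leftOp_word cs (isReduced_alternatingWord cs j i m hlt'),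
    wordProd_alternatingWord_comm cs i j m (h ▸ pow_orderOf_eq_one _)]

/-- The action of the Hecke algebra by left multiplication, written in the basis `(T_x)`. -/
def heckeRegular : HeckeAlgebra cs →ₐ[ℤ[T;T⁻¹]] Module.End ℤ[T;T⁻¹] (W →₀ ℤ[T;T⁻¹]) :=
  RingQuot.liftAlgHom ℤ[T;T⁻¹] ⟨FreeAlgebra.lift ℤ[T;T⁻¹] (leftOp cs), by
    intro x y h
    induction h with
    | quadratic i => simpa using leftOp_sq cs i
    | braid i j m hm h =>
      simpa [map_list_prod, List.map_map, Function.comp_def] using leftOp_braid cs i j m h⟩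

/-- The trace `τ (∑ p_x T_x) = p_1`. -/
def heckeTau : HeckeAlgebra cs →ₗ[ℤ[T;T⁻¹]] ℤ[T;T⁻¹] :=
  Finsupp.lapply 1 ∘ₗ LinearMap.applyₗ (Finsupp.single 1 1) ∘ₗ (heckeRegular cs).toLinearMap

open scoped Classical in
/-- `T_x = T_{s_1} ⋯ T_{s_n}` for a reduced expression of `x`; then `τ(T_x) = δ_{x,1}`, which
determines `τ`. -/
theorem heckeTau_T {ω : List B} (h : cs.IsReduced ω) :
    heckeTau cs (ω.map (heckeT cs)).prod = if cs.wordProd ω = 1 then 1 else 0 := by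
  have : heckeRegular cs (ω.map (heckeT cs)).prod = (ω.map (leftOp cs)).prod := by
    simp [map_list_prod, List.map_map, Function.comp_def, heckeRegular, heckeT]
  simp only [heckeTau, LinearMap.comp_apply, AlgHom.toLinearMap_apply, this,
    LinearMap.applyₗ_apply_apply, leftOp_word cs h, Finsupp.lapply_apply, Finsupp.single_apply]

end Hecke

/-! ### Gradings by `ℤ` -/

section Grading

variable {k : Type*} [Field k] {M : Type*} [AddCommGroup M] [Module k M]

theorem isInternal_of_proj (gr : ℤ → Submodule k M) (P : ℤ → M →ₗ[k] M)
    (h1 : ∀ i, ∀ m ∈ gr i, P i m = m) (h2 : ∀ i j, i ≠ j → ∀ m ∈ gr j, P i m = 0)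
    (h3 : ⨆ i, gr i = ⊤) : DirectSum.IsInternal gr := by
  refine DirectSum.isInternal_submodule_of_iSupIndep_of_iSup_eq_top ?_ h3
  intro i
  rw [Submodule.disjoint_def]
  intro x hx hx'
  have : ⨆ j, ⨆ (_ : j ≠ i), gr j ≤ LinearMap.ker (P i) :=
    iSup₂_le fun j hj m hm => h2 i j hj.symm m hm
  rw [← h1 i x hx]
  exact this hx'

/-- The decomposition into components. -/
def grEquiv {gr : ℤ → Submodule k M} (h : DirectSum.IsInternal gr) :
    DirectSum ℤ (fun i => gr i) ≃ₗ[k] M :=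
  LinearEquiv.ofBijective (DirectSum.coeLinearMap gr) (show Function.Bijective _ from h)

theorem grEquiv_lof {gr : ℤ → Submodule k M} (h : DirectSum.IsInternal gr) (i : ℤ) (m : gr i) :
    grEquiv h (DirectSum.lof k ℤ (fun i => gr i) i m) = m :=
  DirectSum.coeLinearMap_lof gr i m

/-- The projection to the component of degree `i`. -/
def grProj {gr : ℤ → Submodule k M} (h : DirectSum.IsInternal gr) (i : ℤ) : M →ₗ[k] M :=
  (gr i).subtype ∘ₗ DirectSum.component k ℤ (fun i => gr i) i ∘ₗ (grEquiv h).symm.toLinearMap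

variable {gr : ℤ → Submodule k M} (h : DirectSum.IsInternal gr)

theorem grEquiv_symm_of_mem {i : ℤ} {m : M} (hm : m ∈ gr i) :
    (grEquiv h).symm m =
      DirectSum.lof k ℤ (fun i => gr i) i ⟨m, hm⟩ := by
  rw [LinearEquiv.symm_apply_eq, grEquiv_lof]

theorem grProj_of_mem {i : ℤ} {m : M} (hm : m ∈ gr i) : grProj h i m = m := by
  simp [grProj, grEquiv_symm_of_mem h hm, DirectSum.component.lof_self]

theorem grProj_of_mem_ne {i j : ℤ} (hij : i ≠ j) {m : M} (hm : m ∈ gr j) : grProj h i m = 0 := by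
  simp [grProj, grEquiv_symm_of_mem h hm, DirectSum.component.of, hij.symm]

theorem grProj_mem (i : ℤ) (m : M) : grProj h i m ∈ gr i := by
  simp [grProj]

theorem gr_induction {gr : ℤ → Submodule k M} (h : DirectSum.IsInternal gr) {p : M → Prop} (m : M) (hom : ∀ i, ∀ m ∈ gr i, p m) (zero : p 0)
    (add : ∀ a b, p a → p b → p (a + b)) : p m := by
  have : m ∈ ⨆ i, gr i := by rw [h.submodule_iSup_eq_top]; trivial
  exact Submodule.iSup_induction gr (motive := p) this hom zero add

theorem exists_sum_grProj (m : M) : ∃ s : Finset ℤ, ∀ t : Finset ℤ, s ⊆ t →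
    m = ∑ i ∈ t, grProj h i m := by
  classical
  refine gr_induction h (p := fun m => ∃ s : Finset ℤ, ∀ t : Finset ℤ, s ⊆ t →
    m = ∑ i ∈ t, grProj h i m) m ?_ ⟨∅, fun t _ => by simp⟩ ?_
  · intro i m hm
    refine ⟨{i}, fun t ht => ?_⟩
    rw [Finset.sum_eq_single i (fun j _ hj => grProj_of_mem_ne h hj hm)
      (fun hi => absurd (ht (by simp)) hi), grProj_of_mem h hm]
  · rintro a b ⟨s, hs⟩ ⟨s', hs'⟩
    refine ⟨s ∪ s', fun t ht => ?_⟩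
    simp only [map_add, Finset.sum_add_distrib]
    rw [← hs t (Finset.subset_union_left.trans ht), ← hs' t (Finset.subset_union_right.trans ht)]

end Grading

universe u v

/-- A commutative `ℤ`-graded `k`-algebra. -/
structure GrAlg (k : Type u) [Field k] where
  carrier : Type v
  [commRing : CommRing carrier]
  [algebra : Algebra k carrier]
  gr : ℤ → Submodule k carrier
  one_mem : (1 : carrier) ∈ gr 0
  mul_mem : ∀ {i j : ℤ} {a b : carrier}, a ∈ gr i → b ∈ gr j → a * b ∈ gr (i + j)
  internal : DirectSum.IsInternal gr

attribute [instance] GrAlg.commRing GrAlg.algebra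

/-- Homomorphisms of graded `k`-algebras. -/
structure GrAlg.Hom {k : Type u} [Field k] (A B : GrAlg.{u, v} k) where
  toAlgHom : A.carrier →ₐ[k] B.carrier
  map_mem : ∀ (i : ℤ) (a : A.carrier), a ∈ A.gr i → toAlgHom a ∈ B.gr i

def GrAlg.Hom.id {k : Type u} [Field k] (A : GrAlg.{u, v} k) : GrAlg.Hom A A where
  toAlgHom := AlgHom.id k A.carrier
  map_mem := fun _ _ ha => ha

/-- A `ℤ`-graded `(A, B)`-bimodule (on which `k` acts in the same way from both sides). The left
action of `a` is `lact a` and the right action of `b` is `ract b`; as `B` is commutative, a right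
action of `B` is the same as a homomorphism from `B` to the endomorphisms. -/
structure GrBimod {k : Type u} [Field k] (A B : GrAlg.{u, v} k) where
  carrier : Type v
  [addCommGroup : AddCommGroup carrier]
  [module : Module k carrier]
  lact : A.carrier →ₐ[k] Module.End k carrier
  ract : B.carrier →ₐ[k] Module.End k carrier
  comm : ∀ a b m, lact a (ract b m) = ract b (lact a m)
  gr : ℤ → Submodule k carrier
  internal : DirectSum.IsInternal gr
  lact_mem : ∀ {i j : ℤ} {a : A.carrier} {m : carrier},
    a ∈ A.gr i → m ∈ gr j → lact a m ∈ gr (i + j)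
  ract_mem : ∀ {i j : ℤ} {b : B.carrier} {m : carrier},
    b ∈ B.gr i → m ∈ gr j → ract b m ∈ gr (i + j)

attribute [instance] GrBimod.addCommGroup GrBimod.module

namespace GrBimod

variable {k : Type u} [Field k] {A B D : GrAlg.{u, v} k}

/-- Isomorphism of graded bimodules (bijective bimodule homomorphisms of degree `0`). -/
def Iso (M N : GrBimod A B) : Prop :=
  ∃ e : M.carrier ≃ₗ[k] N.carrier,
    (∀ a m, e (M.lact a m) = N.lact a (e m)) ∧ (∀ b m, e (M.ract b m) = N.ract b (e m)) ∧
      ∀ (i : ℤ) (m : M.carrier), m ∈ M.gr i → e m ∈ N.gr i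

/-- All bimodule homomorphisms, of whatever degree. -/
def hom (M N : GrBimod A B) : Submodule k (M.carrier →ₗ[k] N.carrier) where
  carrier := {f | (∀ a m, f (M.lact a m) = N.lact a (f m)) ∧
    ∀ b m, f (M.ract b m) = N.ract b (f m)}
  add_mem' := by
    rintro f g ⟨h1, h2⟩ ⟨h3, h4⟩
    exact ⟨fun a m => by simp [h1, h3], fun a m => by simp [h2, h4]⟩
  zero_mem' := ⟨fun a m => by simp, fun a m => by simp⟩
  smul_mem' := by
    rintro c f ⟨h1, h2⟩
    exact ⟨fun a m => by simp [h1], fun a m => by simp [h2]⟩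

/-- The right action of `B` on bimodule homomorphisms, `(f · b)(m) = f(m) · b`. -/
def homRact {M N : GrBimod A B} (f : hom M N) (b : B.carrier) : hom M N :=
  ⟨N.ract b ∘ₗ f.1, fun a m => by simp [f.2.1, N.comm], fun c m => by
    simp only [LinearMap.comp_apply, f.2.2]
    rw [← Module.End.mul_apply, ← map_mul, mul_comm, map_mul, Module.End.mul_apply]⟩

/-- Homomorphisms that raise degrees by `d`. -/
def HasDegree {M N : GrBimod A B} (f : hom M N) (d : ℤ) : Prop :=
  ∀ (i : ℤ) (m : M.carrier), m ∈ M.gr i → f.1 m ∈ N.gr (i + d)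

/-- The zero bimodule. -/
def zero (A B : GrAlg.{u, v} k) : GrBimod A B where
  carrier := PUnit
  lact := ⟨⟨⟨⟨fun _ => 0, rfl⟩, fun _ _ => rfl⟩, rfl, fun _ _ => rfl⟩, fun _ => rfl⟩
  ract := ⟨⟨⟨⟨fun _ => 0, rfl⟩, fun _ _ => rfl⟩, rfl, fun _ _ => rfl⟩, fun _ => rfl⟩
  comm := fun _ _ _ => rfl
  gr := fun _ => ⊥
  internal := isInternal_of_proj _ (fun _ => 0) (fun _ _ _ => rfl) (fun _ _ _ _ _ => rfl)
    (Subsingleton.elim _ _)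
  lact_mem := fun _ _ => rfl
  ract_mem := fun _ _ => rfl

/-- Direct sum of two graded bimodules. -/
def directSum (M N : GrBimod A B) : GrBimod A B where
  carrier := M.carrier × N.carrier
  lact := AlgHom.ofLinearMap
    { toFun := fun a => (M.lact a).prodMap (N.lact a)
      map_add' := fun a b => by ext <;> simp
      map_smul' := fun a b => by ext <;> simp }
    (by ext <;> simp) (fun a b => by ext <;> simp)
  ract := AlgHom.ofLinearMap
    { toFun := fun a => (M.ract a).prodMap (N.ract a)
      map_add' := fun a b => by ext <;> simp
      map_smul' := fun a b => by ext <;> simp }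
    (by ext <;> simp) (fun a b => by ext <;> simp)
  comm := fun a b m => Prod.ext (M.comm a b m.1) (N.comm a b m.2)
  gr := fun i => (M.gr i).prod (N.gr i)
  internal := isInternal_of_proj _
    (fun i => (grProj M.internal i).prodMap (grProj N.internal i))
    (fun i m hm => Prod.ext (grProj_of_mem _ hm.1) (grProj_of_mem _ hm.2))
    (fun i j hij m hm => Prod.ext (grProj_of_mem_ne _ hij hm.1) (grProj_of_mem_ne _ hij hm.2)) (by
      rw [eq_top_iff]
      rintro ⟨m, n⟩ -
      have e : (m, n) = (m, 0) + (0, n) := by simp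
      rw [e]
      refine Submodule.add_mem _ ?_ ?_
      · refine gr_induction M.internal (p := fun m => (m, (0 : N.carrier)) ∈ _) m
          (fun i m hm => Submodule.mem_iSup_of_mem i ⟨hm, zero_mem _⟩) (zero_mem _) ?_
        intro a b ha hb
        simpa using Submodule.add_mem _ ha hb
      · refine gr_induction N.internal (p := fun n => ((0 : M.carrier), n) ∈ _) n
          (fun i m hm => Submodule.mem_iSup_of_mem i ⟨zero_mem _, hm⟩) (zero_mem _) ?_
        intro a b ha hb
        simpa using Submodule.add_mem _ ha hb)
  lact_mem := fun ha hm => ⟨M.lact_mem ha hm.1, N.lact_mem ha hm.2⟩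
  ract_mem := fun ha hm => ⟨M.ract_mem ha hm.1, N.ract_mem ha hm.2⟩

/-- Direct sum of a finite list of graded bimodules. -/
def sum (l : List (GrBimod A B)) : GrBimod A B := l.foldr directSum (zero A B)

/-- The shift `M(d)`, with `M(d)_i = M_{i+d}`. -/
def shift (M : GrBimod A B) (d : ℤ) : GrBimod A B where
  carrier := M.carrier
  lact := M.lact
  ract := M.ract
  comm := M.comm
  gr := fun i => M.gr (i + d)
  internal := isInternal_of_proj _ (fun i => grProj M.internal (i + d))
    (fun i m hm => grProj_of_mem _ hm)
    (fun i j hij m hm => grProj_of_mem_ne _ (by omega) hm)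
    ((Equiv.addRight d).iSup_comp (g := M.gr) |>.trans M.internal.submodule_iSup_eq_top)
  lact_mem := fun {i j a m} ha hm => by rw [add_assoc]; exact M.lact_mem ha hm
  ract_mem := fun {i j a m} ha hm => by rw [add_assoc]; exact M.ract_mem ha hm

/-- A graded algebra `E` as an `(A, B)`-bimodule, through homomorphisms from `A` and `B`. -/
def ofAlg {E : GrAlg.{u, v} k} (φ : GrAlg.Hom A E) (ψ : GrAlg.Hom B E) : GrBimod A B where
  carrier := E.carrier
  lact := (Algebra.lmul k E.carrier).comp φ.toAlgHom
  ract := (Algebra.lmul k E.carrier).comp ψ.toAlgHom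
  comm := fun a b m => by simp [mul_left_comm]
  gr := E.gr
  internal := E.internal
  lact_mem := fun ha hm => E.mul_mem (φ.map_mem _ _ ha) hm
  ract_mem := fun hb hm => E.mul_mem (ψ.map_mem _ _ hb) hm

/-- `A` as a graded `(A, A)`-bimodule. -/
def unit (A : GrAlg.{u, v} k) : GrBimod A A := ofAlg (GrAlg.Hom.id A) (GrAlg.Hom.id A)

/-! #### Tensor product over `B` -/

variable (M : GrBimod A B) (N : GrBimod B D)

/-- The relations `m b ⊗ n = m ⊗ b n`. -/
def tensorRel : Submodule k (M.carrier ⊗[k] N.carrier) :=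
  Submodule.span k {x | ∃ m b n, x = M.ract b m ⊗ₜ n - m ⊗ₜ N.lact b n}

abbrev tensorCarrier : Type v := (M.carrier ⊗[k] N.carrier) ⧸ tensorRel M N

/-- The class of `m ⊗ n` in `M ⊗_B N`. -/
def tmul (m : M.carrier) (n : N.carrier) : tensorCarrier M N := (tensorRel M N).mkQ (m ⊗ₜ n)

theorem tmul_balanced (m : M.carrier) (b : B.carrier) (n : N.carrier) :
    tmul M N (M.ract b m) n = tmul M N m (N.lact b n) := by
  rw [tmul, tmul, ← sub_eq_zero, ← map_sub, Submodule.mkQ_apply, Submodule.Quotient.mk_eq_zero]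
  exact Submodule.subset_span ⟨m, b, n, rfl⟩

def tmulBilin : M.carrier →ₗ[k] N.carrier →ₗ[k] tensorCarrier M N :=
  (TensorProduct.mk k M.carrier N.carrier).compr₂ (tensorRel M N).mkQ

theorem tmulBilin_apply (m : M.carrier) (n : N.carrier) : tmulBilin M N m n = tmul M N m n := rfl

variable {M N} in
/-- Linear maps out of `M ⊗_B N` from balanced bilinear maps. -/
def tensorLift {P : Type*} [AddCommGroup P] [Module k P]
    (f : M.carrier →ₗ[k] N.carrier →ₗ[k] P)
    (hf : ∀ m b n, f (M.ract b m) n = f m (N.lact b n)) : tensorCarrier M N →ₗ[k] P :=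
  (tensorRel M N).liftQ (TensorProduct.lift f) (by
    rw [tensorRel, Submodule.span_le]
    rintro x ⟨m, b, n, rfl⟩
    simp [hf])

variable {M N} in
theorem tensorLift_tmul {P : Type*} [AddCommGroup P] [Module k P]
    (f : M.carrier →ₗ[k] N.carrier →ₗ[k] P)
    (hf : ∀ m b n, f (M.ract b m) n = f m (N.lact b n)) (m : M.carrier) (n : N.carrier) :
    tensorLift f hf (tmul M N m n) = f m n := by
  simp [tensorLift, tmul]

variable {M N} in
theorem tensor_induction {p : tensorCarrier M N → Prop} (x : tensorCarrier M N) (zero : p 0)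
    (tmul : ∀ m n, p (tmul M N m n)) (add : ∀ x y, p x → p y → p (x + y)) : p x := by
  obtain ⟨x, rfl⟩ := (tensorRel M N).mkQ_surjective x
  induction x with
  | zero => simpa using zero
  | tmul m n => exact tmul m n
  | add x y hx hy => rw [map_add]; exact add _ _ hx hy

variable {M N} in
theorem tensor_ext {P : Type*} [AddCommGroup P] [Module k P] {f g : tensorCarrier M N →ₗ[k] P}
    (h : ∀ m n, f (tmul M N m n) = g (tmul M N m n)) : f = g :=
  LinearMap.ext fun x => tensor_induction (p := fun x => f x = g x) x
    ((map_zero f).trans (map_zero g).symm) h fun x y hx hy => by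
      rw [map_add, map_add, hx, hy]

def tensorLMap (a : A.carrier) : tensorCarrier M N →ₗ[k] tensorCarrier M N :=
  tensorLift ((tmulBilin M N).comp (M.lact a)) (fun m b n => by
    simp only [LinearMap.comp_apply, tmulBilin_apply, M.comm, tmul_balanced])

theorem tensorLMap_tmul (a : A.carrier) (m : M.carrier) (n : N.carrier) :
    tensorLMap M N a (tmul M N m n) = tmul M N (M.lact a m) n :=
  tensorLift_tmul _ _ m n

def tensorLact : A.carrier →ₐ[k] Module.End k (tensorCarrier M N) := AlgHom.ofLinearMap
  { toFun := tensorLMap M N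
    map_add' := fun a b => tensor_ext fun m n => by
      rw [LinearMap.add_apply, tensorLMap_tmul, tensorLMap_tmul, tensorLMap_tmul, map_add]
      simp only [← tmulBilin_apply, map_add, LinearMap.add_apply]
    map_smul' := fun c a => tensor_ext fun m n => by
      rw [RingHom.id_apply, LinearMap.smul_apply, tensorLMap_tmul, tensorLMap_tmul, map_smul]
      simp only [← tmulBilin_apply, map_smul, LinearMap.smul_apply] }
  (tensor_ext fun m n => by
    change tensorLMap M N 1 (tmul M N m n) = tmul M N m n
    rw [tensorLMap_tmul, map_one, Module.End.one_apply])
  (fun a b => tensor_ext fun m n => by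
    change tensorLMap M N (a * b) (tmul M N m n) =
      tensorLMap M N a (tensorLMap M N b (tmul M N m n))
    rw [tensorLMap_tmul, tensorLMap_tmul, tensorLMap_tmul, map_mul, Module.End.mul_apply])

theorem tensorLact_tmul (a : A.carrier) (m : M.carrier) (n : N.carrier) :
    tensorLact M N a (tmul M N m n) = tmul M N (M.lact a m) n :=
  tensorLMap_tmul M N a m n

def tensorRMap (d : D.carrier) : tensorCarrier M N →ₗ[k] tensorCarrier M N :=
  tensorLift ((tmulBilin M N).compl₂ (N.ract d)) (fun m b n => by
    simp only [LinearMap.compl₂_apply, tmulBilin_apply, ← N.comm, tmul_balanced])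

theorem tensorRMap_tmul (d : D.carrier) (m : M.carrier) (n : N.carrier) :
    tensorRMap M N d (tmul M N m n) = tmul M N m (N.ract d n) :=
  tensorLift_tmul _ _ m n

def tensorRact : D.carrier →ₐ[k] Module.End k (tensorCarrier M N) := AlgHom.ofLinearMap
  { toFun := tensorRMap M N
    map_add' := fun a b => tensor_ext fun m n => by
      rw [LinearMap.add_apply, tensorRMap_tmul, tensorRMap_tmul, tensorRMap_tmul, map_add]
      simp only [← tmulBilin_apply, map_add, LinearMap.add_apply]
    map_smul' := fun c a => tensor_ext fun m n => by
      rw [RingHom.id_apply, LinearMap.smul_apply, tensorRMap_tmul, tensorRMap_tmul, map_smul]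
      simp only [← tmulBilin_apply, map_smul, LinearMap.smul_apply] }
  (tensor_ext fun m n => by
    change tensorRMap M N 1 (tmul M N m n) = tmul M N m n
    rw [tensorRMap_tmul, map_one, Module.End.one_apply])
  (fun a b => tensor_ext fun m n => by
    change tensorRMap M N (a * b) (tmul M N m n) =
      tensorRMap M N a (tensorRMap M N b (tmul M N m n))
    rw [tensorRMap_tmul, tensorRMap_tmul, tensorRMap_tmul, map_mul, Module.End.mul_apply])

theorem tensorRact_tmul (d : D.carrier) (m : M.carrier) (n : N.carrier) :
    tensorRact M N d (tmul M N m n) = tmul M N m (N.ract d n) :=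
  tensorRMap_tmul M N d m n

/-- The part of degree `i` is spanned by the `m ⊗ n` with `deg m + deg n = i`. -/
def tensorGr (i : ℤ) : Submodule k (tensorCarrier M N) :=
  Submodule.span k {x | ∃ p q : ℤ, p + q = i ∧ ∃ m ∈ M.gr p, ∃ n ∈ N.gr q, x = tmul M N m n}

/-- The bilinear map `(m, n) ↦ ∑_p m_p ⊗ n_{i-p}`. -/
def tensorProjAux (i : ℤ) : M.carrier →ₗ[k] N.carrier →ₗ[k] tensorCarrier M N :=
  DirectSum.toModule k ℤ _ (fun p =>
    ((tmulBilin M N).compl₂ (grProj N.internal (i - p))).comp (M.gr p).subtype) ∘ₗ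
      (grEquiv M.internal).symm.toLinearMap

theorem tensorProjAux_of_mem (i p : ℤ) {m : M.carrier} (hm : m ∈ M.gr p) (n : N.carrier) :
    tensorProjAux M N i m n = tmul M N m (grProj N.internal (i - p) n) := by
  simp [tensorProjAux, grEquiv_symm_of_mem M.internal hm, tmulBilin_apply]

theorem tensorProjAux_balanced (i : ℤ) (m : M.carrier) (b : B.carrier) (n : N.carrier) :
    tensorProjAux M N i (M.ract b m) n = tensorProjAux M N i m (N.lact b n) := by
  refine gr_induction M.internal (p := fun m => tensorProjAux M N i (M.ract b m) n =
    tensorProjAux M N i m (N.lact b n)) m (fun p m hm => ?_) (by simp)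
    (fun x y hx hy => by simp [hx, hy])
  refine gr_induction B.internal (p := fun b => tensorProjAux M N i (M.ract b m) n =
    tensorProjAux M N i m (N.lact b n)) b (fun r b hb => ?_) (by simp)
    (fun x y hx hy => by simp [hx, hy])
  rw [tensorProjAux_of_mem M N i (r + p) (M.ract_mem hb hm), tensorProjAux_of_mem M N i p hm,
    tmul_balanced]
  congr 1
  refine gr_induction N.internal (p := fun n => N.lact b (grProj N.internal (i - (r + p)) n) =
    grProj N.internal (i - p) (N.lact b n)) n (fun q n hn => ?_) (by simp)
    (fun x y hx hy => by simp [hx, hy])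
  by_cases hq : q = i - (r + p)
  · subst hq
    rw [grProj_of_mem N.internal hn, grProj_of_mem N.internal]
    have := N.lact_mem hb hn
    rwa [show r + (i - (r + p)) = i - p by ring] at this
  · rw [grProj_of_mem_ne N.internal (Ne.symm hq) hn, map_zero,
      grProj_of_mem_ne N.internal _ (N.lact_mem hb hn)]
    omega

theorem tensorGr_internal : DirectSum.IsInternal (tensorGr M N) := by
  refine isInternal_of_proj _
    (fun i => tensorLift (tensorProjAux M N i) (tensorProjAux_balanced M N i)) ?_ ?_ ?_
  · intro i x hx
    refine Submodule.span_induction ?_ (by simp) (fun x y _ _ hx hy => by rw [map_add, hx, hy])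
      (fun c x _ hx => by rw [map_smul, hx]) hx
    rintro _ ⟨p, q, rfl, m, hm, n, hn, rfl⟩
    rw [tensorLift_tmul, tensorProjAux_of_mem M N _ p hm, add_sub_cancel_left,
      grProj_of_mem N.internal hn]
  · intro i j hij x hx
    refine Submodule.span_induction ?_ (by simp) (fun x y _ _ hx hy => by rw [map_add, hx, hy, add_zero])
      (fun c x _ hx => by rw [map_smul, hx, smul_zero]) hx
    rintro _ ⟨p, q, rfl, m, hm, n, hn, rfl⟩
    rw [tensorLift_tmul, tensorProjAux_of_mem M N _ p hm,
      grProj_of_mem_ne N.internal (by omega) hn, ← tmulBilin_apply, map_zero]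
  · rw [eq_top_iff]
    rintro x -
    refine tensor_induction x (zero_mem _) ?_ (fun x y hx hy => add_mem hx hy)
    intro m n
    refine gr_induction M.internal (p := fun m => tmul M N m n ∈ ⨆ i, tensorGr M N i) m
      (fun p m hm => ?_) (by simp [← tmulBilin_apply]) (fun x y hx hy => ?_)
    · refine gr_induction N.internal (p := fun n => tmul M N m n ∈ ⨆ i, tensorGr M N i) n
        (fun q n hn => ?_) (by simp [← tmulBilin_apply]) (fun x y hx hy => ?_)
      · exact Submodule.mem_iSup_of_mem (p + q)
          (Submodule.subset_span ⟨p, q, rfl, m, hm, n, hn, rfl⟩)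
      · rw [← tmulBilin_apply, map_add]; exact add_mem hx hy
    · rw [← tmulBilin_apply, map_add]; exact add_mem hx hy

/-- The tensor product `M ⊗_B N` of graded bimodules. -/
def tensor : GrBimod A D where
  carrier := tensorCarrier M N
  lact := tensorLact M N
  ract := tensorRact M N
  comm := fun a d x => tensor_induction (p := fun x => tensorLact M N a (tensorRact M N d x) =
      tensorRact M N d (tensorLact M N a x)) x (by simp)
    (fun m n => by simp only [tensorLact_tmul, tensorRact_tmul])
    (fun x y hx hy => by simp [hx, hy])
  gr := tensorGr M N
  internal := tensorGr_internal M N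
  lact_mem := fun {i j a x} ha hx => by
    refine Submodule.span_induction ?_ (by simp) (fun x y _ _ hx hy => by rw [map_add]; exact add_mem hx hy)
      (fun c x _ hx => by rw [map_smul]; exact Submodule.smul_mem _ _ hx) hx
    rintro _ ⟨p, q, rfl, m, hm, n, hn, rfl⟩
    rw [tensorLact_tmul]
    exact Submodule.subset_span ⟨i + p, q, by ring, _, M.lact_mem ha hm, n, hn, rfl⟩
  ract_mem := fun {i j a x} ha hx => by
    refine Submodule.span_induction ?_ (by simp) (fun x y _ _ hx hy => by rw [map_add]; exact add_mem hx hy)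
      (fun c x _ hx => by rw [map_smul]; exact Submodule.smul_mem _ _ hx) hx
    rintro _ ⟨p, q, rfl, m, hm, n, hn, rfl⟩
    rw [tensorRact_tmul]
    exact Submodule.subset_span ⟨p, i + q, by ring, m, hm, _, N.ract_mem ha hn, rfl⟩

end GrBimod

/-! ### The algebra of regular functions of a representation -/

section Sym

/-- The grading of the symmetric algebra of `E` with `E` in degree `2`. -/
def symGr (k : Type u) [Field k] (E : Type*) [AddCommGroup E] [Module k E] (n : ℤ) :
    Submodule k (SymmetricAlgebra k E) :=
  ⨆ (m : ℕ) (_ : 2 * (m : ℤ) = n), LinearMap.range (SymmetricAlgebra.ι k E) ^ m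

variable {k : Type u} [Field k] {E F : Type*} [AddCommGroup E] [Module k E]
  [AddCommGroup F] [Module k F]

theorem pow_le_symGr (m : ℕ) :
    LinearMap.range (SymmetricAlgebra.ι k E) ^ m ≤ symGr k E (2 * m) :=
  le_iSup₂_of_le (f := fun (m' : ℕ) (_ : 2 * (m' : ℤ) = 2 * (m : ℤ)) =>
    LinearMap.range (SymmetricAlgebra.ι k E) ^ m') m rfl le_rfl

theorem symGr_induction {n : ℤ} {p : SymmetricAlgebra k E → Prop} {a : SymmetricAlgebra k E}
    (ha : a ∈ symGr k E n)
    (pow : ∀ m : ℕ, 2 * (m : ℤ) = n →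
      ∀ a ∈ LinearMap.range (SymmetricAlgebra.ι k E) ^ m, p a)
    (zero : p 0) (add : ∀ a b, p a → p b → p (a + b)) : p a := by
  refine Submodule.iSup_induction _ (motive := p) ha ?_ zero add
  intro m x hx
  exact Submodule.iSup_induction _ (motive := p) hx (fun h y hy => pow m h y hy) zero add

theorem symGr_mul {i j : ℤ} {a b : SymmetricAlgebra k E} (ha : a ∈ symGr k E i)
    (hb : b ∈ symGr k E j) : a * b ∈ symGr k E (i + j) := by
  refine symGr_induction (p := fun a => a * b ∈ symGr k E (i + j)) ha ?_ (by simp)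
    (fun x y hx hy => by rw [add_mul]; exact add_mem hx hy)
  rintro m rfl a ha
  refine symGr_induction (p := fun b => a * b ∈ symGr k E (2 * (m : ℤ) + j)) hb ?_ (by simp)
    (fun x y hx hy => by rw [mul_add]; exact add_mem hx hy)
  rintro m' rfl b hb
  have h := pow_le_symGr (k := k) (E := E) (m + m') (by
    rw [pow_add]; exact Submodule.mul_mem_mul ha hb)
  rwa [show 2 * (m : ℤ) + 2 * (m' : ℤ) = 2 * ((m + m' : ℕ) : ℤ) by push_cast; ring]

theorem one_mem_symGr : (1 : SymmetricAlgebra k E) ∈ symGr k E 0 :=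
  pow_le_symGr (k := k) (E := E) 0 (by simp)

theorem iSup_symGr : ⨆ n, symGr k E n = ⊤ := by
  rw [eq_top_iff]
  rintro a -
  induction a using SymmetricAlgebra.induction with
  | algebraMap r =>
    rw [Algebra.algebraMap_eq_smul_one]
    exact Submodule.smul_mem _ _ (Submodule.mem_iSup_of_mem 0 one_mem_symGr)
  | ι x =>
    exact Submodule.mem_iSup_of_mem _ (pow_le_symGr (k := k) (E := E) 1 (by simp))
  | mul a b ha hb =>
    refine Submodule.iSup_induction _ (motive := fun a => a * b ∈ ⨆ n, symGr k E n) ha ?_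
      (by simp) (fun x y hx hy => by rw [add_mul]; exact add_mem hx hy)
    intro i a ha
    refine Submodule.iSup_induction _ (motive := fun b => a * b ∈ ⨆ n, symGr k E n) hb ?_
      (by simp) (fun x y hx hy => by rw [mul_add]; exact add_mem hx hy)
    intro j b hb
    exact Submodule.mem_iSup_of_mem _ (symGr_mul ha hb)
  | add a b ha hb => exact add_mem ha hb

/-- The homomorphism `x ↦ x T²` for `x ∈ E`, which separates the degrees. -/
def symDelta (k : Type u) [Field k] (E : Type*) [AddCommGroup E] [Module k E] :
    SymmetricAlgebra k E →ₐ[k] (SymmetricAlgebra k E)[T;T⁻¹] :=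
  SymmetricAlgebra.lift
    { toFun := fun x => LaurentPolynomial.C (SymmetricAlgebra.ι k E x) * LaurentPolynomial.T 2
      map_add' := fun x y => by simp [add_mul]
      map_smul' := fun c x => by
        rw [map_smul, Algebra.smul_def, Algebra.smul_def, LaurentPolynomial.algebraMap_apply,
          map_mul, mul_assoc, RingHom.id_apply] }

theorem symDelta_of_mem {n : ℤ} {a : SymmetricAlgebra k E} (ha : a ∈ symGr k E n) :
    symDelta k E a = LaurentPolynomial.C a * LaurentPolynomial.T n := by
  refine symGr_induction (p := fun a => symDelta k E a =
    LaurentPolynomial.C a * LaurentPolynomial.T n) ha ?_ (by simp)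
    (fun x y hx hy => by rw [map_add, hx, hy, map_add, add_mul])
  clear ha a
  rintro m rfl a ha
  induction ha using Submodule.pow_induction_on_left' with
  | algebraMap r =>
    rw [AlgHom.commutes, LaurentPolynomial.algebraMap_apply, Nat.cast_zero, mul_zero,
      LaurentPolynomial.T_zero, mul_one]
  | add x y i hx hy ihx ihy => rw [map_add, ihx, ihy, map_add, add_mul]
  | mem_mul m hm i x hx ih =>
    obtain ⟨y, rfl⟩ := hm
    rw [map_mul, ih, symDelta, SymmetricAlgebra.lift_ι_apply]
    simp only [LinearMap.coe_mk, AddHom.coe_mk, map_mul]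
    rw [show 2 * ((i + 1 : ℕ) : ℤ) = 2 + 2 * (i : ℤ) by push_cast; ring, LaurentPolynomial.T_add]
    ring

theorem symGr_internal : DirectSum.IsInternal (symGr k E) := by
  refine isInternal_of_proj _ (fun i =>
    { toFun := fun a => (symDelta k E a).coeff i
      map_add' := fun a b => by rw [map_add]; rfl
      map_smul' := fun c a => by rw [map_smul]; rfl }) ?_ ?_ iSup_symGr
  · intro i a ha
    change (symDelta k E a).coeff i = a
    rw [symDelta_of_mem ha, ← LaurentPolynomial.single_eq_C_mul_T]
    exact Finsupp.single_eq_same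
  · intro i j hij a ha
    change (symDelta k E a).coeff i = 0
    rw [symDelta_of_mem ha, ← LaurentPolynomial.single_eq_C_mul_T]
    exact Finsupp.single_eq_of_ne hij

/-- The homomorphism of symmetric algebras induced by a linear map. -/
def symMap (f : E →ₗ[k] F) : SymmetricAlgebra k E →ₐ[k] SymmetricAlgebra k F :=
  SymmetricAlgebra.lift (SymmetricAlgebra.ι k F ∘ₗ f)

theorem symMap_mem (f : E →ₗ[k] F) (n : ℤ) (a : SymmetricAlgebra k E) (ha : a ∈ symGr k E n) :
    symMap f a ∈ symGr k F n := by
  refine symGr_induction (p := fun a => symMap f a ∈ symGr k F n) ha ?_ (by simp)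
    (fun x y hx hy => by rw [map_add]; exact add_mem hx hy)
  rintro m rfl a ha
  refine pow_le_symGr m ?_
  have h : (LinearMap.range (SymmetricAlgebra.ι k E)).map (symMap f).toLinearMap ≤
      LinearMap.range (SymmetricAlgebra.ι k F) := by
    rintro _ ⟨_, ⟨x, rfl⟩, rfl⟩
    exact ⟨f x, by simp [symMap]⟩
  have h2 := pow_le_pow_left' h m
  rw [← Submodule.map_pow] at h2
  exact h2 ⟨a, ha, rfl⟩

end Sym

section Rep

variable {k : Type u} [Field k] {W : Type*} [Group W] {U : Type v} [AddCommGroup U] [Module k U]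

/-- The graded algebra `R(U) = S(U^*)` of regular functions on `U`, with `U^*` in degree `2`. -/
def regFun (k : Type u) [Field k] (U : Type v) [AddCommGroup U] [Module k U] :
    GrAlg.{u, max u v} k where
  carrier := SymmetricAlgebra k (Module.Dual k U)
  gr := symGr k (Module.Dual k U)
  one_mem := one_mem_symGr
  mul_mem := symGr_mul
  internal := symGr_internal

/-- The action of `w ∈ W` on `R(U)` by functoriality. -/
def regAct (ρ : Representation k W U) (w : W) : GrAlg.Hom (regFun k U) (regFun k U) where
  toAlgHom := symMap (ρ.dual w)
  map_mem := symMap_mem _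

/-- The fixed points of a graded algebra endomorphism. -/
def fixedAlg {A : GrAlg.{u, v} k} (φ : GrAlg.Hom A A) : GrAlg.{u, v} k where
  carrier := AlgHom.equalizer φ.toAlgHom (AlgHom.id k A.carrier)
  gr := fun i => (A.gr i).comap (AlgHom.equalizer φ.toAlgHom (AlgHom.id k A.carrier)).val.toLinearMap
  one_mem := A.one_mem
  mul_mem := fun ha hb => A.mul_mem ha hb
  internal := by
    have hφ : ∀ i a, φ.toAlgHom (grProj A.internal i a) = grProj A.internal i (φ.toAlgHom a) := by
      intro i a
      refine gr_induction A.internal (p := fun a => φ.toAlgHom (grProj A.internal i a) =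
        grProj A.internal i (φ.toAlgHom a)) a ?_ (by simp) (fun x y hx hy => by simp [hx, hy])
      intro j a ha
      by_cases h : i = j
      · subst h
        rw [grProj_of_mem _ ha, grProj_of_mem _ (φ.map_mem _ _ ha)]
      · rw [grProj_of_mem_ne _ h ha, grProj_of_mem_ne _ h (φ.map_mem _ _ ha), map_zero]
    have hmem : ∀ i, ∀ a ∈ AlgHom.equalizer φ.toAlgHom (AlgHom.id k A.carrier),
        grProj A.internal i a ∈ AlgHom.equalizer φ.toAlgHom (AlgHom.id k A.carrier) := by
      intro i a ha
      rw [AlgHom.mem_equalizer] at ha ⊢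
      rw [hφ, ha]; rfl
    refine isInternal_of_proj _ (fun i =>
      { toFun := fun a => ⟨grProj A.internal i a.1, hmem i a.1 a.2⟩
        map_add' := fun a b => Subtype.ext (by simp)
        map_smul' := fun c a => Subtype.ext (by simp) })
      (fun i a ha => Subtype.ext (grProj_of_mem _ ha))
      (fun i j hij a ha => Subtype.ext (grProj_of_mem_ne _ hij ha)) ?_
    rw [eq_top_iff]
    rintro a -
    obtain ⟨s, hs⟩ := exists_sum_grProj A.internal a.1
    have e : a = ∑ i ∈ s, (⟨grProj A.internal i a.1, hmem i a.1 a.2⟩ :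
        AlgHom.equalizer φ.toAlgHom (AlgHom.id k A.carrier)) := by
      refine Subtype.ext ((hs s (Finset.Subset.refl s)).trans ?_)
      simp
    rw [e]
    exact Submodule.sum_mem _ fun i _ => Submodule.mem_iSup_of_mem i
      (show grProj A.internal i a.1 ∈ A.gr i from grProj_mem _ _ _)

/-- The inclusion of the fixed points. -/
def fixedIncl {A : GrAlg.{u, v} k} (φ : GrAlg.Hom A A) : GrAlg.Hom (fixedAlg φ) A where
  toAlgHom := (AlgHom.equalizer φ.toAlgHom (AlgHom.id k A.carrier)).val
  map_mem := fun _ _ ha => ha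

end Rep

/-! ### Soergel bimodules -/

section Main

variable {k : Type u} [Field k] {B W : Type*} [Group W] {C : CoxeterMatrix B}
  (cs : CoxeterSystem C W) {U : Type v} [AddCommGroup U] [Module k U]

open GrBimod

/-- `θ_s = R ⊗_{R^s} R`. -/
def theta (ρ : Representation k W U) (i : B) : GrBimod (regFun k U) (regFun k U) :=
  tensor (B := fixedAlg (regAct ρ (cs.simple i)))
    (ofAlg (GrAlg.Hom.id _) (fixedIncl (regAct ρ (cs.simple i))))
    (ofAlg (fixedIncl (regAct ρ (cs.simple i))) (GrAlg.Hom.id _))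

/-- `θ_{s_1} ⊗_R ⋯ ⊗_R θ_{s_n}`, which is `R` for the empty word. -/
def thetaWord (ρ : Representation k W U) : List B → GrBimod (regFun k U) (regFun k U)
  | [] => unit (regFun k U)
  | i :: ω => tensor (theta cs ρ i) (thetaWord ρ ω)

/-- The objects of the Soergel category `B_k(U)`: the direct factors of finite direct sums of
shifts `θ_{s_1} ⋯ θ_{s_n}(d)`. -/
def IsSoergel (ρ : Representation k W U) (M : GrBimod (regFun k U) (regFun k U)) : Prop :=
  ∃ (l : List (List B × ℤ)) (N : GrBimod (regFun k U) (regFun k U)),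
    Iso (directSum M N) (GrBimod.sum (l.map fun p => shift (thetaWord cs ρ p.1) p.2))

/-- Indecomposable objects of the full subcategory of graded bimodules with objects `P`. -/
def IsIndecomposableIn {A : GrAlg.{u, v} k} (P : GrBimod A A → Prop) (M : GrBimod A A) : Prop :=
  P M ∧ ¬ Subsingleton M.carrier ∧ ∀ M₁ M₂ : GrBimod A A, P M₁ → P M₂ →
    Iso M (directSum M₁ M₂) → Subsingleton M₁.carrier ∨ Subsingleton M₂.carrier

/-- A linear map acts as a reflection: its fixed space is a hyperplane. (Only used for maps whose
square is the identity.) -/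
def ActsAsReflection (f : Module.End k U) : Prop :=
  Module.finrank k (LinearMap.ker (f - 1)) + 1 = Module.finrank k U

/-- For all `s_1, …, s_n`: if `τ((1 + T_{s_1}) ⋯ (1 + T_{s_n})) = ∑ n_i q^i`, then
`Hom(θ_{s_1} ⋯ θ_{s_n}, R) ≃ ⨁_i R(2i)^{n_i}` as graded right `R`-modules. The summand of index
`j = (i, _)` is `R(2i)`, whose part of degree `d` is `R_{d + 2i}`. -/
def HomFormula (ρ : Representation k W U) : Prop :=
  ∀ ω : List B, ∃ n : ℤ →₀ ℕ,
    heckeTau cs (ω.map fun i => 1 + heckeT cs i).prod =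
        n.sum (fun i c => c • LaurentPolynomial.T (-2 * i)) ∧
    ∃ e : hom (thetaWord cs ρ ω) (unit (regFun k U)) ≃ₗ[k]
        ((Σ i : ℤ, Fin (n i)) →₀ (regFun k U).carrier),
      (∀ f b j, e (homRact f b) j = e f j * b) ∧
      ∀ f d, HasDegree f d ↔ ∀ j, e f j ∈ (regFun k U).gr (d + 2 * j.1)

/-- Good pairs `(U, U')`: the simple reflections act as reflections on `U` and on its
subrepresentation `U'`, and `U` satisfies the formula for `Hom(θ_{s_1} ⋯ θ_{s_n}, R)`. -/
structure IsGoodPair (ρ : Representation k W U) (σ : Subrepresentation ρ) : Prop where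
  refl : ∀ i, ActsAsReflection (ρ (cs.simple i))
  refl_sub : ∀ i, ActsAsReflection (σ.toRepresentation (cs.simple i))
  homFormula : HomFormula cs ρ

/-- The restriction of functions `Q : R(V) → R(V')`. -/
def restr (V' : Submodule k U) : GrAlg.Hom (regFun k U) (regFun k V') where
  toAlgHom := symMap V'.dualRestrict
  map_mem := symMap_mem _

/-- `𝔛(M) = R' ⊗_R M ⊗_R R'`. -/
def reduction (V' : Submodule k U) (M : GrBimod (regFun k U) (regFun k U)) :
    GrBimod (regFun k V') (regFun k V') :=
  tensor (tensor (ofAlg (GrAlg.Hom.id _) (restr V')) M) (ofAlg (restr V') (GrAlg.Hom.id _))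

end Main

end Soergel

end

noncomputable section

open scoped TensorProduct LaurentPolynomial

namespace Soergel

universe u v w

/-! ### Induction along a reflection -/

section Ind

open GrBimod

variable {k : Type u} [Field k] {A : GrAlg.{u, v} k}

/-! Let I be the kernel of R → R'. The functor 𝔛 sends M to M/(IM + MI) (`isRed_toReduced`) and
carries a product of the θ_s over V to the same product over V' (`isRed_redWord`), so it maps
Soergel bimodules to Soergel bimodules. For indecomposability it suffices that 𝔛 is full on them
(`lifts_redWord`, `IsSoergel.lifts`). Indeed I lives in positive degrees, and a Soergel bimodule is
bounded below and generated in bounded degrees, so a degree-0 endomorphism killed by 𝔛 is nilpotent.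
Hence idempotents lift from 𝔛(M) to M, and 𝔛 kills no nonzero Soergel bimodule.

As θ_s is self-adjoint up to a shift, fullness reduces to morphisms out of R, that is, to lifting
central elements of 𝔛(θ_{s_1}⋯θ_{s_n}) to central elements (`LeafFamily.exists_central`). This rests
on a light leaf basis: θ_{s_1}⋯θ_{s_n} is free as a left R-module on the values b_j = f_j(1⊗⋯⊗1) of
morphisms f_j out of reduced words u_j. Coefficients are read off by functionals of twist x ∈ W, the
maps g to R or R' with g(a m b) = a x(b) g(m). A nonzero functional on a word has for twist either
the product of the word or an element shorter than the word (`IsFun.eq_zero_or`), which makes the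
basis triangular for the length. As W is faithful on V', a functional to R' of twist x ≠ 1 kills
everything that is central modulo IM + MI. Such an element therefore has coefficients in I at all
b_j with u_j nonempty, and the other b_j are images of 1 ∈ R, hence central.

Leaves are built one letter at a time, which requires passing between reduced words of one element
by morphisms that preserve 1⊗⋯⊗1. By `matsumoto` only braid relations matter, and this is where the
Hom formula enters. If pq has order m, the coefficient of q^m in τ of the alternating product of 2m
factors is positive, so there is a nonzero morphism of degree -2m from the alternating word of
length 2m to R. Moving m letters across by adjunction gives a degree-0 morphism between the two
alternating words of length m. It multiplies 1⊗⋯⊗1 by a scalar, and if this scalar were 0 the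
original morphism would have degree greater than -2m (`DegreeBound.long`). -/

theorem GrBimod.lact_lact {B : GrAlg.{u, v} k} (M : GrBimod A B) (a b : A.carrier)
    (m : M.carrier) : M.lact a (M.lact b m) = M.lact (a * b) m := by
  rw [map_mul, Module.End.mul_apply]

theorem GrBimod.ract_ract {B : GrAlg.{u, v} k} (M : GrBimod A B) (a b : B.carrier)
    (m : M.carrier) : M.ract a (M.ract b m) = M.ract (a * b) m := by
  rw [map_mul, Module.End.mul_apply]

theorem GrBimod.lact_one {B : GrAlg.{u, v} k} (M : GrBimod A B) (m : M.carrier) :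
    M.lact 1 m = m := by rw [map_one, Module.End.one_apply]

theorem GrBimod.ract_one {B : GrAlg.{u, v} k} (M : GrBimod A B) (m : M.carrier) :
    M.ract 1 m = m := by rw [map_one, Module.End.one_apply]

theorem GrBimod.lact_add {B : GrAlg.{u, v} k} (M : GrBimod A B) (a b : A.carrier)
    (m : M.carrier) : M.lact (a + b) m = M.lact a m + M.lact b m := by
  rw [map_add, LinearMap.add_apply]

theorem GrBimod.lact_sub {B : GrAlg.{u, v} k} (M : GrBimod A B) (a b : A.carrier)
    (m : M.carrier) : M.lact (a - b) m = M.lact a m - M.lact b m := by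
  rw [map_sub, LinearMap.sub_apply]

/-- `φ` is an involution of `A` that behaves as a reflection with root `α`. -/
structure IsRefl (φ : GrAlg.Hom A A) (α : A.carrier) : Prop where
  mem : α ∈ A.gr 2
  invol : ∀ a, φ.toAlgHom (φ.toAlgHom a) = a
  neg : φ.toAlgHom α = -α
  dvd : ∀ a, ∃ b, a - φ.toAlgHom a = α * b
  cancel : ∀ a, α * a = 0 → a = 0

/-- The class of `m ⊗ n`, as a bilinear map. -/
def tm {B D : GrAlg.{u, v} k} (M : GrBimod A B) (N : GrBimod B D) :
    M.carrier →ₗ[k] N.carrier →ₗ[k] (tensor M N).carrier := tmulBilin M N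

section

variable {B D : GrAlg.{u, v} k} (M : GrBimod A B) (N : GrBimod B D)

theorem tm_balanced (m : M.carrier) (b : B.carrier) (n : N.carrier) :
    tm M N (M.ract b m) n = tm M N m (N.lact b n) := tmul_balanced M N m b n

theorem lact_tm (a : A.carrier) (m : M.carrier) (n : N.carrier) :
    (tensor M N).lact a (tm M N m n) = tm M N (M.lact a m) n := tensorLact_tmul M N a m n

theorem ract_tm (d : D.carrier) (m : M.carrier) (n : N.carrier) :
    (tensor M N).ract d (tm M N m n) = tm M N m (N.ract d n) := tensorRact_tmul M N d m n

theorem tm_mem {i j : ℤ} {m : M.carrier} {n : N.carrier} (hm : m ∈ M.gr i) (hn : n ∈ N.gr j) :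
    tm M N m n ∈ (tensor M N).gr (i + j) :=
  show tmul M N m n ∈ tensorGr M N (i + j) from
    Submodule.subset_span ⟨i, j, rfl, m, hm, n, hn, rfl⟩

variable {M N}

theorem tm_induction {p : (tensor M N).carrier → Prop} (x : (tensor M N).carrier) (zero : p 0)
    (tmul : ∀ m n, p (tm M N m n)) (add : ∀ x y, p x → p y → p (x + y)) : p x :=
  tensor_induction x zero tmul add

/-- Linear maps out of a tensor product. -/
def tmLift {P : Type*} [AddCommGroup P] [Module k P] (f : M.carrier →ₗ[k] N.carrier →ₗ[k] P)
    (hf : ∀ m b n, f (M.ract b m) n = f m (N.lact b n)) : (tensor M N).carrier →ₗ[k] P :=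
  tensorLift f hf

theorem tmLift_tm {P : Type*} [AddCommGroup P] [Module k P]
    (f : M.carrier →ₗ[k] N.carrier →ₗ[k] P)
    (hf : ∀ m b n, f (M.ract b m) n = f m (N.lact b n)) (m : M.carrier) (n : N.carrier) :
    tmLift f hf (tm M N m n) = f m n := tensorLift_tmul f hf m n

end

theorem ofAlg_lact {B E : GrAlg.{u, v} k} (f : GrAlg.Hom A E) (g : GrAlg.Hom B E) (a : A.carrier)
    (e : E.carrier) : (ofAlg f g).lact a e = f.toAlgHom a * e := rfl

theorem ofAlg_ract {B E : GrAlg.{u, v} k} (f : GrAlg.Hom A E) (g : GrAlg.Hom B E) (b : B.carrier)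
    (e : E.carrier) : (ofAlg f g).ract b e = g.toAlgHom b * e := rfl

/-- The bimodule `A ⊗_{A^φ} A`. -/
abbrev thetaOf (φ : GrAlg.Hom A A) : GrBimod A A :=
  tensor (B := fixedAlg φ) (ofAlg (GrAlg.Hom.id _) (fixedIncl φ))
    (ofAlg (fixedIncl φ) (GrAlg.Hom.id _))

/-- The element `a ⊗ b` of `A ⊗_{A^φ} A`. -/
def th (φ : GrAlg.Hom A A) : A.carrier →ₗ[k] A.carrier →ₗ[k] (thetaOf φ).carrier :=
  tm (B := fixedAlg φ) (ofAlg (GrAlg.Hom.id _) (fixedIncl φ))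
    (ofAlg (fixedIncl φ) (GrAlg.Hom.id _))

/-- The bimodule `A ⊗_{A^φ} N`. -/
abbrev Ind (φ : GrAlg.Hom A A) (N : GrBimod A A) : GrBimod A A := tensor (thetaOf φ) N

/-- The map `n ↦ 1 ⊗ n`. -/
def ind (φ : GrAlg.Hom A A) (N : GrBimod A A) : N.carrier →ₗ[k] (Ind φ N).carrier :=
  tm (thetaOf φ) N (th φ 1 1)

variable {φ : GrAlg.Hom A A} {α : A.carrier}

theorem lact_th (a b c : A.carrier) : (thetaOf φ).lact a (th φ b c) = th φ (a * b) c :=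
  (lact_tm (B := fixedAlg φ) (ofAlg (GrAlg.Hom.id _) (fixedIncl φ))
    (ofAlg (fixedIncl φ) (GrAlg.Hom.id _)) a b c).trans
      (congrArg (fun z : A.carrier => th φ z c) (ofAlg_lact (GrAlg.Hom.id _) (fixedIncl φ) a b))

theorem ract_th (a b c : A.carrier) : (thetaOf φ).ract a (th φ b c) = th φ b (a * c) :=
  (ract_tm (B := fixedAlg φ) (ofAlg (GrAlg.Hom.id _) (fixedIncl φ))
    (ofAlg (fixedIncl φ) (GrAlg.Hom.id _)) a b c).trans
      (congrArg (fun z : A.carrier => th φ b z) (ofAlg_ract (fixedIncl φ) (GrAlg.Hom.id _) a c))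

theorem th_balanced (a b : A.carrier) {r : A.carrier} (hr : φ.toAlgHom r = r) :
    th φ (r * a) b = th φ a (r * b) :=
  tm_balanced (B := fixedAlg φ) (ofAlg (GrAlg.Hom.id _) (fixedIncl φ))
    (ofAlg (fixedIncl φ) (GrAlg.Hom.id _)) a ⟨r, hr⟩ b

theorem th_induction {p : (thetaOf φ).carrier → Prop} (x : (thetaOf φ).carrier) (zero : p 0)
    (tmul : ∀ a b, p (th φ a b)) (add : ∀ x y, p x → p y → p (x + y)) : p x :=
  tm_induction x zero tmul add

theorem th_mem {i j : ℤ} {a b : A.carrier} (ha : a ∈ A.gr i) (hb : b ∈ A.gr j) :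
    th φ a b ∈ (thetaOf φ).gr (i + j) :=
  tm_mem (B := fixedAlg φ) (ofAlg (GrAlg.Hom.id _) (fixedIncl φ))
    (ofAlg (fixedIncl φ) (GrAlg.Hom.id _)) ha hb

/-- Linear maps out of `A ⊗_{A^φ} A`. -/
def thLift {P : Type*} [AddCommGroup P] [Module k P] (f : A.carrier →ₗ[k] A.carrier →ₗ[k] P)
    (hf : ∀ a r b, φ.toAlgHom r = r → f (r * a) b = f a (r * b)) : (thetaOf φ).carrier →ₗ[k] P :=
  tmLift (B := fixedAlg φ) (M := ofAlg (GrAlg.Hom.id _) (fixedIncl φ))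
    (N := ofAlg (fixedIncl φ) (GrAlg.Hom.id _)) f (fun a r b => hf a r.1 b r.2)

theorem thLift_th {P : Type*} [AddCommGroup P] [Module k P]
    (f : A.carrier →ₗ[k] A.carrier →ₗ[k] P)
    (hf : ∀ a r b, φ.toAlgHom r = r → f (r * a) b = f a (r * b)) (a b : A.carrier) :
    thLift (φ := φ) f hf (th φ a b) = f a b := 
  tmLift_tm (B := fixedAlg φ) (M := ofAlg (GrAlg.Hom.id _) (fixedIncl φ))
    (N := ofAlg (fixedIncl φ) (GrAlg.Hom.id _)) f (fun a r b => hf a r.1 b r.2) a b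

theorem ind_ract (N : GrBimod A A) (b : A.carrier) (n : N.carrier) :
    ind φ N (N.ract b n) = (Ind φ N).ract b (ind φ N n) :=
  (ract_tm _ _ _ _ _).symm

theorem lact_ind_lact (N : GrBimod A A) (a b : A.carrier) (n : N.carrier) :
    (Ind φ N).lact a (ind φ N (N.lact b n)) = tm (thetaOf φ) N (th φ a b) n := by
  rw [ind, lact_tm, lact_th, mul_one, ← tm_balanced, ract_th, mul_one]

theorem ind_lact (N : GrBimod A A) {r : A.carrier} (hr : φ.toAlgHom r = r) (n : N.carrier) :
    ind φ N (N.lact r n) = (Ind φ N).lact r (ind φ N n) := by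
  have h := lact_ind_lact (φ := φ) N 1 r n
  have h2 := lact_ind_lact (φ := φ) N r 1 n
  rw [lact_one] at h h2
  rw [h, h2, ← mul_one r, ← th_balanced 1 1 hr, mul_one]

namespace IsRefl

variable (h : IsRefl φ α)
include h

theorem map_sq : φ.toAlgHom (α * α) = α * α := by rw [map_mul, h.neg]; ring

/-- The invariant part of `a`. -/
theorem exists_decomp (hk : (2 : k) ≠ 0) : ∃ p d : A.carrier →ₗ[k] A.carrier,
    (∀ a, φ.toAlgHom (p a) = p a) ∧ (∀ a, φ.toAlgHom (d a) = d a) ∧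
    ∀ a, a = p a + α * d a := by
  choose b hb using h.dvd
  have inj : ∀ x y, α * x = α * y → x = y := fun x y hxy =>
    sub_eq_zero.1 (h.cancel _ (by rw [mul_sub, hxy, sub_self]))
  have hφb : ∀ a, φ.toAlgHom (b a) = b a := by
    intro a
    refine inj _ _ ?_
    have e := congrArg φ.toAlgHom (hb a)
    rw [map_sub, h.invol, map_mul, h.neg] at e
    rw [← hb a, ← neg_sub, e]
    ring
  -- Here p = (id + φ)/2, and d(a) is half of the quotient of a - φ(a) by α; cancelling α makes d
  -- linear.
  refine ⟨(2 : k)⁻¹ • (LinearMap.id + φ.toAlgHom.toLinearMap), (2 : k)⁻¹ •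
    { toFun := b
      map_add' := fun x y => inj _ _ (by rw [mul_add, ← hb, ← hb, ← hb, map_add]; ring)
      map_smul' := fun c x => inj _ _ (by
        rw [RingHom.id_apply, mul_smul_comm, ← hb, ← hb, map_smul, smul_sub]) }, ?_, ?_, ?_⟩
  · intro a
    simp only [LinearMap.smul_apply, LinearMap.add_apply, LinearMap.id_apply,
      AlgHom.toLinearMap_apply, map_smul, map_add, h.invol]
    rw [add_comm]
  · intro a
    simp only [LinearMap.smul_apply, LinearMap.coe_mk, AddHom.coe_mk, map_smul, hφb]
  · intro a
    simp only [LinearMap.smul_apply, LinearMap.add_apply, LinearMap.id_apply,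
      AlgHom.toLinearMap_apply, LinearMap.coe_mk, AddHom.coe_mk, mul_smul_comm, ← hb]
    rw [← smul_add, add_add_sub_cancel, ← two_smul k a, smul_smul, inv_mul_cancel₀ hk, one_smul]

theorem decomp_unique (hk : (2 : k) ≠ 0) {p d p' d' : A.carrier} (hp : φ.toAlgHom p = p)
    (hd : φ.toAlgHom d = d) (hp' : φ.toAlgHom p' = p') (hd' : φ.toAlgHom d' = d')
    (e : p + α * d = p' + α * d') : p = p' ∧ d = d' := by
  have e2 := congrArg φ.toAlgHom e
  simp only [map_add, map_mul, hp, hd, hp', hd', h.neg] at e2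
  have e3 : (2 : k) • p = (2 : k) • p' := by
    rw [two_smul, two_smul]; linear_combination e + e2
  have e4 : p = p' := by
    have := congrArg (fun z => (2 : k)⁻¹ • z) e3
    simpa [smul_smul, inv_mul_cancel₀ hk] using this
  refine ⟨e4, sub_eq_zero.1 (h.cancel _ ?_)⟩
  subst e4
  linear_combination e

/-- The coordinates of an element of `A ⊗_{A^φ} N` with respect to `1` and `α`. -/
theorem exists_coord (hk : (2 : k) ≠ 0) (N : GrBimod A A) :
    ∃ e : (Ind φ N).carrier ≃ₗ[k] N.carrier × N.carrier, ∀ n₀ n₁,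
      e.symm (n₀, n₁) = ind φ N n₀ + (Ind φ N).lact α (ind φ N n₁) := by
  obtain ⟨p, d, hp, hd, hpd⟩ := h.exists_decomp hk
  let G : N.carrier × N.carrier →ₗ[k] (Ind φ N).carrier :=
    (ind φ N).coprod ((Ind φ N).lact α ∘ₗ ind φ N)
  have p_mul : ∀ r, φ.toAlgHom r = r → ∀ a, p (a * r) = p a * r ∧ d (a * r) = d a * r := by
    intro r hr a
    refine h.decomp_unique hk (hp _) (hd _) (by rw [map_mul, hp, hr]) (by rw [map_mul, hd, hr]) ?_
    rw [← hpd (a * r)]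
    conv_lhs => rw [hpd a]
    ring
  have p1 : p 1 = 1 ∧ d 1 = 0 := by
    refine h.decomp_unique hk (hp _) (hd _) (map_one _) (map_zero _) ?_
    rw [← hpd]; simp
  have pα : p α = 0 ∧ d α = 1 := by
    refine h.decomp_unique hk (hp _) (hd _) (map_zero _) (map_one _) ?_
    rw [← hpd]; simp
  -- The inverse of `G` sends a ⊗ b ⊗ n to (p(a) b n, d(a) b n), where a = p(a) + α d(a) is the
  -- unique decomposition over the invariants.
  let F₁ : (thetaOf φ).carrier →ₗ[k] (N.carrier →ₗ[k] N.carrier × N.carrier) :=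
    thLift (LinearMap.mk₂ k (fun a b : A.carrier => (N.lact (p a * b)).prod (N.lact (d a * b)))
        (fun a a' b => by ext n <;> simp [add_mul])
        (fun c a b => by ext n <;> simp)
        (fun a b b' => by ext n <;> simp [mul_add])
        (fun c a b => by ext n <;> simp)) (by
      intro a r b hr
      simp only [LinearMap.mk₂_apply, mul_comm r a, (p_mul r hr a).1, (p_mul r hr a).2, mul_assoc])
  have F₁_th : ∀ a b : A.carrier, F₁ (th φ a b) =
      (N.lact (p a * b)).prod (N.lact (d a * b)) := fun a b => thLift_th _ _ _ _
  let F : (Ind φ N).carrier →ₗ[k] N.carrier × N.carrier := tmLift F₁ (by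
    intro m b n
    refine th_induction (p := fun m => F₁ ((thetaOf φ).ract b m) n = F₁ m (N.lact b n)) m
      (by simp) ?_ (fun x y hx hy => by simp [hx, hy])
    intro x y
    rw [ract_th, F₁_th, F₁_th]
    refine Prod.ext ?_ ?_
    · change N.lact (p x * (b * y)) n = N.lact (p x * y) (N.lact b n)
      rw [lact_lact, mul_assoc, mul_comm b]
    · change N.lact (d x * (b * y)) n = N.lact (d x * y) (N.lact b n)
      rw [lact_lact, mul_assoc, mul_comm b])
  have F_tm : ∀ (a b : A.carrier) n, F (tm (thetaOf φ) N (th φ a b) n) =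
      (N.lact (p a * b) n, N.lact (d a * b) n) := by
    intro a b n
    rw [tmLift_tm, F₁_th]; rfl
  have FG : ∀ x, F (G x) = x := by
    rintro ⟨n₀, n₁⟩
    have e0 := lact_ind_lact (φ := φ) N 1 1 n₀
    have e1 := lact_ind_lact (φ := φ) N α 1 n₁
    rw [lact_one] at e0 e1
    rw [lact_one] at e0
    simp only [G, LinearMap.coprod_apply, LinearMap.comp_apply]
    rw [e0, e1, map_add, F_tm, F_tm, p1.1, p1.2, pα.1, pα.2]
    simp
  have GF : ∀ x, G (F x) = x := by
    intro x
    refine tm_induction (p := fun x => G (F x) = x) x (by simp) ?_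
      (fun x y hx hy => by rw [map_add, map_add, hx, hy])
    intro t n
    refine th_induction (p := fun t => G (F (tm (thetaOf φ) N t n)) = tm (thetaOf φ) N t n) t
      (by simp) ?_ (fun x y hx hy => by simp only [map_add, LinearMap.add_apply, hx, hy])
    intro a b
    rw [F_tm, ← lact_ind_lact]
    simp only [G, LinearMap.coprod_apply, LinearMap.comp_apply]
    rw [← lact_lact, ← lact_lact, ind_lact N (hp a), ind_lact N (hd a), lact_lact,
      ← lact_add, ← hpd]
  exact ⟨LinearEquiv.ofLinearMap F G (LinearMap.ext FG) (LinearMap.ext GF), fun n₀ n₁ => rfl⟩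

variable (hk : (2 : k) ≠ 0)

/-- The coordinates of an element of `A ⊗_{A^φ} N` with respect to `1` and `α`. -/
def coord (N : GrBimod A A) : (Ind φ N).carrier ≃ₗ[k] N.carrier × N.carrier :=
  (h.exists_coord hk N).choose

variable (N : GrBimod A A)

theorem coord_symm (n₀ n₁ : N.carrier) :
    (h.coord hk N).symm (n₀, n₁) = ind φ N n₀ + (Ind φ N).lact α (ind φ N n₁) :=
  (h.exists_coord hk N).choose_spec n₀ n₁

theorem coord_add (n₀ n₁ : N.carrier) :
    h.coord hk N (ind φ N n₀ + (Ind φ N).lact α (ind φ N n₁)) = (n₀, n₁) := by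
  rw [← h.coord_symm hk, LinearEquiv.apply_symm_apply]

theorem coord_ind (n : N.carrier) : h.coord hk N (ind φ N n) = (n, 0) := by
  simpa using h.coord_add hk N n 0

theorem eq_add (t : (Ind φ N).carrier) :
    t = ind φ N (h.coord hk N t).1 + (Ind φ N).lact α (ind φ N (h.coord hk N t).2) := by
  rw [← h.coord_symm hk, Prod.mk.eta, LinearEquiv.symm_apply_apply]

theorem coord_ract (b : A.carrier) (t : (Ind φ N).carrier) :
    h.coord hk N ((Ind φ N).ract b t) =
      (N.ract b (h.coord hk N t).1, N.ract b (h.coord hk N t).2) := by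
  conv_lhs => rw [h.eq_add hk N t]
  rw [map_add, ← (Ind φ N).comm, ← ind_ract, ← ind_ract, coord_add]

theorem coord_lact_fixed {r : A.carrier} (hr : φ.toAlgHom r = r) (t : (Ind φ N).carrier) :
    h.coord hk N ((Ind φ N).lact r t) =
      (N.lact r (h.coord hk N t).1, N.lact r (h.coord hk N t).2) := by
  conv_lhs => rw [h.eq_add hk N t]
  rw [map_add, lact_lact, mul_comm r α, ← lact_lact, ← ind_lact N hr, ← ind_lact N hr, coord_add]

theorem coord_lact_root (t : (Ind φ N).carrier) :
    h.coord hk N ((Ind φ N).lact α t) =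
      (N.lact (α * α) (h.coord hk N t).2, (h.coord hk N t).1) := by
  conv_lhs => rw [h.eq_add hk N t]
  rw [map_add, lact_lact, ← ind_lact N h.map_sq, add_comm, coord_add]

/-- A is generated by α over the fixed points of φ, so left linearity has to be tested only on
these. Most left actions on induced bimodules are checked this way. -/
theorem linear_of_root {P Q : Type*} [AddCommGroup P] [Module k P] [AddCommGroup Q] [Module k Q]
    (L : A.carrier →ₐ[k] Module.End k P) (L' : A.carrier →ₐ[k] Module.End k Q) (f : P →ₗ[k] Q)
    (hr : ∀ r, φ.toAlgHom r = r → ∀ m, f (L r m) = L' r (f m)) (hα : ∀ m, f (L α m) = L' α (f m))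
    (hk : (2 : k) ≠ 0) (a : A.carrier) (m : P) : f (L a m) = L' a (f m) := by
  obtain ⟨p, d, hp, hd, hpd⟩ := h.exists_decomp hk
  rw [hpd a, map_add, map_add, map_mul, map_mul, LinearMap.add_apply, LinearMap.add_apply,
    Module.End.mul_apply, Module.End.mul_apply, map_add, hr _ (hp a), hα, hr _ (hd a)]

/-- The extension to `A ⊗_{A^φ} N` of a map on `N`. -/
def extend {P : Type*} [AddCommGroup P] [Module k P] (L : A.carrier →ₐ[k] Module.End k P)
    (g : N.carrier →ₗ[k] P) : (Ind φ N).carrier →ₗ[k] P :=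
  (g.coprod (L α ∘ₗ g)) ∘ₗ (h.coord hk N).toLinearMap

variable {P : Type*} [AddCommGroup P] [Module k P] (L : A.carrier →ₐ[k] Module.End k P)
  (g : N.carrier →ₗ[k] P)

theorem extend_apply (t : (Ind φ N).carrier) :
    h.extend hk N L g t = g (h.coord hk N t).1 + L α (g (h.coord hk N t).2) := rfl

theorem extend_ind (n : N.carrier) : h.extend hk N L g (ind φ N n) = g n := by
  rw [extend_apply, coord_ind]; simp

theorem extend_lact (hg : ∀ r, φ.toAlgHom r = r → ∀ n, g (N.lact r n) = L r (g n))
    (a : A.carrier) (t : (Ind φ N).carrier) :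
    h.extend hk N L g ((Ind φ N).lact a t) = L a (h.extend hk N L g t) := by
  refine h.linear_of_root (Ind φ N).lact L _ ?_ ?_ hk a t
  · intro r hr t
    rw [extend_apply, extend_apply, coord_lact_fixed _ _ _ hr, map_add, hg r hr, hg r hr,
      ← Module.End.mul_apply, ← Module.End.mul_apply, ← map_mul, ← map_mul, mul_comm]
  · intro t
    rw [extend_apply, extend_apply, coord_lact_root, map_add, hg _ h.map_sq,
      ← Module.End.mul_apply, ← map_mul, add_comm]

theorem extend_ract {ψ : A.carrier → P →ₗ[k] P} (hψ : ∀ b x, ψ b (L α x) = L α (ψ b x))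
    (hg : ∀ b n, g (N.ract b n) = ψ b (g n)) (b : A.carrier) (t : (Ind φ N).carrier) :
    h.extend hk N L g ((Ind φ N).ract b t) = ψ b (h.extend hk N L g t) := by
  rw [extend_apply, extend_apply, coord_ract, map_add, hg, hg, hψ]

end IsRefl

theorem grProj_comm {M N : Type*} [AddCommGroup M] [Module k M] [AddCommGroup N] [Module k N]
    {gM : ℤ → Submodule k M} {gN : ℤ → Submodule k N} (hM : DirectSum.IsInternal gM)
    (hN : DirectSum.IsInternal gN) (f : M →ₗ[k] N) (d : ℤ)
    (hf : ∀ i, ∀ m ∈ gM i, f m ∈ gN (i + d)) (i : ℤ) (m : M) :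
    grProj hN (i + d) (f m) = f (grProj hM i m) := by
  refine gr_induction hM (p := fun m => grProj hN (i + d) (f m) = f (grProj hM i m)) m ?_
    (by simp) (fun a b ha hb => by simp [ha, hb])
  intro j m hm
  by_cases hij : i = j
  · subst hij
    rw [grProj_of_mem hM hm, grProj_of_mem hN (hf _ _ hm)]
  · rw [grProj_of_mem_ne hM hij hm, grProj_of_mem_ne hN (by omega) (hf _ _ hm), map_zero]

theorem mem_gr_iff {M : Type*} [AddCommGroup M] [Module k M] {gM : ℤ → Submodule k M}
    (hM : DirectSum.IsInternal gM) (i : ℤ) (m : M) : m ∈ gM i ↔ grProj hM i m = m :=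
  ⟨grProj_of_mem hM, fun h => h ▸ grProj_mem hM i m⟩

theorem ind_mem (N : GrBimod A A) {i : ℤ} {n : N.carrier} (hn : n ∈ N.gr i) :
    ind φ N n ∈ (Ind φ N).gr i := by
  have h1 : th φ 1 1 ∈ (thetaOf φ).gr (0 + 0) := th_mem A.one_mem A.one_mem
  have h2 := tm_mem (thetaOf φ) N h1 hn
  rwa [show (0 + 0 + i : ℤ) = i by ring] at h2

theorem IsRefl.lact_ind_mem (h : IsRefl φ α) (N : GrBimod A A) {i : ℤ} {n : N.carrier}
    (hn : n ∈ N.gr i) : (Ind φ N).lact α (ind φ N n) ∈ (Ind φ N).gr (i + 2) := by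
  rw [add_comm]
  exact (Ind φ N).lact_mem h.mem (ind_mem N hn)

/-- The maps n ↦ 1 ⊗ n and n ↦ α ⊗ n are homogeneous of degrees 0 and 2, so they commute with the
projections to components, and uniqueness of coordinates does the rest. -/
theorem IsRefl.mem_gr_iff (h : IsRefl φ α) (hk : (2 : k) ≠ 0) (N : GrBimod A A) (i : ℤ)
    (t : (Ind φ N).carrier) : t ∈ (Ind φ N).gr i ↔
      (h.coord hk N t).1 ∈ N.gr i ∧ (h.coord hk N t).2 ∈ N.gr (i - 2) := by
  constructor
  · intro ht
    have e := grProj_of_mem (Ind φ N).internal ht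
    rw [h.eq_add hk N t, map_add] at e
    have e1 := grProj_comm N.internal (Ind φ N).internal (ind φ N) 0
      (fun i m hm => by rw [add_zero]; exact ind_mem N hm) i (h.coord hk N t).1
    rw [add_zero] at e1
    have e2 := grProj_comm N.internal (Ind φ N).internal ((Ind φ N).lact α ∘ₗ ind φ N) 2
      (fun i m hm => h.lact_ind_mem N hm) (i - 2) (h.coord hk N t).2
    rw [sub_add_cancel] at e2
    simp only [LinearMap.comp_apply] at e2
    rw [e1, e2] at e
    have e3 := congrArg (h.coord hk N) e
    rw [h.coord_add, h.coord_add, Prod.mk.injEq] at e3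
    exact ⟨(Soergel.mem_gr_iff N.internal _ _).2 e3.1, (Soergel.mem_gr_iff N.internal _ _).2 e3.2⟩
  · rintro ⟨h0, h1⟩
    rw [h.eq_add hk N t]
    refine add_mem (ind_mem N h0) ?_
    have := h.lact_ind_mem N h1
    rwa [sub_add_cancel] at this

end Ind

/-! ### Reflections acting on regular functions -/

section Reg

variable {k : Type u} [Field k] {W : Type*} [Group W] {U : Type v} [AddCommGroup U] [Module k U]

/-- Each coordinate form of a basis extends to an algebra homomorphism to k. -/
theorem symι_injective (k : Type u) [Field k] (E : Type*) [AddCommGroup E] [Module k E] :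
    Function.Injective (SymmetricAlgebra.ι k E) := by
  intro x y hxy
  let b := Module.Basis.ofVectorSpace k E
  refine b.ext_elem fun i => ?_
  have h := congrArg (fun z => SymmetricAlgebra.lift (b.coord i) z) hxy
  simpa [SymmetricAlgebra.lift_ι_apply] using h

instance : IsDomain (regFun k U).carrier :=
  inferInstanceAs (IsDomain (SymmetricAlgebra k (Module.Dual k U)))

/-- A linear form as a regular function. -/
def regι (k : Type u) [Field k] (U : Type v) [AddCommGroup U] [Module k U] :
    Module.Dual k U →ₗ[k] (regFun k U).carrier :=
  SymmetricAlgebra.ι k (Module.Dual k U)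

theorem regι_injective : Function.Injective (regι k U) := symι_injective _ _

theorem regι_mem (ξ : Module.Dual k U) : regι k U ξ ∈ (regFun k U).gr 2 :=
  pow_le_symGr (k := k) (E := Module.Dual k U) 1 (by rw [pow_one]; exact ⟨ξ, rfl⟩)

theorem reg_induction {p : (regFun k U).carrier → Prop} (a : (regFun k U).carrier)
    (algebraMap : ∀ c, p (algebraMap k (regFun k U).carrier c)) (ι : ∀ ξ, p (regι k U ξ))
    (mul : ∀ a b, p a → p b → p (a * b)) (add : ∀ a b, p a → p b → p (a + b)) : p a :=
  SymmetricAlgebra.induction k (Module.Dual k U) (motive := p) algebraMap ι mul add a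

theorem reg_algHom_ext {S : Type*} [CommRing S] [Algebra k S]
    {f g : (regFun k U).carrier →ₐ[k] S} (h : ∀ ξ, f (regι k U ξ) = g (regι k U ξ)) : f = g :=
  SymmetricAlgebra.algHom_ext (LinearMap.ext h)

theorem regAct_ι (ρ : Representation k W U) (w : W) (ξ : Module.Dual k U) :
    (regAct ρ w).toAlgHom (regι k U ξ) = regι k U (ρ.dual w ξ) :=
  SymmetricAlgebra.lift_ι_apply (A := SymmetricAlgebra k (Module.Dual k U)) _ _

theorem restr_ι (V' : Submodule k U) (ξ : Module.Dual k U) :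
    (restr V').toAlgHom (regι k U ξ) = regι k V' (V'.dualRestrict ξ) :=
  SymmetricAlgebra.lift_ι_apply (A := SymmetricAlgebra k (Module.Dual k V')) _ _

/-- The action of `W` on regular functions. -/
def regRep (ρ : Representation k W U) :
    W →* ((regFun k U).carrier →ₐ[k] (regFun k U).carrier) where
  toFun w := (regAct ρ w).toAlgHom
  map_one' := reg_algHom_ext fun ξ => by rw [regAct_ι, map_one]; rfl
  map_mul' x y := reg_algHom_ext fun ξ => by
    rw [AlgHom.mul_apply, regAct_ι, regAct_ι, regAct_ι, map_mul]; rfl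

theorem regRep_apply (ρ : Representation k W U) (w : W) (a : (regFun k U).carrier) :
    regRep ρ w a = (regAct ρ w).toAlgHom a := rfl

theorem restr_surjective (V' : Submodule k U) : Function.Surjective (restr V').toAlgHom := by
  intro a
  refine reg_induction (p := fun a => ∃ b, (restr V').toAlgHom b = a) a ?_ ?_ ?_ ?_
  · exact fun c => ⟨algebraMap _ _ c, AlgHom.commutes _ _⟩
  · intro ξ
    obtain ⟨η, hη⟩ := Subspace.dualRestrict_surjective (W := V') ξ
    exact ⟨regι k U η, by rw [restr_ι, hη]⟩
  · rintro _ _ ⟨a, rfl⟩ ⟨b, rfl⟩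
    exact ⟨a * b, map_mul _ _ _⟩
  · rintro _ _ ⟨a, rfl⟩ ⟨b, rfl⟩
    exact ⟨a + b, map_add _ _ _⟩

variable {ρ : Representation k W U} (σ : Subrepresentation ρ)

theorem restr_regAct (w : W) (a : (regFun k U).carrier) :
    (restr σ.toSubmodule).toAlgHom ((regAct ρ w).toAlgHom a) =
      (regAct σ.toRepresentation w).toAlgHom ((restr σ.toSubmodule).toAlgHom a) := by
  have : (restr σ.toSubmodule).toAlgHom.comp (regAct ρ w).toAlgHom =
      (regAct σ.toRepresentation w).toAlgHom.comp (restr σ.toSubmodule).toAlgHom := by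
    refine reg_algHom_ext fun ξ => ?_
    rw [AlgHom.comp_apply, AlgHom.comp_apply, regAct_ι, restr_ι, restr_ι, regAct_ι]
    rfl
  exact DFunLike.congr_fun this a

/-- Every linear form on V' extends to V, and linear forms separate points, so an element acting
trivially on all restrictions acts trivially on V'. This is where faithfulness on V' enters. -/
theorem exists_restr_ne (hσ : Function.Injective σ.toRepresentation) {w : W} (hw : w ≠ 1) :
    ∃ a, (restr σ.toSubmodule).toAlgHom (regRep ρ w a) ≠ (restr σ.toSubmodule).toAlgHom a := by
  by_contra! h
  apply hw
  have h2 : ∀ ξ : Module.Dual k σ.toSubmodule, σ.toRepresentation.dual w ξ = ξ := by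
    intro ξ
    obtain ⟨η, rfl⟩ := Subspace.dualRestrict_surjective (W := σ.toSubmodule) ξ
    have := h (regι k U η)
    rw [regRep_apply, restr_regAct, restr_ι, regAct_ι] at this
    exact regι_injective this
  have h3 : σ.toRepresentation w⁻¹ = 1 := by
    refine LinearMap.ext fun x => ?_
    refine (Module.forall_dual_apply_eq_zero_iff k _).1 ?_ |> sub_eq_zero.1
    intro ξ
    have := LinearMap.congr_fun (h2 ξ) x
    rw [map_sub, sub_eq_zero]
    exact this
  have := hσ (h3.trans (map_one σ.toRepresentation).symm)
  exact inv_eq_one.1 this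

theorem exists_regRep_ne (hσ : Function.Injective σ.toRepresentation) {w : W} (hw : w ≠ 1) :
    ∃ a, regRep ρ w a ≠ a := by
  obtain ⟨a, ha⟩ := exists_restr_ne σ hσ hw
  exact ⟨a, fun h => ha (congrArg _ h)⟩

/-- Everything descends along the surjection R → R' except that the root stays nonzero: if ξ
vanished on V', then s would fix V' pointwise and not be a reflection there. -/
theorem IsRefl.restrict {s : W} {ξ : Module.Dual k U} (h : IsRefl (regAct ρ s) (regι k U ξ))
    (hξ : ∀ x, ξ x = 0 → ρ s x = x) (hσ : ActsAsReflection (σ.toRepresentation s)) :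
    IsRefl (regAct σ.toRepresentation s) ((restr σ.toSubmodule).toAlgHom (regι k U ξ)) where
  mem := (restr σ.toSubmodule).map_mem _ _ h.mem
  invol a := by
    obtain ⟨a, rfl⟩ := restr_surjective σ.toSubmodule a
    rw [← restr_regAct, ← restr_regAct, h.invol]
  neg := by rw [← restr_regAct, h.neg, map_neg]
  dvd a := by
    obtain ⟨a, rfl⟩ := restr_surjective σ.toSubmodule a
    obtain ⟨b, hb⟩ := h.dvd a
    exact ⟨(restr σ.toSubmodule).toAlgHom b, by rw [← restr_regAct, ← map_sub, hb, map_mul]⟩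
  cancel a ha := by
    refine (mul_eq_zero.1 ha).resolve_left fun h0 => ?_
    rw [restr_ι] at h0
    have h1 : σ.toSubmodule.dualRestrict ξ = 0 := regι_injective (by rw [h0, map_zero])
    have h2 : σ.toRepresentation s = 1 := LinearMap.ext fun x =>
      Subtype.ext (hξ x.1 (LinearMap.congr_fun h1 x))
    have h3 := hσ
    rw [ActsAsReflection, h2, sub_self, LinearMap.ker_zero, finrank_top] at h3
    omega

variable [FiniteDimensional k U]

/-- By rank and nullity f - 1 has rank one, so it is a linear form times a vector that spans its
range. -/
theorem ActsAsReflection.exists_root {f : Module.End k U} (hf : ActsAsReflection f) :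
    ∃ (ξ : Module.Dual k U) (v : U), ξ ≠ 0 ∧ ∀ x, f x = x - ξ x • v := by
  have h1 := LinearMap.finrank_range_add_finrank_ker (f - 1)
  rw [← hf, add_comm] at h1
  have h2 : Module.finrank k (LinearMap.range (f - 1)) = 1 := by omega
  obtain ⟨⟨v, hv⟩, hv0, hc⟩ := finrank_eq_one_iff'.1 h2
  have hv0' : v ≠ 0 := fun h => hv0 (Subtype.ext h)
  have hc' : ∀ x, ∃ c : k, c • v = (f - 1) x := fun x => by
    obtain ⟨c, hc⟩ := hc ⟨(f - 1) x, ⟨x, rfl⟩⟩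
    exact ⟨c, congrArg Subtype.val hc⟩
  choose c hc' using hc'
  have inj := smul_left_injective k hv0'
  let ξ : Module.Dual k U :=
    { toFun := fun x => - c x
      map_add' := fun x y => inj (by
        simp only [neg_smul, add_smul, hc', map_add]; abel)
      map_smul' := fun r x => inj (by
        simp only [neg_smul, hc', map_smul, smul_eq_mul, mul_smul, RingHom.id_apply, mul_neg]) }
  have hξ : ∀ x, f x = x - ξ x • v := fun x => by
    change f x = x - (- c x) • v
    rw [neg_smul, hc']; simp
  refine ⟨ξ, v, fun h => ?_, hξ⟩
  have h3 : f - 1 = 0 := LinearMap.ext fun x => by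
    rw [LinearMap.sub_apply, hξ, h]; simp
  rw [h3, LinearMap.range_zero, finrank_bot] at h2
  exact zero_ne_one h2

/-- The root is the form that cuts out the hyperplane fixed by s. Divisibility of a - s(a) by it
passes from linear forms to products through ab - s(a)s(b) = (a - s(a))b + s(a)(b - s(b)). -/
theorem exists_isRefl (ρ : Representation k W U) {s : W} (hs : s * s = 1)
    (h : ActsAsReflection (ρ s)) : ∃ ξ : Module.Dual k U, IsRefl (regAct ρ s) (regι k U ξ) ∧
      ∀ x, ξ x = 0 → ρ s x = x := by
  obtain ⟨ξ, v, hξ0, hξ⟩ := h.exists_root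
  have hinv : s⁻¹ = s := inv_eq_of_mul_eq_one_left hs
  -- The relation s² = 1 reads ξ(x)(2 - ξ(v))v = 0 for all x, and v ≠ 0 because s does not act
  -- trivially.
  have hv : ξ v = 2 := by
    by_contra hne
    apply hξ0
    refine LinearMap.ext fun x => ?_
    have e : ρ s (ρ s x) = x := by
      rw [← Module.End.mul_apply, ← map_mul, hs, map_one]; rfl
    have hv0 : v ≠ 0 := by
      rintro rfl
      have h0 : ρ s = 1 := LinearMap.ext fun x => by rw [hξ]; simp
      have h1 : Module.finrank k (LinearMap.ker (ρ s - 1)) = Module.finrank k U := by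
        rw [h0, sub_self, LinearMap.ker_zero, finrank_top]
      have := h
      rw [ActsAsReflection, h1] at this
      omega
    rw [hξ x, map_sub, map_smul, hξ x, hξ v] at e
    have e2 : (ξ x * (2 - ξ v)) • v = 0 := by
      have : (ξ x * (2 - ξ v)) • v = x - (x - ξ x • v - ξ x • (v - ξ v • v)) := by
        module
      rw [this, e, sub_self]
    rcases smul_eq_zero.1 e2 with e3 | e3
    · rcases mul_eq_zero.1 e3 with e4 | e4
      · exact e4
      · exact absurd (sub_eq_zero.1 e4).symm hne
    · exact absurd e3 hv0
  have hact : ∀ η : Module.Dual k U, ρ.dual s η = η - η v • ξ := by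
    intro η
    refine LinearMap.ext fun x => ?_
    rw [Representation.dual_apply, hinv]
    simp only [Module.Dual.transpose_apply, LinearMap.comp_apply, LinearMap.sub_apply,
      LinearMap.smul_apply, hξ x, map_sub, map_smul, smul_eq_mul]
    ring
  have hι : ∀ η, (regAct ρ s).toAlgHom (regι k U η) = regι k U η - η v • regι k U ξ := by
    intro η
    rw [regAct_ι, hact, map_sub, map_smul]
  refine ⟨ξ, ⟨regι_mem ξ, ?_, ?_, ?_, ?_⟩, fun x hx => by rw [hξ, hx]; simp⟩
  · intro a
    rw [← regRep_apply, ← regRep_apply, ← AlgHom.mul_apply, ← map_mul, hs, map_one]; rfl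
  · rw [hι, hv, two_smul]; abel
  · intro a
    refine reg_induction (p := fun a => ∃ b, a - (regAct ρ s).toAlgHom a = regι k U ξ * b) a
      ?_ ?_ ?_ ?_
    · exact fun c => ⟨0, by rw [AlgHom.commutes, sub_self, mul_zero]⟩
    · intro η
      exact ⟨η v • 1, by rw [hι, mul_smul_comm, mul_one]; abel⟩
    · rintro a b ⟨a', ha⟩ ⟨b', hb⟩
      refine ⟨a' * b + (regAct ρ s).toAlgHom a * b', ?_⟩
      rw [map_mul]
      linear_combination b * ha + (regAct ρ s).toAlgHom a * hb
    · rintro a b ⟨a', ha⟩ ⟨b', hb⟩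
      exact ⟨a' + b', by rw [map_add]; linear_combination ha + hb⟩
  · intro a ha
    refine (mul_eq_zero.1 ha).resolve_left fun h0 => hξ0 (regι_injective ?_)
    rw [h0, map_zero]

/-- Roots of the simple reflections, compatible with restriction to a subrepresentation. -/
theorem exists_roots {B : Type*} {C : CoxeterMatrix B} (cs : CoxeterSystem C W)
    (h1 : ∀ i, ActsAsReflection (ρ (cs.simple i)))
    (h2 : ∀ i, ActsAsReflection (σ.toRepresentation (cs.simple i))) :
    ∃ α : B → (regFun k U).carrier, (∀ i, IsRefl (regAct ρ (cs.simple i)) (α i)) ∧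
      ∀ i, IsRefl (regAct σ.toRepresentation (cs.simple i))
        ((restr σ.toSubmodule).toAlgHom (α i)) := by
  choose ξ hξ hξ' using fun i => exists_isRefl ρ (cs.simple_mul_simple_self i) (h1 i)
  exact ⟨fun i => regι k U (ξ i), hξ, fun i => (hξ i).restrict σ (hξ' i) (h2 i)⟩

end Reg

/-! ### Functionals on bimodules -/

section Functional

open GrBimod

variable {k : Type u} [Field k] {W : Type*} [Group W] {U : Type v} [AddCommGroup U] [Module k U]

/-- A domain with an action of `W` and an equivariant map from `R(U)` that still separates the
elements of `W`. -/
structure Target (ρ : Representation k W U) where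
  S : Type w
  [commRing : CommRing S]
  [isDomain : IsDomain S]
  [algebra : Algebra k S]
  Q : (regFun k U).carrier →ₐ[k] S
  act : W →* (S →ₐ[k] S)
  equivariant : ∀ w a, Q (regRep ρ w a) = act w (Q a)
  faithful : ∀ w, w ≠ 1 → ∃ a, Q (regRep ρ w a) ≠ Q a

attribute [instance] Target.commRing Target.isDomain Target.algebra

variable {ρ : Representation k W U} (T : Target.{u, v, w} ρ)

/-- Functionals that are morphisms of bimodules, with the right action twisted by `x`. -/
structure IsFun (M : GrBimod (regFun k U) (regFun k U)) (x : W) (g : M.carrier →ₗ[k] T.S) :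
    Prop where
  left : ∀ a m, g (M.lact a m) = T.Q a * g m
  right : ∀ b m, g (M.ract b m) = T.Q (regRep ρ x b) * g m

/-- The left action of `R(U)` on a target. -/
def Target.left : (regFun k U).carrier →ₐ[k] Module.End k T.S := (Algebra.lmul k T.S).comp T.Q

theorem Target.left_apply (a : (regFun k U).carrier) (x : T.S) : T.left a x = T.Q a * x := rfl

variable {T}

theorem IsFun.comp {M N : GrBimod (regFun k U) (regFun k U)} {x : W} {g : N.carrier →ₗ[k] T.S}
    (hg : IsFun T N x g) (f : hom M N) : IsFun T M x (g ∘ₗ f.1) :=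
  ⟨fun a m => by rw [LinearMap.comp_apply, f.2.1, hg.left]; rfl,
    fun b m => by rw [LinearMap.comp_apply, f.2.2, hg.right]; rfl⟩

/-- The product (Q(a) - Q(x a)) g(m) is zero for every a; faithfulness provides an a with nonzero
first factor, and S is a domain. -/
theorem IsFun.eq_zero_of_central {M : GrBimod (regFun k U) (regFun k U)} {x : W}
    {g : M.carrier →ₗ[k] T.S} (hg : IsFun T M x g) (hx : x ≠ 1) {m : M.carrier}
    (hm : ∀ b, g (M.lact b m) = g (M.ract b m)) : g m = 0 := by
  obtain ⟨a, ha⟩ := T.faithful x hx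
  have e := hm a
  rw [hg.left, hg.right, ← sub_eq_zero, ← sub_mul] at e
  exact (mul_eq_zero.1 e).resolve_left fun h => ha (sub_eq_zero.1 h).symm

/-! ### Functionals on a bimodule induced along one reflection -/

section Step

variable {s : W} (hs : s * s = 1) {α : (regFun k U).carrier} (h : IsRefl (regAct ρ s) α)
  {N : GrBimod (regFun k U) (regFun k U)} {x : W}

include h in
-- Each a - s(a) is a multiple of α, so Q(α) = 0 would make s invisible to Q.
theorem Target.root_ne_zero (hs1 : s ≠ 1) : T.Q α ≠ 0 := by
  intro h0
  obtain ⟨a, ha⟩ := T.faithful s hs1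
  obtain ⟨b, hb⟩ := h.dvd a
  apply ha
  rw [regRep_apply, ← sub_eq_zero, ← map_sub, ← neg_sub, hb, map_neg, map_mul, h0, zero_mul,
    neg_zero]

theorem regRep_mul_apply (x y : W) (a : (regFun k U).carrier) :
    regRep ρ (x * y) a = regRep ρ x (regRep ρ y a) := by rw [map_mul, AlgHom.mul_apply]

include hs in
theorem Target.act_act (a : T.S) : T.act s (T.act s a) = a := by
  rw [← AlgHom.mul_apply, ← map_mul, hs, map_one, AlgHom.one_apply]

theorem Target.act_fixed {r : (regFun k U).carrier} (hr : (regAct ρ s).toAlgHom r = r) :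
    T.act s (T.Q r) = T.Q r := by rw [← T.equivariant, regRep_apply, hr]

include h in
theorem Target.act_root : T.act s (T.Q α) = - T.Q α := by
  rw [← T.equivariant, regRep_apply, h.neg, map_neg]

theorem IsFun.extend_same (hk : (2 : k) ≠ 0) {g : N.carrier →ₗ[k] T.S} (hg : IsFun T N x g) :
    IsFun T (Ind (regAct ρ s) N) x (h.extend hk N T.left g) where
  left := h.extend_lact hk N T.left g fun r _ n => hg.left r n
  right := h.extend_ract hk N T.left g (ψ := fun b => LinearMap.mulLeft k (T.Q (regRep ρ x b)))
    (fun _ _ => mul_left_comm _ _ _) hg.right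

/-- Composing with s preserves linearity over the s-invariants, which is all that extension
requires, and turns the twist x into s x. Together with `IsFun.extend_same` this gives two
functionals on the induced bimodule. -/
theorem IsFun.extend_refl (hk : (2 : k) ≠ 0) {g : N.carrier →ₗ[k] T.S} (hg : IsFun T N x g) :
    IsFun T (Ind (regAct ρ s) N) (s * x)
      (h.extend hk N T.left ((T.act s).toLinearMap ∘ₗ g)) where
  left := h.extend_lact hk N T.left _ fun r hr n => by
    rw [LinearMap.comp_apply, hg.left, AlgHom.toLinearMap_apply, map_mul, T.act_fixed hr]; rfl
  right := h.extend_ract hk N T.left _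
    (ψ := fun b => LinearMap.mulLeft k (T.Q (regRep ρ (s * x) b)))
    (fun _ _ => mul_left_comm _ _ _) fun b n => by
      rw [LinearMap.comp_apply, hg.right, AlgHom.toLinearMap_apply, map_mul, ← T.equivariant,
        ← regRep_mul_apply]; rfl

variable {g : (Ind (regAct ρ s) N).carrier →ₗ[k] T.S} (hg : IsFun T (Ind (regAct ρ s) N) x g)

/-- `n ↦ g(1 ⊗ α n) + α g(1 ⊗ n)`. -/
def funSame (g : (Ind (regAct ρ s) N).carrier →ₗ[k] T.S) (α : (regFun k U).carrier) :
    N.carrier →ₗ[k] T.S :=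
  g ∘ₗ ind _ N ∘ₗ N.lact α + T.left α ∘ₗ g ∘ₗ ind _ N

/-- `n ↦ s(g(1 ⊗ α n) - α g(1 ⊗ n))`. -/
def funRefl (g : (Ind (regAct ρ s) N).carrier →ₗ[k] T.S) (α : (regFun k U).carrier) :
    N.carrier →ₗ[k] T.S :=
  (T.act s).toLinearMap ∘ₗ (g ∘ₗ ind _ N ∘ₗ N.lact α - T.left α ∘ₗ g ∘ₗ ind _ N)

omit T in
theorem funSame_apply {T : Target.{u, v, w} ρ} (g : (Ind (regAct ρ s) N).carrier →ₗ[k] T.S)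
    (α : (regFun k U).carrier) (n : N.carrier) :
    funSame g α n = g (ind _ N (N.lact α n)) + T.Q α * g (ind _ N n) := rfl

theorem funRefl_apply (g : (Ind (regAct ρ s) N).carrier →ₗ[k] T.S)
    (α : (regFun k U).carrier) (n : N.carrier) :
    funRefl g α n = T.act s (g (ind _ N (N.lact α n)) - T.Q α * g (ind _ N n)) := rfl

include hg in
theorem IsFun.ind_fixed {r : (regFun k U).carrier} (hr : (regAct ρ s).toAlgHom r = r)
    (n : N.carrier) : g (ind _ N (N.lact r n)) = T.Q r * g (ind _ N n) := by
  rw [ind_lact N hr, hg.left]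

include hg in
theorem IsFun.ind_right (b : (regFun k U).carrier)
    (n : N.carrier) : g (ind _ N (N.ract b n)) = T.Q (regRep ρ x b) * g (ind _ N n) := by
  rw [ind_ract, hg.right]

include h hg in
-- As α² is invariant, replacing n by α n exchanges the two summands up to the factor α.
theorem IsFun.same (hk : (2 : k) ≠ 0) : IsFun T N x (funSame g α) where
  left := h.linear_of_root N.lact T.left _
    (fun r hr n => by
      rw [funSame_apply, funSame_apply, lact_lact, mul_comm α r, ← lact_lact,
        hg.ind_fixed hr, hg.ind_fixed hr, T.left_apply]; ring)
    (fun n => by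
      rw [funSame_apply, funSame_apply, lact_lact, hg.ind_fixed h.map_sq, map_mul,
        T.left_apply]; ring) hk
  right b n := by
    rw [funSame_apply, funSame_apply, N.comm, hg.ind_right, hg.ind_right]; ring

include h hg in
-- Before s is applied, replacing n by α n multiplies the difference by -α; the sign disappears
-- because s(α) = -α.
theorem IsFun.refl (hk : (2 : k) ≠ 0) : IsFun T N (s * x) (funRefl g α) where
  left := h.linear_of_root N.lact T.left _
    (fun r hr n => by
      rw [funRefl_apply, funRefl_apply, lact_lact, mul_comm α r, ← lact_lact,
        hg.ind_fixed hr, hg.ind_fixed hr, T.left_apply, mul_left_comm, ← mul_sub, map_mul,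
        T.act_fixed hr])
    (fun n => by
      rw [funRefl_apply, funRefl_apply, lact_lact, hg.ind_fixed h.map_sq, map_mul,
        T.left_apply, ← neg_sub, mul_assoc, ← mul_sub, map_neg, map_mul, T.act_root h]; ring) hk
  right b n := by
    rw [funRefl_apply, funRefl_apply, N.comm, hg.ind_right, hg.ind_right, mul_left_comm,
      ← mul_sub, map_mul, ← T.equivariant, ← regRep_mul_apply]

include h hg in
theorem IsFun.eq_zero_of_ind (hk : (2 : k) ≠ 0) (h0 : ∀ n, g (ind _ N n) = 0) : g = 0 := by
  refine LinearMap.ext fun t => ?_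
  rw [h.eq_add hk N t, map_add, hg.left, h0, h0, mul_zero, add_zero]; rfl

theorem Target.two_ne_zero (hk : (2 : k) ≠ 0) : (2 : T.S) ≠ 0 := by
  have := (map_ne_zero_iff (algebraMap k T.S) (algebraMap k T.S).injective).2 hk
  rwa [map_ofNat] at this

include hs h hg in
-- The two components differ, after s, by 2α g(1 ⊗ n), and 2α is nonzero in the domain S. So a
-- functional on the induced bimodule is determined by one of twist x and one of twist s x.
theorem IsFun.eq_zero_of_same_refl (hk : (2 : k) ≠ 0) (hs1 : s ≠ 1) (h0 : funSame g α = 0)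
    (h1 : funRefl g α = 0) : g = 0 := by
  refine hg.eq_zero_of_ind h hk fun n => ?_
  have e0 := LinearMap.congr_fun h0 n
  have e1 := congrArg (T.act s) (LinearMap.congr_fun h1 n)
  rw [funRefl_apply, T.act_act hs, LinearMap.zero_apply, map_zero] at e1
  rw [funSame_apply, LinearMap.zero_apply] at e0
  have e2 : 2 * T.Q α * g (ind _ N n) = 0 := by linear_combination e0 - e1
  exact (mul_eq_zero.1 e2).resolve_left (mul_ne_zero (T.two_ne_zero hk) (T.root_ne_zero h hs1))

include hs h hg in
-- Vanishing of the reflected component says g(1 ⊗ α n) = α g(1 ⊗ n), exactly the missing left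
-- linearity of n ↦ g(1 ⊗ n). The gain over `IsFun.same` is that no factor α is spent, so degrees do
-- not go up.
theorem IsFun.of_funRefl_eq_zero (hk : (2 : k) ≠ 0) (h1 : funRefl g α = 0) :
    IsFun T N x (g ∘ₗ ind _ N) where
  left := h.linear_of_root N.lact T.left _ (fun r hr n => hg.ind_fixed hr n)
    (fun n => by
      have e1 := congrArg (T.act s) (LinearMap.congr_fun h1 n)
      rw [funRefl_apply, T.act_act hs, LinearMap.zero_apply, map_zero, sub_eq_zero] at e1
      exact e1) hk
  right b n := hg.ind_right b n

include h hg in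
-- The mirror case: g(1 ⊗ α n) = -α g(1 ⊗ n), which becomes left linearity after applying s.
theorem IsFun.of_funSame_eq_zero (hk : (2 : k) ≠ 0) (h0 : funSame g α = 0) :
    IsFun T N (s * x) ((T.act s).toLinearMap ∘ₗ g ∘ₗ ind _ N) where
  left := h.linear_of_root N.lact T.left _
    (fun r hr n => by
      simp only [LinearMap.comp_apply, AlgHom.toLinearMap_apply, T.left_apply]
      rw [hg.ind_fixed hr, map_mul, T.act_fixed hr])
    (fun n => by
      have e0 := LinearMap.congr_fun h0 n
      rw [funSame_apply, LinearMap.zero_apply, add_eq_zero_iff_eq_neg] at e0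
      simp only [LinearMap.comp_apply, AlgHom.toLinearMap_apply, T.left_apply]
      rw [e0, map_neg, map_mul, T.act_root h]; ring) hk
  right b n := by
    simp only [LinearMap.comp_apply, AlgHom.toLinearMap_apply]
    rw [hg.ind_right, map_mul, ← T.equivariant, ← regRep_mul_apply]

end Step

/-! ### Functionals on words: possible twists and the value at 1⊗⋯⊗1 -/

section Words

variable {B : Type*} {C : CoxeterMatrix B} (cs : CoxeterSystem C W)
  {α : B → (regFun k U).carrier} (hα : ∀ i, IsRefl (regAct ρ (cs.simple i)) (α i))
  (hk : (2 : k) ≠ 0)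

theorem simple_ne_one (i : B) : cs.simple i ≠ 1 := fun h => by
  have := cs.length_simple i
  rw [h, cs.length_one] at this
  exact zero_ne_one this

/-- The element `1 ⊗ ⋯ ⊗ 1` of `θ_{s_1} ⋯ θ_{s_n}`. -/
def word1 (ρ : Representation k W U) : ∀ u : List B, (thetaWord cs ρ u).carrier
  | [] => (1 : (regFun k U).carrier)
  | i :: u => ind (regAct ρ (cs.simple i)) (thetaWord cs ρ u) (word1 ρ u)

theorem word1_mem (u : List B) : word1 cs ρ u ∈ (thetaWord cs ρ u).gr 0 := by
  induction u with
  | nil => exact (regFun k U).one_mem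
  | cons i u ih => exact ind_mem _ ih

theorem IsFun.nil_eq_zero {x : W} {g : (thetaWord cs ρ []).carrier →ₗ[k] T.S}
    (hg : IsFun T (thetaWord cs ρ []) x g) (hx : x ≠ 1) : g = 0 :=
  LinearMap.ext fun _ => hg.eq_zero_of_central hx fun _ => rfl

include hα hk in
-- Induction on the word: if g ≠ 0, one of its two components on the tail is nonzero, of twist x or
-- s x, and lengths of twists change by at most one per letter.
theorem IsFun.eq_zero_or (u : List B) : ∀ {x : W} {g : (thetaWord cs ρ u).carrier →ₗ[k] T.S},
    IsFun T (thetaWord cs ρ u) x g → g = 0 ∨ x = cs.wordProd u ∨ cs.length x < u.length := by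
  induction u with
  | nil =>
    intro x g hg
    by_cases hx : x = 1
    · exact Or.inr (Or.inl (by simpa using hx))
    · exact Or.inl (hg.nil_eq_zero cs hx)
  | cons i u ih =>
    intro x (g : (Ind (regAct ρ (cs.simple i)) (thetaWord cs ρ u)).carrier →ₗ[k] T.S)
      (hg : IsFun T (Ind (regAct ρ (cs.simple i)) (thetaWord cs ρ u)) x g)
    have hs := cs.simple_mul_simple_self i
    by_contra! hne
    obtain ⟨hne0, hne1, hne2⟩ := hne
    rw [List.length_cons] at hne2
    apply hne0
    have hl := cs.length_simple_mul x i
    have hu := cs.length_wordProd_le u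
    refine hg.eq_zero_of_same_refl hs (hα i) hk (simple_ne_one cs i) ?_ ?_
    · refine (ih (hg.same (hα i) hk)).resolve_right ?_
      rintro (rfl | h2) <;> omega
    · refine (ih (hg.refl (hα i) hk)).resolve_right ?_
      rintro (h1 | h2)
      · apply hne1
        rw [cs.wordProd_cons, ← h1, ← mul_assoc, hs, one_mul]
      · omega

include hα hk in
-- The component of twist x on the tail vanishes, since x has length greater than that of the tail.
-- So at the top twist α passes across the first tensor sign with a change of sign.
theorem IsFun.ind_root {i : B} {u : List B} (hu : cs.IsReduced (i :: u))
    {g : (Ind (regAct ρ (cs.simple i)) (thetaWord cs ρ u)).carrier →ₗ[k] T.S}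
    (hg : IsFun T (Ind (regAct ρ (cs.simple i)) (thetaWord cs ρ u)) (cs.wordProd (i :: u)) g) 
    (n : (thetaWord cs ρ u).carrier) :
    g (ind (regAct ρ (cs.simple i)) (thetaWord cs ρ u) ((thetaWord cs ρ u).lact (α i) n)) =
      - (T.Q (α i) * g (ind (regAct ρ (cs.simple i)) (thetaWord cs ρ u) n)) := by
  have h0 : funSame (N := thetaWord cs ρ u) (s := cs.simple i) g (α i) = 0 := by
    have hu2 := hu.eq
    rw [List.length_cons] at hu2
    refine (IsFun.eq_zero_or cs hα hk u (hg.same (hα i) hk)).resolve_right ?_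
    have := cs.length_wordProd_le u
    rintro (h1 | h2)
    · rw [h1] at hu2; omega
    · omega
  have := LinearMap.congr_fun h0 n
  rw [funSame_apply, LinearMap.zero_apply] at this
  exact eq_neg_of_add_eq_zero_left this

include hα hk in
-- At the top twist of a reduced word only the reflected component survives at each letter, so the
-- functionals form a space of rank at most one, detected by 1⊗⋯⊗1.
theorem IsFun.eq_zero_of_word1 (u : List B) (hu : cs.IsReduced u) :
    ∀ {g : (thetaWord cs ρ u).carrier →ₗ[k] T.S},
    IsFun T (thetaWord cs ρ u) (cs.wordProd u) g → g (word1 cs ρ u) = 0 → g = 0 := by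
  induction u with
  | nil =>
    intro g hg h0
    refine LinearMap.ext fun m => ?_
    have e := hg.left m (word1 cs ρ [])
    rw [h0, mul_zero] at e
    exact (congrArg g (mul_one (show (regFun k U).carrier from m)).symm).trans e
  | cons i u ih =>
    intro (g : (Ind (regAct ρ (cs.simple i)) (thetaWord cs ρ u)).carrier →ₗ[k] T.S)
      (hg : IsFun T (Ind (regAct ρ (cs.simple i)) (thetaWord cs ρ u)) (cs.wordProd (i :: u)) g) h0
    have hs := cs.simple_mul_simple_self i
    have hu' : cs.IsReduced u := hu.drop 1
    have h1 : funSame (N := thetaWord cs ρ u) (s := cs.simple i) g (α i) = 0 :=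
      LinearMap.ext fun n => by
        rw [funSame_apply, IsFun.ind_root cs hα hk hu hg]; simp
    refine hg.eq_zero_of_same_refl hs (hα i) hk (simple_ne_one cs i) h1 ?_
    have hg2 := hg.refl (hα i) hk
    rw [cs.wordProd_cons, ← mul_assoc, hs, one_mul] at hg2
    refine ih hu' hg2 ?_
    rw [funRefl_apply, IsFun.ind_root cs hα hk hu hg]
    have h0' : g (ind _ _ (word1 cs ρ u)) = 0 := h0
    rw [h0']; simp

end Words

end Functional

/-! ### Light leaves -/

section SemiHom

open GrBimod

variable {k : Type u} [Field k] {A : GrAlg.{u, v} k} {φ : GrAlg.Hom A A} {α : A.carrier}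

/-- Right linear maps that are left linear over the fixed points of `φ`. -/
structure IsSemi (φ : GrAlg.Hom A A) (N P : GrBimod A A) (g : N.carrier →ₗ[k] P.carrier) :
    Prop where
  left : ∀ r, φ.toAlgHom r = r → ∀ n, g (N.lact r n) = P.lact r (g n)
  right : ∀ b n, g (N.ract b n) = P.ract b (g n)

theorem isSemi_ind (N : GrBimod A A) : IsSemi φ N (Ind φ N) (ind φ N) :=
  ⟨fun _ hr n => ind_lact N hr n, ind_ract N⟩

theorem isSemi_hom {N P : GrBimod A A} (f : hom N P) : IsSemi φ N P f.1 :=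
  ⟨fun r _ n => f.2.1 r n, f.2.2⟩

theorem IsSemi.comp {N P Q : GrBimod A A} {g : P.carrier →ₗ[k] Q.carrier}
    {f : N.carrier →ₗ[k] P.carrier} (hg : IsSemi φ P Q g) (hf : IsSemi φ N P f) :
    IsSemi φ N Q (g ∘ₗ f) :=
  ⟨fun r hr n => by
    rw [LinearMap.comp_apply, LinearMap.comp_apply, hf.left r hr, hg.left r hr],
    fun b n => by rw [LinearMap.comp_apply, LinearMap.comp_apply, hf.right, hg.right]⟩

variable {N P : GrBimod A A} {g : N.carrier →ₗ[k] P.carrier} (hg : IsSemi φ N P g)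
  (h : IsRefl φ α) (hk : (2 : k) ≠ 0)
include hg h hk

/-- The morphism `A ⊗_{A^φ} N → P` induced by `g`. -/
theorem IsSemi.exists_extend : ∃ f : hom (Ind φ N) P, ∀ n₀ n₁,
    f.1 (ind φ N n₀ + (Ind φ N).lact α (ind φ N n₁)) = g n₀ + P.lact α (g n₁) :=
  ⟨⟨h.extend hk N P.lact g, h.extend_lact hk N P.lact g hg.left,
    h.extend_ract hk N P.lact g (ψ := P.ract) (fun b x => (P.comm _ _ _).symm) hg.right⟩,
    fun n₀ n₁ => by
      change h.extend hk N P.lact g _ = _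
      rw [IsRefl.extend_apply, IsRefl.coord_add]⟩

/-- The morphism `N → A ⊗_{A^φ} P`, `n ↦ 1 ⊗ g(α n) + α ⊗ g(n)`. -/
theorem IsSemi.exists_coextend : ∃ f : hom N (Ind φ P), ∀ n,
    f.1 n = ind φ P (g (N.lact α n)) + (Ind φ P).lact α (ind φ P (g n)) := by
  let f : N.carrier →ₗ[k] (Ind φ P).carrier :=
    ind φ P ∘ₗ g ∘ₗ N.lact α + (Ind φ P).lact α ∘ₗ ind φ P ∘ₗ g
  have hf : ∀ n, f n = ind φ P (g (N.lact α n)) + (Ind φ P).lact α (ind φ P (g n)) := fun n => rfl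
  refine ⟨⟨f, h.linear_of_root N.lact (Ind φ P).lact f ?_ ?_ hk, ?_⟩, hf⟩
  · intro r hr n
    rw [hf, hf, lact_lact, mul_comm α r, ← lact_lact, hg.left r hr, hg.left r hr, map_add,
      ind_lact P hr, ind_lact P hr, lact_lact, lact_lact, mul_comm]
  · intro n
    rw [hf, hf, lact_lact, hg.left _ h.map_sq, ind_lact P h.map_sq, map_add, lact_lact, add_comm]
  · intro b n
    rw [hf, hf, N.comm, hg.right, hg.right, ind_ract, ind_ract, map_add, (Ind φ P).comm]

end SemiHom

/-! ### Adding a letter to a light leaf -/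

section LightLeaves

open GrBimod

variable {k : Type u} [Field k] {W : Type*} [Group W] {U : Type v} [AddCommGroup U] [Module k U]
  {ρ : Representation k W U} {B : Type*} {C : CoxeterMatrix B} (cs : CoxeterSystem C W)
  {α : B → (regFun k U).carrier} (hα : ∀ i, IsRefl (regAct ρ (cs.simple i)) (α i))
  (hk : (2 : k) ≠ 0)

/-- Composition of morphisms. -/
def homComp {A D : GrAlg.{u, v} k} {M N P : GrBimod A D} (g : hom N P) (f : hom M N) : hom M P :=
  ⟨g.1 ∘ₗ f.1, fun a m => by simp only [LinearMap.comp_apply, f.2.1, g.2.1],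
    fun b m => by simp only [LinearMap.comp_apply, f.2.2, g.2.2]⟩

theorem homComp_apply {A D : GrAlg.{u, v} k} {M N P : GrBimod A D} (g : hom N P) (f : hom M N)
    (m : M.carrier) : (homComp g f).1 m = g.1 (f.1 m) := rfl

/-- The component of degree `d` of a morphism. -/
theorem exists_component {A D : GrAlg.{u, v} k} {M N : GrBimod A D} (f : hom M N) (d : ℤ) :
    ∃ f' : hom M N, HasDegree f' d ∧
      ∀ j, ∀ m ∈ M.gr j, f'.1 m = grProj N.internal (j + d) (f.1 m) := by
  classical
  let F : M.carrier →ₗ[k] N.carrier := DirectSum.toModule k ℤ N.carrier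
    (fun j => grProj N.internal (j + d) ∘ₗ f.1 ∘ₗ (M.gr j).subtype) ∘ₗ
      (grEquiv M.internal).symm.toLinearMap
  have hF : ∀ j, ∀ m ∈ M.gr j, F m = grProj N.internal (j + d) (f.1 m) := by
    intro j m hm
    simp only [F, LinearMap.comp_apply, LinearEquiv.coe_coe, grEquiv_symm_of_mem M.internal hm,
      DirectSum.toModule_lof, Submodule.subtype_apply]
  refine ⟨⟨F, fun a m => ?_, fun b m => ?_⟩, fun j m hm => ?_, hF⟩
  · refine gr_induction A.internal (p := fun a => F (M.lact a m) = N.lact a (F m)) a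
      (fun i a ha => ?_) (by simp) (fun x y hx hy => by
        rw [map_add, map_add, LinearMap.add_apply, LinearMap.add_apply, map_add, hx, hy])
    refine gr_induction M.internal (p := fun m => F (M.lact a m) = N.lact a (F m)) m
      (fun j m hm => ?_) (by simp) (fun x y hx hy => by simp only [map_add, hx, hy])
    rw [hF _ _ hm, hF _ _ (M.lact_mem ha hm), f.2.1,
      show i + j + d = (j + d) + i by ring]
    exact grProj_comm N.internal N.internal (N.lact a) i
      (fun j m hm => add_comm i j ▸ N.lact_mem ha hm) _ _
  · refine gr_induction D.internal (p := fun a => F (M.ract a m) = N.ract a (F m)) b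
      (fun i a ha => ?_) (by simp) (fun x y hx hy => by
        rw [map_add, map_add, LinearMap.add_apply, LinearMap.add_apply, map_add, hx, hy])
    refine gr_induction M.internal (p := fun m => F (M.ract a m) = N.ract a (F m)) m
      (fun j m hm => ?_) (by simp) (fun x y hx hy => by simp only [map_add, hx, hy])
    rw [hF _ _ hm, hF _ _ (M.ract_mem ha hm), f.2.2,
      show i + j + d = (j + d) + i by ring]
    exact grProj_comm N.internal N.internal (N.ract a) i
      (fun j m hm => add_comm i j ▸ N.ract_mem ha hm) _ _
  · change F m ∈ _
    rw [hF j m hm]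
    exact grProj_mem _ _ _

include hα hk in
/-- The two light leaves obtained from one by adding a letter. -/
theorem exists_leaf_step (i : B) {N : GrBimod (regFun k U) (regFun k U)} {u : List B}
    (hu : cs.IsReduced u) (hiu : cs.IsReduced (i :: u) ∨ ∃ u', u = i :: u')
    (f : hom (thetaWord cs ρ u) N) {d : ℤ} (hd : HasDegree f d) :
    ∃ (u₀ u₁ : List B) (f₀ : hom (thetaWord cs ρ u₀) (Ind (regAct ρ (cs.simple i)) N))
      (f₁ : hom (thetaWord cs ρ u₁) (Ind (regAct ρ (cs.simple i)) N)) (c : N.carrier),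
      cs.IsReduced u₀ ∧ cs.IsReduced u₁ ∧
      cs.wordProd u₁ = cs.simple i * cs.wordProd u₀ ∧
      u₁.length = u₀.length + 1 ∧
      f₁.1 (word1 cs ρ u₁) = ind _ N (f.1 (word1 cs ρ u)) ∧
      f₀.1 (word1 cs ρ u₀) = ind _ N c +
        (Ind (regAct ρ (cs.simple i)) N).lact (α i) (ind _ N (f.1 (word1 cs ρ u))) ∧
      c ∈ N.gr (d + 2) ∧
      (cs.wordProd u = cs.wordProd u₀ ∧ c = N.lact (α i) (f.1 (word1 cs ρ u)) ∨
        cs.wordProd u = cs.wordProd u₁ ∧ ∀ (T : Target.{u, v, w} ρ) (g : N.carrier →ₗ[k] T.S),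
          IsFun T N (cs.wordProd u) g →
            g c = - (T.Q (α i) * g (f.1 (word1 cs ρ u)))) := by
  rcases hiu with hiu | ⟨u', rfl⟩
  · obtain ⟨f₁, hf₁⟩ := ((isSemi_ind N).comp (isSemi_hom f)).exists_extend (hα i) hk
    obtain ⟨f₀, hf₀⟩ := (isSemi_hom (φ := regAct ρ (cs.simple i)) f).exists_coextend (hα i) hk
    have e₁ : f₁.1 (ind _ _ (word1 cs ρ u)) = ind _ N (f.1 (word1 cs ρ u)) := by
      simpa using hf₁ (word1 cs ρ u) 0
    refine ⟨u, i :: u, f₀, f₁, N.lact (α i) (f.1 (word1 cs ρ u)), hu, hiu, cs.wordProd_cons i u,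
      rfl, e₁, ?_, ?_, Or.inl ⟨rfl, rfl⟩⟩
    · rw [hf₀, f.2.1]
    · have := N.lact_mem (hα i).mem (hd _ _ (word1_mem cs u))
      rwa [show 2 + (0 + d) = d + 2 by ring] at this
  -- The letter is a descent: f₁ keeps the word i :: u', and coextension of f restricted to 1 ⊗
  -- θ_{u'} gives f₀ from the shorter word u'. Now c is f(1 ⊗ α(1⊗⋯⊗1)), on which functionals of top
  -- twist take the value -α g(b).
  · have hu' : cs.IsReduced u' := hu.drop 1
    let f' : hom (Ind (regAct ρ (cs.simple i)) (thetaWord cs ρ u')) N := f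
    have hsemi : IsSemi (regAct ρ (cs.simple i)) (thetaWord cs ρ u') N
        (f'.1 ∘ₗ ind _ (thetaWord cs ρ u')) := (isSemi_hom f').comp (isSemi_ind _)
    obtain ⟨f₁, hf₁⟩ := ((isSemi_ind N).comp hsemi).exists_extend (hα i) hk
    obtain ⟨f₀, hf₀⟩ := hsemi.exists_coextend (hα i) hk
    have e₁ : f₁.1 (ind _ _ (word1 cs ρ u')) =
        ind _ N (f'.1 (ind _ _ (word1 cs ρ u'))) := by
      simpa using hf₁ (word1 cs ρ u') 0
    refine ⟨u', i :: u', f₀, f₁, f'.1 (ind _ _ ((thetaWord cs ρ u').lact (α i) (word1 cs ρ u'))),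
      hu', hu, cs.wordProd_cons i u', rfl, e₁, ?_, ?_, Or.inr ⟨rfl, ?_⟩⟩
    · rw [hf₀]; rfl
    · have := hd _ _ (ind_mem (φ := regAct ρ (cs.simple i)) _
          ((thetaWord cs ρ u').lact_mem (hα i).mem (word1_mem cs u')))
      rwa [show 2 + 0 + d = d + 2 by ring] at this
    · intro T g hg
      exact IsFun.ind_root cs hα hk hu (hg.comp f') (word1 cs ρ u')

end LightLeaves

/-! ### Families of light leaves and their independence -/

section LeafFamilies

open GrBimod

variable {k : Type u} [Field k] {W : Type*} [Group W] {U : Type v} [AddCommGroup U] [Module k U]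
  {ρ : Representation k W U} {B : Type*} {C : CoxeterMatrix B} (cs : CoxeterSystem C W)
  {α : B → (regFun k U).carrier} (hα : ∀ i, IsRefl (regAct ρ (cs.simple i)) (α i))
  (hk : (2 : k) ≠ 0)

/-- A finite family of morphisms from reduced words to `N` whose values at `1 ⊗ ⋯ ⊗ 1` look like a
basis of `N` as a left module, adapted to functionals. -/
structure LeafFamily (ρ : Representation k W U) (N : GrBimod (regFun k U) (regFun k U)) where
  J : Type
  [fintype : Fintype J]
  u : J → List B
  red : ∀ j, cs.IsReduced (u j)
  f : ∀ j, hom (thetaWord cs ρ (u j)) N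
  d : J → ℤ
  deg : ∀ j, HasDegree (f j) (d j)
  indep : ∀ (T : Target.{u, v, max u v} ρ) (x : W) (a : J → T.S),
    (∀ j, cs.wordProd (u j) ≠ x → a j = 0) →
    (∀ g, IsFun T N x g → ∑ j, a j * g ((f j).1 (word1 cs ρ (u j))) = 0) → ∀ j, a j = 0
  count : ∀ i, Module.finrank k (N.gr i) =
    ∑ j, Module.finrank k ((regFun k U).gr (i - d j))

attribute [instance] LeafFamily.fintype

/-- Any two reduced words of the same element are related by a morphism that preserves
`1 ⊗ ⋯ ⊗ 1`. -/
def HasBraidMorphisms (ρ : Representation k W U) : Prop :=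
  ∀ u v, cs.IsReduced u → cs.IsReduced v → cs.wordProd u = cs.wordProd v →
    ∃ β : hom (thetaWord cs ρ u) (thetaWord cs ρ v), β.1 (word1 cs ρ u) = word1 cs ρ v

/-- Since 1⊗⋯⊗1 has degree 0, the component of degree d of f has the same value there. This repairs
morphisms, such as composites with braid morphisms, not known to be homogeneous. -/
theorem exists_homogeneous {u : List B} {N : GrBimod (regFun k U) (regFun k U)}
    (f : hom (thetaWord cs ρ u) N) {d : ℤ} (hf : f.1 (word1 cs ρ u) ∈ N.gr d) :
    ∃ f' : hom (thetaWord cs ρ u) N, HasDegree f' d ∧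
      f'.1 (word1 cs ρ u) = f.1 (word1 cs ρ u) := by
  obtain ⟨f', h1, h2⟩ := exists_component f d
  refine ⟨f', h1, ?_⟩
  rw [h2 _ _ (word1_mem cs u), zero_add, grProj_of_mem _ hf]

def LeafFamily.nil : LeafFamily cs ρ (thetaWord cs ρ []) where
  J := Unit
  u := fun _ => []
  red := fun _ => by simp [CoxeterSystem.IsReduced]
  f := fun _ => ⟨LinearMap.id, fun _ _ => rfl, fun _ _ => rfl⟩
  d := fun _ => 0
  deg := fun _ i m hm => by rw [add_zero]; exact hm
  indep := fun T x a h1 h2 j => by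
    by_cases hx : x = 1
    · subst hx
      -- The map Q is itself a functional of twist 1, with value 1 at 1.
      have := h2 T.Q.toLinearMap ⟨fun a m => map_mul T.Q a m, fun b m => by
        rw [map_one, AlgHom.one_apply]; exact map_mul T.Q b m⟩
      have e : ∑ j : Unit, a j * T.Q 1 = 0 := this
      simpa using e
    · exact h1 j (by simpa using Ne.symm hx)
  count := fun i => by
    rw [Finset.univ_unique, Finset.sum_singleton, sub_zero]; rfl

include hα hk in
-- Composition with the leaf gives a functional on a reduced word whose twist is neither the product
-- of the word nor shorter than it. This is the triangularity of light leaves.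
theorem IsFun.leaf_eq_zero {T : Target.{u, v, w} ρ} {N : GrBimod (regFun k U) (regFun k U)}
    {x : W} {g : N.carrier →ₗ[k] T.S} (hg : IsFun T N x g) {u : List B} (hu : cs.IsReduced u)
    (f : hom (thetaWord cs ρ u) N) (hx : x ≠ cs.wordProd u)
    (hl : cs.length (cs.wordProd u) ≤ cs.length x) : g (f.1 (word1 cs ρ u)) = 0 := by
  have h := (hg.comp f).eq_zero_or cs hα hk
  rw [← hu.eq] at h
  exact LinearMap.congr_fun (h.resolve_right (by rintro (h | h) <;> [exact hx h; omega])) _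

include hα hk in
-- The coordinates with respect to 1 and α give A ⊗_{A^φ} N ≅ N ⊕ N(-2) as graded spaces.
theorem finrank_ind (i : B) (N : GrBimod (regFun k U) (regFun k U))
    (hN : ∀ j, Module.Finite k (N.gr j)) (j : ℤ) :
    Module.finrank k ((Ind (regAct ρ (cs.simple i)) N).gr j) =
      Module.finrank k (N.gr j) + Module.finrank k (N.gr (j - 2)) ∧
    Module.Finite k ((Ind (regAct ρ (cs.simple i)) N).gr j) := by
  have := hN j
  have := hN (j - 2)
  let e : (Ind (regAct ρ (cs.simple i)) N).gr j ≃ₗ[k] N.gr j × N.gr (j - 2) :=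
    LinearEquiv.ofSubmodules ((hα i).coord hk N) _ ((N.gr j).prod (N.gr (j - 2))) (by
      ext t
      rw [Submodule.mem_map_equiv, (hα i).mem_gr_iff hk, LinearEquiv.apply_symm_apply]
      rfl) ≪≫ₗ
    { toFun := fun t => (⟨t.1.1, t.2.1⟩, ⟨t.1.2, t.2.2⟩)
      invFun := fun t => ⟨(t.1.1, t.2.1), t.1.2, t.2.2⟩
      map_add' := fun _ _ => rfl
      map_smul' := fun _ _ => rfl
      left_inv := fun _ => rfl
      right_inv := fun _ => rfl }
  exact ⟨by rw [e.finrank_eq, Module.finrank_prod], Module.Finite.equiv e.symm⟩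

section Independence

variable {s : W} (hs : s * s = 1) {r : (regFun k U).carrier} (h : IsRefl (regAct ρ s) r)
  {T : Target.{u, v, w} ρ} {N : GrBimod (regFun k U) (regFun k U)} {J : Type*} [Fintype J]
  {x : J → W} {b : J → N.carrier}
  (hind : ∀ (y : W) (a : J → T.S), (∀ j, x j ≠ y → a j = 0) →
    (∀ g, IsFun T N y g → ∑ j, a j * g (b j) = 0) → ∀ j, a j = 0)

include hs h hk hind in
-- For the elements 1 ⊗ b_j. Extensions of functionals of twist y see only the terms with x_j = y,
-- by triangularity, so these coefficients vanish; the reflected extensions of functionals of twist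
-- s y then deal with the others.
theorem indep_upper {y : W}
    (htop : ∀ j g, IsFun T N y g → x j = s * y → g (b j) = 0)
    {a : J → T.S} (ha : ∀ j, a j = 0 ∨ x j = y ∨ x j = s * y)
    (h0 : ∀ g, IsFun T (Ind (regAct ρ s) N) y g → ∑ j, a j * g (ind _ N (b j)) = 0) (j : J) :
    a j = 0 := by
  classical
  have h1 : ∀ j, x j = y → a j = 0 := by
    intro j hj
    have := hind y (fun j => if x j = y then a j else 0) (fun j hj => if_neg hj) (fun g hg => by
      refine Eq.trans (Finset.sum_congr rfl fun j _ => ?_) (h0 _ (hg.extend_same h hk))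
      rw [h.extend_ind]
      split_ifs with hj
      · rfl
      · rcases ha j with h | h | h
        · simp [h]
        · exact absurd h hj
        · rw [htop j g hg h]; simp) j
    simpa [hj] using this
  have h2 := hind (s * y) (fun j => T.act s (a j)) (fun j hj => by
      rcases ha j with h | h | h
      · rw [h, map_zero]
      · rw [h1 j h, map_zero]
      · exact absurd h hj) (fun g hg => by
      have hg' := hg.extend_refl h hk
      rw [← mul_assoc, hs, one_mul] at hg'
      have := congrArg (T.act s) (h0 _ hg')
      rw [map_zero, map_sum] at this
      refine Eq.trans (Finset.sum_congr rfl fun j _ => ?_) this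
      rw [h.extend_ind, map_mul, LinearMap.comp_apply, AlgHom.toLinearMap_apply,
        T.act_act hs]) j
  have := congrArg (T.act s) h2
  rwa [T.act_act hs, map_zero] at this

include hs h hk hind in
-- For the elements 1 ⊗ c_j + α ⊗ b_j. On the terms with x_j = y, where c_j = α b_j, the reflected
-- extension gives s(α g(b_j)) + α s(g(b_j)) = 0, while on those with x_j = s y it gives 2α
-- s(g(b_j)). So the latter coefficients vanish first. The plain extension then gives 2α g(b_j) on
-- the remaining terms.
theorem indep_lower (hs1 : s ≠ 1) {y : W} (hy : y ≠ s * y) {c : J → N.carrier}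
    {a : J → T.S} (ha : ∀ j, a j = 0 ∨ (x j = y ∧ c j = N.lact r (b j)) ∨ (x j = s * y ∧
      ∀ g, IsFun T N (s * y) g → g (c j) = - (T.Q r * g (b j))))
    (h0 : ∀ g, IsFun T (Ind (regAct ρ s) N) y g →
      ∑ j, a j * g (ind _ N (c j) + (Ind (regAct ρ s) N).lact r (ind _ N (b j))) = 0) (j : J) :
    a j = 0 := by
  classical
  have hne : 2 * T.Q r ≠ 0 := mul_ne_zero (T.two_ne_zero hk) (T.root_ne_zero h hs1)
  have h1 : ∀ j, x j = s * y → a j = 0 := by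
    intro j hj
    have := hind (s * y) (fun j => if x j = s * y then T.act s (a j * (2 * T.Q r)) else 0)
      (fun j hj => if_neg hj) (fun g hg => by
      have hg' := hg.extend_refl h hk
      rw [← mul_assoc, hs, one_mul] at hg'
      have := congrArg (T.act s) (h0 _ hg')
      rw [map_zero, map_sum] at this
      refine Eq.trans (Finset.sum_congr rfl fun j _ => ?_) this
      rw [h.extend_apply, h.coord_add, LinearMap.comp_apply, LinearMap.comp_apply,
        AlgHom.toLinearMap_apply, AlgHom.toLinearMap_apply, T.left_apply]
      rcases ha j with h' | ⟨h', hc⟩ | ⟨h', hc⟩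
      · simp [h']
      · rw [if_neg (h' ▸ hy), hc, hg.left, map_mul (T.act s) (T.Q r), T.act_root h]
        simp
      · rw [if_pos h', hc g hg, map_neg, map_mul (T.act s) (T.Q r), T.act_root h]
        simp only [map_mul, map_add, map_neg, T.act_act hs, T.act_root h, map_ofNat]
        ring) j
    rw [if_pos hj] at this
    have h3 := congrArg (T.act s) this
    rw [T.act_act hs, map_zero] at h3
    exact (mul_eq_zero.1 h3).resolve_right hne
  have h2 := hind y (fun j => a j * (2 * T.Q r)) (fun j hj => by
      rcases ha j with h | h | h
      · rw [h, zero_mul]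
      · exact absurd h.1 hj
      · rw [h1 j h.1, zero_mul]) (fun g hg => by
      refine Eq.trans (Finset.sum_congr rfl fun j _ => ?_) (h0 _ (hg.extend_same h hk))
      rw [h.extend_apply, h.coord_add, T.left_apply]
      rcases ha j with h' | ⟨h', hc⟩ | ⟨h', hc⟩
      · simp [h']
      · rw [hc, hg.left]; ring
      · rw [h1 j h']; ring) j
  exact (mul_eq_zero.1 h2).resolve_right hne

end Independence

/-- If i is a left descent of the product of the word, some reduced word of that product starts with
i, and a braid morphism replaces the given word by it without changing the basis element. -/
theorem LeafFamily.exists_descent (hbr : HasBraidMorphisms cs ρ) (i : B)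
    {N : GrBimod (regFun k U) (regFun k U)} (L : LeafFamily cs ρ N) (j : L.J) :
    ∃ (u : List B) (f : hom (thetaWord cs ρ u) N), cs.IsReduced u ∧
      (cs.IsReduced (i :: u) ∨ ∃ u', u = i :: u') ∧ cs.wordProd u = cs.wordProd (L.u j) ∧
      HasDegree f (L.d j) ∧ f.1 (word1 cs ρ u) = (L.f j).1 (word1 cs ρ (L.u j)) := by
  rcases cs.length_simple_mul (cs.wordProd (L.u j)) i with h | h
  · refine ⟨L.u j, L.f j, L.red j, Or.inl ?_, rfl, L.deg j, rfl⟩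
    rw [CoxeterSystem.IsReduced, cs.wordProd_cons, h, (L.red j).eq, List.length_cons]
  · obtain ⟨u', hu', e⟩ := cs.exists_isReduced (cs.simple i * cs.wordProd (L.u j))
    have e2 : cs.wordProd (i :: u') = cs.wordProd (L.u j) := by
      rw [cs.wordProd_cons, ← e, ← mul_assoc, cs.simple_mul_simple_self, one_mul]
    have hr : cs.IsReduced (i :: u') := by
      rw [CoxeterSystem.IsReduced, e2, ← h, e, hu'.eq, List.length_cons]
    obtain ⟨β, hβ⟩ := hbr _ _ hr (L.red j) e2
    have e3 : (homComp (L.f j) β).1 (word1 cs ρ (i :: u')) =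
        (L.f j).1 (word1 cs ρ (L.u j)) := by rw [homComp_apply, hβ]
    obtain ⟨f, hf, e4⟩ := exists_homogeneous cs (homComp (L.f j) β) (d := L.d j) (by
      rw [e3]; have := L.deg j _ _ (word1_mem cs (L.u j)); rwa [zero_add] at this)
    exact ⟨i :: u', f, hr, Or.inr ⟨u', rfl⟩, e2, hf, e4.trans e3⟩

include hα hk in
-- Each leaf gives two, of degrees d and d + 2, matching the two summands of the induced bimodule in
-- the dimension count.
theorem LeafFamily.exists_step (hbr : HasBraidMorphisms cs ρ) (i : B)
    {N : GrBimod (regFun k U) (regFun k U)} (hN : ∀ j, Module.Finite k (N.gr j))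
    (L : LeafFamily cs ρ N) :
    Nonempty (LeafFamily cs ρ (Ind (regAct ρ (cs.simple i)) N)) := by
  have key : ∀ j, ∃ (u₀ u₁ : List B)
      (f₀ : hom (thetaWord cs ρ u₀) (Ind (regAct ρ (cs.simple i)) N))
      (f₁ : hom (thetaWord cs ρ u₁) (Ind (regAct ρ (cs.simple i)) N)) (c : N.carrier),
      cs.IsReduced u₀ ∧ cs.IsReduced u₁ ∧
      cs.wordProd u₁ = cs.simple i * cs.wordProd u₀ ∧
      u₁.length = u₀.length + 1 ∧
      HasDegree f₁ (L.d j) ∧ HasDegree f₀ (L.d j + 2) ∧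
      f₁.1 (word1 cs ρ u₁) = ind _ N ((L.f j).1 (word1 cs ρ (L.u j))) ∧
      f₀.1 (word1 cs ρ u₀) = ind _ N c + (Ind (regAct ρ (cs.simple i)) N).lact (α i)
        (ind _ N ((L.f j).1 (word1 cs ρ (L.u j)))) ∧
      (cs.wordProd (L.u j) = cs.wordProd u₀ ∧
        c = N.lact (α i) ((L.f j).1 (word1 cs ρ (L.u j))) ∨
        cs.wordProd (L.u j) = cs.wordProd u₁ ∧
          ∀ (T : Target.{u, v, max u v} ρ) (g : N.carrier →ₗ[k] T.S),
          IsFun T N (cs.wordProd (L.u j)) g →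
            g c = - (T.Q (α i) * g ((L.f j).1 (word1 cs ρ (L.u j))))) := by
    intro j
    obtain ⟨u, f, hu, hiu, e1, hf, e2⟩ := L.exists_descent cs hbr i j
    obtain ⟨u₀, u₁, f₀, f₁, c, hu₀, hu₁, h1, h2, h3, h4, h5, h6⟩ :=
      exists_leaf_step.{u, v, max u v} cs hα hk i hu hiu f hf
    have hb : f.1 (word1 cs ρ u) ∈ N.gr (L.d j) := by
      have := hf _ _ (word1_mem cs u); rwa [zero_add] at this
    obtain ⟨f₁', d₁, e₁⟩ := exists_homogeneous cs f₁ (d := L.d j) (by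
      rw [h3]; exact ind_mem _ hb)
    obtain ⟨f₀', d₀, e₀⟩ := exists_homogeneous cs f₀ (d := L.d j + 2) (by
      rw [h4]; exact add_mem (ind_mem _ h5) ((hα i).lact_ind_mem _ hb))
    rw [e2] at h3 h4 h6
    rw [e1] at h6
    exact ⟨u₀, u₁, f₀', f₁', c, hu₀, hu₁, h1, h2, d₁, d₀, e₁.trans h3, e₀.trans h4, h6⟩
  choose u₀ u₁ f₀ f₁ c hu₀ hu₁ hw hl d₁ d₀ e₁ e₀ hc using key
  have hs := cs.simple_mul_simple_self i
  refine ⟨{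
    J := L.J × Bool
    u := fun p => if p.2 then u₁ p.1 else u₀ p.1
    red := ?_
    f := fun p => match p with
      | (j, true) => f₁ j
      | (j, false) => f₀ j
    d := fun p => if p.2 then L.d p.1 else L.d p.1 + 2
    deg := ?_
    indep := ?_
    count := ?_ }⟩
  · rintro ⟨j, _ | _⟩ <;> [exact hu₀ j; exact hu₁ j]
  · rintro ⟨j, _ | _⟩ <;> [exact d₀ j; exact d₁ j]
  · intro T y a ha h0
    have hlen : ∀ j, cs.length (cs.wordProd (u₁ j)) = cs.length (cs.wordProd (u₀ j)) + 1 :=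
      fun j => by rw [(hu₀ j).eq, (hu₁ j).eq, hl j]
    have hw' : ∀ j, cs.wordProd (u₀ j) = cs.simple i * cs.wordProd (u₁ j) := fun j => by
      rw [hw, ← mul_assoc, hs, one_mul]
    have hy : y ≠ cs.simple i * y := fun h => by
      have := cs.length_simple_mul y i
      rw [← h] at this; omega
    have hind : ∀ (y : W) (a : L.J → T.S), (∀ j, cs.wordProd (L.u j) ≠ y → a j = 0) →
      (∀ g, IsFun T N y g → ∑ j, a j * g ((L.f j).1 (word1 cs ρ (L.u j))) = 0) →
        ∀ j, a j = 0 := L.indep T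
    have h1 : ∀ g, IsFun T (Ind (regAct ρ (cs.simple i)) N) y g →
        (∑ j, a (j, true) * g ((f₁ j).1 (word1 cs ρ (u₁ j)))) +
          ∑ j, a (j, false) * g ((f₀ j).1 (word1 cs ρ (u₀ j))) = 0 := by
      intro g hg
      rw [← h0 g hg, Fintype.sum_prod_type, ← Finset.sum_add_distrib]
      exact Finset.sum_congr rfl fun j _ => by rw [Fintype.sum_bool]; rfl
    have ha₁ : ∀ j, cs.wordProd (u₁ j) ≠ y → a (j, true) = 0 := fun j => ha (j, true)
    have ha₀ : ∀ j, cs.wordProd (u₀ j) ≠ y → a (j, false) = 0 := fun j => ha (j, false)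
    -- The word of f₁ is longer than that of f₀ and their products differ by the letter i, so for a
    -- given y only one kind of leaf occurs: f₀ if i is not a left descent of y, and f₁ if it is.
    rcases cs.length_simple_mul y i with hly | hly
    · have hz : ∀ j, a (j, true) = 0 := fun j => ha₁ j fun h => by
        have := hlen j
        rw [hw', h] at this; omega
      have := indep_lower hk hs (hα i) hind (simple_ne_one cs i) hy (c := c)
        (a := fun j => a (j, false)) (fun j => by
          by_cases hj : cs.wordProd (u₀ j) = y
          · rcases hc j with ⟨h, hc⟩ | ⟨h, hc⟩
            · exact Or.inr (Or.inl ⟨h.trans hj, hc⟩)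
            · rw [hw, hj] at h
              exact Or.inr (Or.inr ⟨h, fun g hg => hc T g (h.symm ▸ hg)⟩)
          · exact Or.inl (ha₀ j hj)) (fun g hg => by
          rw [← h1 g hg]
          simp only [hz, zero_mul, Finset.sum_const_zero, zero_add, e₀])
      rintro ⟨j, _ | _⟩ <;> [exact this j; exact hz j]
    · have hz : ∀ j, a (j, false) = 0 := fun j => ha₀ j fun h => by
        have := hlen j
        rw [hw, h] at this; omega
      have := indep_upper hk hs (hα i) hind (fun j g hg hj =>
          hg.leaf_eq_zero cs hα hk (L.red j) (L.f j) (hj ▸ hy) (by rw [hj]; omega))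
        (a := fun j => a (j, true)) (fun j => by
          by_cases hj : cs.wordProd (u₁ j) = y
          · rcases hc j with ⟨h, -⟩ | ⟨h, -⟩
            · rw [hw', hj] at h
              exact Or.inr (Or.inr h)
            · exact Or.inr (Or.inl (h.trans hj))
          · exact Or.inl (ha₁ j hj)) (fun g hg => by
          rw [← h1 g hg]
          simp only [hz, zero_mul, Finset.sum_const_zero, add_zero, e₁])
      rintro ⟨j, _ | _⟩ <;> [exact hz j; exact this j]
  · intro j
    rw [(finrank_ind cs hα hk i N hN j).1, L.count, L.count, Fintype.sum_prod_type,
      ← Finset.sum_add_distrib]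
    refine Finset.sum_congr rfl fun l _ => ?_
    rw [Fintype.sum_bool]
    change _ = Module.finrank k ((regFun k U).gr (j - L.d l)) +
      Module.finrank k ((regFun k U).gr (j - (L.d l + 2)))
    rw [show j - 2 - L.d l = j - (L.d l + 2) by ring]

end LeafFamilies

/-! ### Light leaves as a basis, and central elements -/

section Spanning

open GrBimod

variable {k : Type u} [Field k] {W : Type*} [Group W] {U : Type v} [AddCommGroup U] [Module k U]
  {ρ : Representation k W U} {B : Type*} {C : CoxeterMatrix B} (cs : CoxeterSystem C W)
  {α : B → (regFun k U).carrier} (hα : ∀ i, IsRefl (regAct ρ (cs.simple i)) (α i))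
  (hk : (2 : k) ≠ 0)

theorem symGr_eq_bot {E : Type*} [AddCommGroup E] [Module k E] {n : ℤ} (hn : n < 0) :
    symGr k E n = ⊥ := by
  refine le_antisymm (iSup₂_le fun m hm => ?_) bot_le
  omega

theorem regFun_finite [FiniteDimensional k U] (i : ℤ) :
    Module.Finite k ((regFun k U).gr i) := by
  rw [Module.Finite.iff_fg]
  have h : (LinearMap.range (SymmetricAlgebra.ι k (Module.Dual k U))).FG :=
    Module.Finite.iff_fg.1 inferInstance
  change (symGr k (Module.Dual k U) i).FG
  by_cases hi : ∃ m : ℕ, 2 * (m : ℤ) = i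
  · obtain ⟨m, rfl⟩ := hi
    have e : symGr k (Module.Dual k U) (2 * m) =
        LinearMap.range (SymmetricAlgebra.ι k (Module.Dual k U)) ^ m := by
      refine le_antisymm (iSup₂_le fun m' hm' => ?_) (pow_le_symGr m)
      obtain rfl : m' = m := by omega
      exact le_rfl
    rw [e]
    exact h.pow m
  · have e : symGr k (Module.Dual k U) i = ⊥ :=
      le_antisymm (iSup₂_le fun m' hm' => absurd ⟨m', hm'⟩ hi) bot_le
    rw [e]
    exact Submodule.fg_bot

include hα hk in
theorem thetaWord_finite [FiniteDimensional k U] (ω : List B) :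
    ∀ j, Module.Finite k ((thetaWord cs ρ ω).gr j) := by
  induction ω with
  | nil => exact fun j => regFun_finite j
  | cons i ω ih => exact fun j => (finrank_ind cs hα hk i _ ih j).2

include hα hk in
theorem exists_leafFamily [FiniteDimensional k U] (hbr : HasBraidMorphisms cs ρ) (ω : List B) :
    Nonempty (LeafFamily cs ρ (thetaWord cs ρ ω)) := by
  induction ω with
  | nil => exact ⟨LeafFamily.nil cs⟩
  | cons i ω ih =>
    obtain ⟨L⟩ := ih
    exact L.exists_step cs hα hk hbr i (thetaWord_finite cs hα hk ω)

variable {N : GrBimod (regFun k U) (regFun k U)} (L : LeafFamily cs ρ N)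

/-- The basis of `N` given by a leaf family. -/
def LeafFamily.b (j : L.J) : N.carrier := (L.f j).1 (word1 cs ρ (L.u j))

theorem LeafFamily.b_mem (j : L.J) : L.b cs j ∈ N.gr (L.d j) := by
  have := L.deg j _ _ (word1_mem cs (L.u j))
  rwa [zero_add] at this

include hα hk in
-- Functionals of twist y kill the basis elements of other products of length at most that of y, so
-- on the sum they see only the terms of product y, to which independence applies.
theorem LeafFamily.top_eq_zero (T : Target.{u, v, max u v} ρ) (a : L.J → (regFun k U).carrier)
    (y : W) (hl : ∀ j, T.Q (a j) ≠ 0 → cs.length (cs.wordProd (L.u j)) ≤ cs.length y)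
    (h0 : ∀ g, IsFun T N y g → g (∑ j, N.lact (a j) (L.b cs j)) = 0) (j : L.J)
    (hj : cs.wordProd (L.u j) = y) : T.Q (a j) = 0 := by
  classical
  have := L.indep T y (fun j => if cs.wordProd (L.u j) = y then T.Q (a j) else 0)
    (fun j hj => if_neg hj) (fun g hg => by
      refine Eq.trans ?_ (h0 g hg)
      rw [map_sum]
      refine Finset.sum_congr rfl fun j _ => ?_
      rw [hg.left]
      split_ifs with hj
      · rfl
      · by_cases ha : T.Q (a j) = 0
        · rw [ha, zero_mul, zero_mul]
        · rw [LeafFamily.b, hg.leaf_eq_zero cs hα hk (L.red j) (L.f j) (Ne.symm hj) (hl j ha),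
            mul_zero, mul_zero]) j
  rwa [if_pos hj] at this

/-- The identity target. -/
def Target.self (h : ∀ w, w ≠ 1 → ∃ a, regRep ρ w a ≠ a) : Target.{u, v, max u v} ρ where
  S := (regFun k U).carrier
  Q := AlgHom.id k _
  act := regRep ρ
  equivariant _ _ := rfl
  faithful := h

include hα hk in
-- A nonzero coefficient whose word has maximal length is detected by functionals to R of that
-- twist.
theorem LeafFamily.linearIndependent (hρ : ∀ w, w ≠ 1 → ∃ a, regRep ρ w a ≠ a)
    (a : L.J → (regFun k U).carrier) (h0 : ∑ j, N.lact (a j) (L.b cs j) = 0) : a = 0 := by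
  classical
  by_contra hne
  obtain ⟨j, hj⟩ := Function.ne_iff.1 hne
  obtain ⟨j₀, h1, h2⟩ := (Finset.univ.filter fun j => a j ≠ 0).exists_max_image
    (fun j => cs.length (cs.wordProd (L.u j))) ⟨j, by simpa using hj⟩
  refine (Finset.mem_filter.1 h1).2 ?_
  refine L.top_eq_zero cs hα hk (Target.self hρ) a _ (fun j hj => h2 j ?_) (fun g _ => ?_) j₀ rfl
  · exact Finset.mem_filter.2 ⟨Finset.mem_univ _, hj⟩
  · rw [h0, map_zero]

include hα hk in
-- Spanning comes from counting: in each degree the map from coefficients to N is injective between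
-- finite-dimensional spaces of equal dimension.
theorem LeafFamily.exists_sum [FiniteDimensional k U] (hρ : ∀ w, w ≠ 1 → ∃ a, regRep ρ w a ≠ a)
    (hN : ∀ j, Module.Finite k (N.gr j)) (n : N.carrier) :
    ∃ a : L.J → (regFun k U).carrier, n = ∑ j, N.lact (a j) (L.b cs j) := by
  refine gr_induction N.internal (p := fun n => ∃ a : L.J → (regFun k U).carrier,
    n = ∑ j, N.lact (a j) (L.b cs j)) n (fun i n hn => ?_) ⟨0, by simp⟩ ?_
  · have hR : ∀ j, Module.Finite k ((regFun k U).gr (i - L.d j)) := fun j => regFun_finite _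
    have := hN i
    let Φ : (∀ j, (regFun k U).gr (i - L.d j)) →ₗ[k] N.gr i :=
      LinearMap.codRestrict _ (∑ j, (N.lact.toLinearMap.flip (L.b cs j)) ∘ₗ
        (Submodule.subtype _) ∘ₗ LinearMap.proj j) (fun a => by
          rw [LinearMap.sum_apply]
          refine sum_mem fun j _ => ?_
          have := N.lact_mem (a j).2 (L.b_mem cs j)
          rwa [sub_add_cancel] at this)
    have hΦ : ∀ a, (Φ a : N.carrier) = ∑ j, N.lact (a j) (L.b cs j) := fun a => by
      simp [Φ]
    have hinj : Function.Injective Φ := by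
      rw [injective_iff_map_eq_zero]
      intro a ha
      have := L.linearIndependent cs hα hk hρ (fun j => a j) (by rw [← hΦ, ha]; rfl)
      exact funext fun j => Subtype.ext (congrFun this j)
    have hsurj := (LinearMap.injective_iff_surjective_of_finrank_eq_finrank (by
      rw [Module.finrank_pi_fintype, L.count])).1 hinj
    obtain ⟨a, ha⟩ := hsurj ⟨n, hn⟩
    exact ⟨fun j => a j, by rw [← hΦ, ha]⟩
  · rintro _ _ ⟨a, rfl⟩ ⟨b, rfl⟩
    exact ⟨a + b, by simp [Finset.sum_add_distrib]⟩

/-- The sub-bimodule `I M + M I` for `I` the kernel of `Q`. -/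
def kerSpan {A A' : GrAlg.{u, v} k} (Q : A.carrier →ₐ[k] A'.carrier) (M : GrBimod A A) :
    Submodule k M.carrier :=
  Submodule.span k {x | ∃ a m, Q a = 0 ∧ (x = M.lact a m ∨ x = M.ract a m)}

theorem kerSpan_le {A A' : GrAlg.{u, v} k} {Q : A.carrier →ₐ[k] A'.carrier} {M : GrBimod A A}
    {p : Submodule k M.carrier} (h : ∀ a m, Q a = 0 → M.lact a m ∈ p ∧ M.ract a m ∈ p) :
    kerSpan Q M ≤ p := by
  refine Submodule.span_le.2 ?_
  rintro _ ⟨a, m, ha, rfl | rfl⟩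
  exacts [(h a m ha).1, (h a m ha).2]

theorem lact_mem_kerSpan {A A' : GrAlg.{u, v} k} {Q : A.carrier →ₐ[k] A'.carrier}
    {M : GrBimod A A} {a : A.carrier} (ha : Q a = 0) (m : M.carrier) : M.lact a m ∈ kerSpan Q M :=
  Submodule.subset_span ⟨a, m, ha, Or.inl rfl⟩

theorem ract_mem_kerSpan {A A' : GrAlg.{u, v} k} {Q : A.carrier →ₐ[k] A'.carrier}
    {M : GrBimod A A} {a : A.carrier} (ha : Q a = 0) (m : M.carrier) : M.ract a m ∈ kerSpan Q M :=
  Submodule.subset_span ⟨a, m, ha, Or.inr rfl⟩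

/-- The target given by restriction to a faithful subrepresentation. -/
def Target.restr (σ : Subrepresentation ρ) (hσ : Function.Injective σ.toRepresentation) :
    Target.{u, v, max u v} ρ where
  S := (regFun k σ.toSubmodule).carrier
  Q := (Soergel.restr σ.toSubmodule).toAlgHom
  act := regRep σ.toRepresentation
  equivariant w a := restr_regAct σ w a
  faithful _ hw := exists_restr_ne σ hσ hw

variable (σ : Subrepresentation ρ) (hσ : Function.Injective σ.toRepresentation)

/-- The left part is immediate, and the right part holds because the kernel of Q is stable under W
by equivariance. -/
theorem IsFun.kerSpan_eq_zero {x : W} {g : N.carrier →ₗ[k] (Target.restr σ hσ).S}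
    (hg : IsFun (Target.restr σ hσ) N x g) {m : N.carrier}
    (hm : m ∈ kerSpan (A' := regFun k σ.toSubmodule) (restr σ.toSubmodule).toAlgHom N) :
    g m = 0 := by
  refine (kerSpan_le (p := LinearMap.ker g) fun a m ha => ⟨?_, ?_⟩) hm
  · rw [LinearMap.mem_ker, hg.left]
    exact (congrArg (· * g m) ha).trans (zero_mul _)
  · rw [LinearMap.mem_ker, hg.right, Target.equivariant]
    have : (Target.restr σ hσ).act x ((Target.restr σ hσ).Q a) = 0 := by
      rw [show (Target.restr σ hσ).Q a = 0 from ha, map_zero]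
    rw [this, zero_mul]

include hα hk hσ L in
/-- An element that is central modulo `I N + N I` is central up to an element of `I N + N I`. -/
theorem LeafFamily.exists_central [FiniteDimensional k U] (hN : ∀ j, Module.Finite k (N.gr j))
    (m : N.carrier) (hm : ∀ b, N.lact b m - N.ract b m ∈
      kerSpan (A' := regFun k σ.toSubmodule) (restr σ.toSubmodule).toAlgHom N) :
    ∃ m' : N.carrier, (∀ b, N.lact b m' = N.ract b m') ∧
      m - m' ∈ kerSpan (A' := regFun k σ.toSubmodule) (restr σ.toSubmodule).toAlgHom N := by
  classical
  obtain ⟨a, ha⟩ := L.exists_sum cs hα hk (fun _ hw => exists_regRep_ne σ hσ hw) hN m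
  -- Among the leaves contradicting the claim take one of maximal length. Leaves of product 1 have
  -- length 0 and do not obstruct the leading-term argument, although their coefficients are
  -- arbitrary.
  have key : ∀ j, cs.wordProd (L.u j) ≠ 1 → (restr σ.toSubmodule).toAlgHom (a j) = 0 := by
    by_contra! hne
    obtain ⟨j, hj1, hj⟩ := hne
    obtain ⟨j₀, h1, h2⟩ := (Finset.univ.filter fun j => cs.wordProd (L.u j) ≠ 1 ∧
      (restr σ.toSubmodule).toAlgHom (a j) ≠ 0).exists_max_image
      (fun j => cs.length (cs.wordProd (L.u j))) ⟨j, by simpa using ⟨hj1, hj⟩⟩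
    obtain ⟨-, h3, h4⟩ := Finset.mem_filter.1 h1
    refine h4 (L.top_eq_zero cs hα hk (Target.restr σ hσ) a _ (fun j hj => ?_) (fun g hg => ?_)
      j₀ rfl)
    · by_cases hj1 : cs.wordProd (L.u j) = 1
      · rw [hj1, cs.length_one]; exact Nat.zero_le _
      · exact h2 j (Finset.mem_filter.2 ⟨Finset.mem_univ _, hj1, hj⟩)
    · rw [← ha]
      refine hg.eq_zero_of_central h3 fun b => ?_
      rw [← sub_eq_zero, ← map_sub]
      exact hg.kerSpan_eq_zero σ hσ (hm b)
  -- The lift keeps the terms whose word is empty; each of these is a multiple of the image of 1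
  -- under a morphism from R, hence central.
  refine ⟨∑ j, if cs.wordProd (L.u j) = 1 then N.lact (a j) (L.b cs j) else 0, fun b => ?_, ?_⟩
  · rw [map_sum, map_sum]
    refine Finset.sum_congr rfl fun j _ => ?_
    split_ifs with hj
    · rw [← N.comm, lact_lact, mul_comm, ← lact_lact]
      congr 1
      have hu : L.u j = [] := by
        have := (L.red j).eq
        rw [hj, cs.length_one] at this
        exact List.length_eq_zero_iff.1 this.symm
      rw [LeafFamily.b, ← (L.f j).2.1, ← (L.f j).2.2]
      congr 1
      rw [hu]; rfl
    · rw [map_zero, map_zero]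
  · rw [ha, ← Finset.sum_sub_distrib]
    refine sum_mem fun j _ => ?_
    split_ifs with hj
    · rw [sub_self]; exact zero_mem _
    · rw [sub_zero]; exact lact_mem_kerSpan (key j hj) _

end Spanning

/-! ### Braid morphisms -/

/-! ### The exchange condition and Matsumoto's theorem -/

section Exchange

open CoxeterSystem

variable {B W : Type*} [Group W] {C : CoxeterMatrix B} (cs : CoxeterSystem C W)

/-- A left descent occurs an odd number of times among the left inversions of any word of the
element, in particular at least once, and multiplying by an inversion deletes a letter. -/
theorem exists_eraseIdx {i : B} {ω : List B}
    (h : cs.length (cs.simple i * cs.wordProd ω) < cs.length (cs.wordProd ω)) :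
    ∃ j < ω.length, cs.simple i * cs.wordProd ω = cs.wordProd (ω.eraseIdx j) := by
  classical
  have h1 : invParity cs (cs.wordProd ω.reverse) (cs.simple i) = 1 := by
    rw [← mul_simple_lt_iff, cs.wordProd_reverse, cs.length_inv, ← cs.length_inv, mul_inv_rev,
      inv_inv, cs.inv_simple]
    exact h
  rw [invParity_wordProd] at h1
  have hm : cs.simple i ∈ cs.rightInvSeq ω.reverse := by
    by_contra hn
    rw [List.count_eq_zero_of_not_mem hn] at h1
    exact absurd h1 (by decide)
  rw [cs.rightInvSeq_reverse, List.mem_reverse] at hm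
  obtain ⟨j, hj, e⟩ := List.getElem_of_mem hm
  rw [cs.length_leftInvSeq] at hj
  refine ⟨j, hj, ?_⟩
  rw [← cs.getD_leftInvSeq_mul_wordProd, ← e, List.getD_eq_getElem]

/-- Alternating letters are peeled off one at a time. Both p and q are descents of x, so the next
letter can always be exchanged against a letter of the current word. -/
theorem exists_alternating {p q : B} {x : W} {N : ℕ}
    (hN : ∀ l, 0 < l → l < N → (cs.simple p * cs.simple q) ^ l ≠ 1)
    (hp : cs.length (cs.simple p * x) < cs.length x)
    (hq : cs.length (cs.simple q * x) < cs.length x) (n : ℕ) (hn : n ≤ N) :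
    ∃ z, x = cs.wordProd (alternatingWord p q n) * z ∧ cs.length x = n + cs.length z := by
  induction n with
  | zero => exact ⟨x, by simp [alternatingWord], by simp⟩
  | succ n ih =>
    obtain ⟨z, hz, hl⟩ := ih (by omega)
    obtain ⟨ζ, hζ, rfl⟩ := cs.exists_isReduced z
    rw [← cs.wordProd_append] at hz
    obtain ⟨a, ha, hax⟩ : ∃ a, alternatingWord p q (n + 1) = a :: alternatingWord p q n ∧
        cs.length (cs.simple a * x) < cs.length x := by
      refine ⟨_, alternatingWord_succ' p q n, ?_⟩
      split_ifs <;> assumption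
    have hred := isReduced_alternatingWord cs p q (n + 1) fun l h0 hl => hN l h0 (by omega)
    rw [hz] at hax
    obtain ⟨j, hj, e⟩ := exists_eraseIdx cs hax
    by_cases hjn : j < (alternatingWord p q n).length
    -- If the deleted letter belonged to the alternating part, the reduced alternating word of
    -- length n + 1 would equal a word of length n - 1.
    · exfalso
      rw [List.eraseIdx_append_of_lt_length hjn, cs.wordProd_append, cs.wordProd_append,
        ← mul_assoc, mul_left_inj, ← cs.wordProd_cons, ← ha] at e
      have h1 := hred.eq
      rw [e, length_alternatingWord] at h1
      have h2 := cs.length_wordProd_le ((alternatingWord p q n).eraseIdx j)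
      rw [List.length_eraseIdx_of_lt hjn, length_alternatingWord] at h2
      omega
    · rw [not_lt] at hjn
      have hj' : j - n < ζ.length := by
        rw [List.length_append, length_alternatingWord] at hj
        rw [length_alternatingWord] at hjn
        omega
      rw [List.eraseIdx_append_of_length_le hjn, cs.wordProd_append _ (ζ.eraseIdx _),
        length_alternatingWord] at e
      have e2 : x = cs.wordProd (alternatingWord p q (n + 1)) *
          cs.wordProd (ζ.eraseIdx (j - n)) := by
        rw [ha, cs.wordProd_cons, mul_assoc, ← e, hz, ← mul_assoc, cs.simple_mul_simple_self,
          one_mul]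
      refine ⟨_, e2, ?_⟩
      have h1 := cs.length_wordProd_le (ζ.eraseIdx (j - n))
      rw [List.length_eraseIdx_of_lt hj'] at h1
      have h2 := cs.length_mul_le (cs.wordProd (alternatingWord p q (n + 1)))
        (cs.wordProd (ζ.eraseIdx (j - n)))
      rw [← e2, hred.eq, length_alternatingWord] at h2
      rw [hζ.eq] at hl
      omega

/-- If two simple reflections are left descents of `x`, their product has finite order, at most the
length of `x`. -/
theorem orderOf_pos_and_le {p q : B} {x : W}
    (hp : cs.length (cs.simple p * x) < cs.length x)
    (hq : cs.length (cs.simple q * x) < cs.length x) :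
    0 < orderOf (cs.simple p * cs.simple q) ∧
      orderOf (cs.simple p * cs.simple q) ≤ cs.length x := by
  have hpos : 0 < orderOf (cs.simple p * cs.simple q) := by
    by_contra h0
    rw [not_lt, Nat.le_zero, orderOf_eq_zero_iff'] at h0
    obtain ⟨z, -, h⟩ := exists_alternating cs (N := cs.length x + 1) (fun l hl _ => h0 l hl)
      hp hq _ le_rfl
    omega
  refine ⟨hpos, ?_⟩
  obtain ⟨z, -, h⟩ := exists_alternating cs (N := orderOf (cs.simple p * cs.simple q))
      (fun l hl h => pow_ne_one_of_lt_orderOf hl.ne' h) hp hq _ le_rfl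
  omega

theorem exists_eq_alternating {p q : B} {m : ℕ} (hm : 0 < m) :
    ∃ u, alternatingWord p q m = (if Even m then p else q) :: u := by
  obtain ⟨m, rfl⟩ := Nat.exists_eq_succ_of_ne_zero hm.ne'
  refine ⟨alternatingWord p q m, (alternatingWord_succ' p q m).trans ?_⟩
  by_cases h : Even m <;> simp [Nat.even_add_one, h]

/-- A relation on words that contains the braid relations and is compatible with concatenation
relates any two reduced words of the same element. -/
theorem matsumoto {E : List B → List B → Prop} (refl : ∀ u, E u u)
    (trans : ∀ u v w, E u v → E v w → E u w) (cons : ∀ i u v, E u v → E (i :: u) (i :: v))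
    (append : ∀ u v z, E u v → E (u ++ z) (v ++ z))
    (braid : ∀ i j m, 0 < m → orderOf (cs.simple i * cs.simple j) = m →
      E (alternatingWord i j m) (alternatingWord j i m)) (u : List B) :
    ∀ v, cs.IsReduced u → cs.IsReduced v → cs.wordProd u = cs.wordProd v → E u v := by
  induction h : u.length generalizing u with
  | zero =>
    intro v hu hv e
    rw [List.length_eq_zero_iff] at h
    subst h
    have := hv.eq
    rw [← e, hu.eq] at this
    rw [List.length_eq_zero_iff.1 this.symm]
    exact refl _
  | succ n ih =>
    intro v hu hv e
    have hlen : v.length = n + 1 := by rw [← hv.eq, ← e, hu.eq, h]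
    obtain ⟨i, u, rfl⟩ := List.exists_cons_of_length_eq_add_one h
    obtain ⟨j, v, rfl⟩ := List.exists_cons_of_length_eq_add_one hlen
    have hE : ∀ (a : B) (u' v' : List B), u'.length = n → cs.IsReduced (a :: u') →
        cs.IsReduced (a :: v') → cs.wordProd (a :: u') = cs.wordProd (a :: v') →
        E (a :: u') (a :: v') := by
      intro a u' v' hl hu' hv' e
      refine cons _ _ _ (ih u' hl v' (hu'.drop 1) (hv'.drop 1) ?_)
      rwa [cs.wordProd_cons, cs.wordProd_cons, mul_right_inj] at e
    have desc : ∀ (a : B) (u' : List B), cs.IsReduced (a :: u') →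
        cs.length (cs.simple a * cs.wordProd (a :: u')) < cs.length (cs.wordProd (a :: u')) := by
      intro a u' hu'
      rw [hu'.eq, cs.wordProd_cons, ← mul_assoc, cs.simple_mul_simple_self, one_mul,
        List.length_cons]
      have := cs.length_wordProd_le u'
      omega
    have hi := desc i u hu
    have hj := desc j v hv
    rw [← e] at hj
    -- it suffices to treat reduced words that start with the two letters in a chosen order
    have main : ∀ (p q : B), cs.length (cs.simple p * cs.wordProd (i :: u)) <
        cs.length (cs.wordProd (i :: u)) → cs.length (cs.simple q * cs.wordProd (i :: u)) <
        cs.length (cs.wordProd (i :: u)) → ∀ a u' b v', 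
        (a, b) = (if Even (orderOf (cs.simple p * cs.simple q)) then (p, q) else (q, p)) →
        (a :: u').length = n + 1 → cs.IsReduced (a :: u') → cs.IsReduced (b :: v') →
        cs.wordProd (a :: u') = cs.wordProd (i :: u) →
        cs.wordProd (b :: v') = cs.wordProd (i :: u) → E (a :: u') (b :: v') := by
      intro p q hp hq a u' b v' hab hl hu' hv' eu ev
      obtain ⟨hm, -⟩ := orderOf_pos_and_le cs hp hq
      set m := orderOf (cs.simple p * cs.simple q) with hmdef
      have hlt : ∀ l, 0 < l → l < m → (cs.simple p * cs.simple q) ^ l ≠ 1 :=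
        fun l hl h => pow_ne_one_of_lt_orderOf hl.ne' h
      obtain ⟨z, hz, hlz⟩ := exists_alternating cs hlt hp hq m le_rfl
      obtain ⟨ζ, hζ, rfl⟩ := cs.exists_isReduced z
      have hcomm := wordProd_alternatingWord_comm cs p q m (pow_orderOf_eq_one _)
      obtain ⟨r, hr⟩ := exists_eq_alternating (p := p) (q := q) hm
      obtain ⟨r', hr'⟩ := exists_eq_alternating (p := q) (q := p) hm
      have ha : (if Even m then p else q) = a := by
        have := congrArg Prod.fst hab; split_ifs at this ⊢ <;> exact this.symm
      have hb : (if Even m then q else p) = b := by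
        have := congrArg Prod.snd hab; split_ifs at this ⊢ <;> exact this.symm
      rw [ha] at hr
      rw [hb] at hr'
      have e1 : cs.wordProd (alternatingWord p q m ++ ζ) = cs.wordProd (i :: u) := by
        rw [cs.wordProd_append, ← hz]
      have e2 : cs.wordProd (alternatingWord q p m ++ ζ) = cs.wordProd (i :: u) := by
        rw [cs.wordProd_append, ← hcomm, ← hz]
      have r1 : cs.IsReduced (alternatingWord p q m ++ ζ) := by
        rw [CoxeterSystem.IsReduced, e1, hlz, hζ.eq, List.length_append, length_alternatingWord]
      have r2 : cs.IsReduced (alternatingWord q p m ++ ζ) := by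
        rw [CoxeterSystem.IsReduced, e2, hlz, hζ.eq, List.length_append, length_alternatingWord]
      have b1 := append _ _ ζ (braid p q m hm hmdef.symm)
      rw [hr, hr', List.cons_append, List.cons_append] at b1
      rw [hr, List.cons_append] at e1 r1
      rw [hr', List.cons_append] at e2 r2
      have hl2 : (r' ++ ζ).length = n := by
        have := r2.eq
        rw [e2, hu.eq, h, List.length_cons] at this
        omega
      -- The chain is a u' ~ A(p,q) ζ ~ A(q,p) ζ ~ b v', where A are the alternating words of length
      -- m. The outer links have equal first letters and follow by induction; the middle one is a
      -- braid relation.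
      refine trans _ _ _ (hE a u' (r ++ ζ) (by simpa using hl) hu' r1 (eu.trans e1.symm))
        (trans _ _ _ b1 ?_)
      exact hE b (r' ++ ζ) v' hl2 r2 hv' (e2.trans ev.symm)
    -- The alternating word in p, q ends in q, so its first letter depends on the parity of m; the
    -- roles of i and j are chosen so that the first word starts with i.
    by_cases hev : Even (orderOf (cs.simple i * cs.simple j))
    · exact main i j hi hj i u j v (by rw [if_pos hev]) h hu hv rfl e.symm
    · have hev' : ¬ Even (orderOf (cs.simple j * cs.simple i)) := by
        rw [← orderOf_inv, mul_inv_rev, cs.inv_simple, cs.inv_simple]; exact hev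
      exact main j i hj hi i u j v (by rw [if_neg hev']) h hu hv rfl e.symm

end Exchange

/-! ### Compatibility of braid morphisms with concatenation of words -/

section Concatenation

open GrBimod

variable {k : Type u} [Field k] {W : Type*} [Group W] {U : Type v} [AddCommGroup U] [Module k U]
  {ρ : Representation k W U} {B : Type*} {C : CoxeterMatrix B} (cs : CoxeterSystem C W)
  {α : B → (regFun k U).carrier} (hα : ∀ i, IsRefl (regAct ρ (cs.simple i)) (α i))
  (hk : (2 : k) ≠ 0)

/-- There is a morphism that preserves `1 ⊗ ⋯ ⊗ 1`. -/
def Connects (ρ : Representation k W U) (u v : List B) : Prop :=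
  ∃ β : hom (thetaWord cs ρ u) (thetaWord cs ρ v), β.1 (word1 cs ρ u) = word1 cs ρ v

theorem Connects.refl (u : List B) : Connects cs ρ u u :=
  ⟨⟨LinearMap.id, fun _ _ => rfl, fun _ _ => rfl⟩, rfl⟩

theorem Connects.trans {u v z : List B} (h : Connects cs ρ u v) (h' : Connects cs ρ v z) :
    Connects cs ρ u z := by
  obtain ⟨β, hβ⟩ := h
  obtain ⟨γ, hγ⟩ := h'
  exact ⟨homComp γ β, by rw [homComp_apply, hβ, hγ]⟩

include hα hk in
theorem Connects.cons (i : B) {u v : List B} (h : Connects cs ρ u v) :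
    Connects cs ρ (i :: u) (i :: v) := by
  obtain ⟨β, hβ⟩ := h
  obtain ⟨f, hf⟩ := ((isSemi_ind (φ := regAct ρ (cs.simple i)) (thetaWord cs ρ v)).comp
    (isSemi_hom β)).exists_extend (hα i) hk
  refine ⟨f, ?_⟩
  have e : f.1 (ind _ _ (word1 cs ρ u)) = ind _ _ (β.1 (word1 cs ρ u)) := by
    simpa using hf (word1 cs ρ u) 0
  rw [hβ] at e
  exact e

/-- `f ⊗ 1` for a right linear map `f`. -/
theorem exists_rTensor {A : GrAlg.{u, v} k} {M N Z : GrBimod A A}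
    (f : M.carrier →ₗ[k] N.carrier) (hf : ∀ b m, f (M.ract b m) = N.ract b (f m)) :
    ∃ F : (tensor M Z).carrier →ₗ[k] (tensor N Z).carrier,
      (∀ m z, F (tm M Z m z) = tm N Z (f m) z) ∧
      ∀ b t, F ((tensor M Z).ract b t) = (tensor N Z).ract b (F t) := by
  let F := tmLift (M := M) (N := Z) ((tm N Z) ∘ₗ f) (fun m b z => by
    simp only [LinearMap.comp_apply]; rw [hf, tm_balanced])
  have hF : ∀ m z, F (tm M Z m z) = tm N Z (f m) z := fun m z => tmLift_tm _ _ _ _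
  refine ⟨F, hF, fun b t => ?_⟩
  refine tm_induction (p := fun t => F ((tensor M Z).ract b t) = (tensor N Z).ract b (F t)) t
    (by simp) (fun m z => ?_) (fun x y hx hy => by simp only [map_add, hx, hy])
  rw [ract_tm, hF, hF, ract_tm]

theorem rTensor_lact {A : GrAlg.{u, v} k} {M N Z : GrBimod A A}
    {f : M.carrier →ₗ[k] N.carrier} {F : (tensor M Z).carrier →ₗ[k] (tensor N Z).carrier}
    (hF : ∀ m z, F (tm M Z m z) = tm N Z (f m) z) {a : A.carrier}
    (hf : ∀ m, f (M.lact a m) = N.lact a (f m)) (t : (tensor M Z).carrier) :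
    F ((tensor M Z).lact a t) = (tensor N Z).lact a (F t) := by
  refine tm_induction (p := fun t => F ((tensor M Z).lact a t) = (tensor N Z).lact a (F t)) t
    (by simp) (fun m z => ?_) (fun x y hx hy => by simp only [map_add, hx, hy])
  rw [lact_tm, hF, hF, lact_tm, hf]

include hα hk in
-- Induction on u: a morphism for the tail, followed by n ↦ 1 ⊗ n on the first factor, is linear
-- over the invariants and so extends to the induced bimodule.
theorem exists_split (u z : List B) :
    ∃ f : hom (thetaWord cs ρ (u ++ z)) (tensor (thetaWord cs ρ u) (thetaWord cs ρ z)),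
      f.1 (word1 cs ρ (u ++ z)) = tm _ _ (word1 cs ρ u) (word1 cs ρ z) := by
  induction u with
  | nil =>
    refine ⟨⟨tm (thetaWord cs ρ []) (thetaWord cs ρ z) (word1 cs ρ []), fun a m => ?_,
      fun b m => (ract_tm _ _ _ _ _).symm⟩, rfl⟩
    rw [lact_tm]
    exact (tm_balanced (thetaWord cs ρ []) (thetaWord cs ρ z) (word1 cs ρ []) a m).symm
  | cons i u ih =>
    obtain ⟨f, hf⟩ := ih
    let X := thetaWord cs ρ u
    let Z := thetaWord cs ρ z
    obtain ⟨F, hF, hFr⟩ := exists_rTensor (M := X) (N := Ind (regAct ρ (cs.simple i)) X) (Z := Z)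
      (ind (regAct ρ (cs.simple i)) X) (ind_ract X)
    have hs : IsSemi (regAct ρ (cs.simple i)) (tensor X Z)
        (tensor (Ind (regAct ρ (cs.simple i)) X) Z) F :=
      ⟨fun r hr t => rTensor_lact hF (fun m => ind_lact X hr m) t, hFr⟩
    obtain ⟨g, hg⟩ := (hs.comp (isSemi_hom f)).exists_extend (hα i) hk
    refine ⟨g, ?_⟩
    have e : g.1 (ind _ _ (word1 cs ρ (u ++ z))) = F (f.1 (word1 cs ρ (u ++ z))) := by
      simpa using hg (word1 cs ρ (u ++ z)) 0
    rw [hf, hF] at e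
    exact e

include hα hk in
theorem exists_merge (u z : List B) :
    ∃ f : hom (tensor (thetaWord cs ρ u) (thetaWord cs ρ z)) (thetaWord cs ρ (u ++ z)),
      f.1 (tm _ _ (word1 cs ρ u) (word1 cs ρ z)) = word1 cs ρ (u ++ z) := by
  suffices h : ∃ μ : (thetaWord cs ρ u).carrier →ₗ[k] (thetaWord cs ρ z).carrier →ₗ[k]
      (thetaWord cs ρ (u ++ z)).carrier,
      (∀ a m n, μ ((thetaWord cs ρ u).lact a m) n = (thetaWord cs ρ (u ++ z)).lact a (μ m n)) ∧
      (∀ m b n, μ ((thetaWord cs ρ u).ract b m) n = μ m ((thetaWord cs ρ z).lact b n)) ∧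
      (∀ b m n, μ m ((thetaWord cs ρ z).ract b n) = (thetaWord cs ρ (u ++ z)).ract b (μ m n)) ∧
      μ (word1 cs ρ u) (word1 cs ρ z) = word1 cs ρ (u ++ z) by
    obtain ⟨μ, h1, h2, h3, h4⟩ := h
    refine ⟨⟨tmLift μ h2, fun a t => ?_, fun b t => ?_⟩, ?_⟩
    · refine tm_induction (p := fun t => tmLift μ h2 ((tensor _ _).lact a t) =
        (thetaWord cs ρ (u ++ z)).lact a (tmLift μ h2 t)) t (by simp) (fun m z => ?_)
        (fun x y hx hy => by simp only [map_add, hx, hy])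
      rw [lact_tm, tmLift_tm, tmLift_tm, h1]
    · refine tm_induction (p := fun t => tmLift μ h2 ((tensor _ _).ract b t) =
        (thetaWord cs ρ (u ++ z)).ract b (tmLift μ h2 t)) t (by simp) (fun m z => ?_)
        (fun x y hx hy => by simp only [map_add, hx, hy])
      rw [ract_tm, tmLift_tm, tmLift_tm, h3]
    · exact (tmLift_tm μ h2 _ _).trans h4
  induction u with
  | nil =>
    exact ⟨(thetaWord cs ρ z).lact.toLinearMap, fun a m n => (lact_lact _ _ _ _).symm,
      fun (m : (regFun k U).carrier) b n => by
        change (thetaWord cs ρ z).lact (b * m) n =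
          (thetaWord cs ρ z).lact m ((thetaWord cs ρ z).lact b n)
        rw [lact_lact, mul_comm],
      fun b m n => (thetaWord cs ρ z).comm _ _ _, lact_one _ _⟩
  | cons i u ih =>
    obtain ⟨μ, h1, h2, h3, h4⟩ := ih
    let φ := regAct ρ (cs.simple i)
    let X := thetaWord cs ρ u
    let Z := thetaWord cs ρ z
    let Y := thetaWord cs ρ (u ++ z)
    let c := (hα i).coord hk X
    -- The pairing for i :: u applies the pairing for u to the coordinates with respect to 1 and α.
    let ν : (Ind φ X).carrier →ₗ[k] Z.carrier →ₗ[k] (Ind φ Y).carrier :=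
      (μ.compr₂ (ind φ Y)) ∘ₗ LinearMap.fst k _ _ ∘ₗ c.toLinearMap +
      (μ.compr₂ ((Ind φ Y).lact (α i) ∘ₗ ind φ Y)) ∘ₗ LinearMap.snd k _ _ ∘ₗ c.toLinearMap
    have hν : ∀ t n, ν t n = ind φ Y (μ (c t).1 n) +
        (Ind φ Y).lact (α i) (ind φ Y (μ (c t).2 n)) := fun t n => rfl
    refine ⟨ν, fun a (t : (Ind φ X).carrier) n => ?_, fun (t : (Ind φ X).carrier) b n => ?_,
      fun b (t : (Ind φ X).carrier) n => ?_, ?_⟩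
    · refine (hα i).linear_of_root (Ind φ X).lact (Ind φ Y).lact (ν.flip n) (fun r hr t => ?_)
        (fun t => ?_) hk a t
      · simp only [LinearMap.flip_apply]
        rw [hν, hν, (hα i).coord_lact_fixed hk X hr, h1, h1, ind_lact Y hr, ind_lact Y hr, map_add,
          lact_lact, lact_lact, mul_comm]
      · simp only [LinearMap.flip_apply]
        rw [hν, hν, (hα i).coord_lact_root hk X, h1, ind_lact Y (hα i).map_sq, map_add,
          lact_lact, add_comm]
    · change ν ((Ind φ X).ract b t) n = ν t (Z.lact b n)
      rw [hν, hν, (hα i).coord_ract hk X, h2, h2]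
    · change ν t (Z.ract b n) = (Ind φ Y).ract b (ν t n)
      rw [hν, hν, h3, h3, ind_ract, ind_ract, map_add, (Ind φ Y).comm]
    · change ν (ind φ X (word1 cs ρ u)) (word1 cs ρ z) = ind φ Y (word1 cs ρ (u ++ z))
      rw [hν, (hα i).coord_ind hk X, h4]; simp

include hα hk in
-- The morphism β ⊗ 1, placed between the splitting of one word and the merging of the other.
theorem Connects.append {u v : List B} (h : Connects cs ρ u v) (z : List B) :
    Connects cs ρ (u ++ z) (v ++ z) := by
  obtain ⟨β, hβ⟩ := h
  obtain ⟨f, hf⟩ := exists_split cs hα hk u z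
  obtain ⟨g, hg⟩ := exists_merge cs hα hk v z
  obtain ⟨F, hF, hFr⟩ := exists_rTensor (Z := thetaWord cs ρ z) β.1 β.2.2
  refine ⟨homComp g (homComp ⟨F, fun a => rTensor_lact hF (β.2.1 a), hFr⟩ f), ?_⟩
  rw [homComp_apply, homComp_apply, hf, ← hg, ← hβ]
  exact congrArg g.1 (hF _ _)

end Concatenation

/-! ### Degrees of functionals on alternating words -/

section DegreeBound

open GrBimod CoxeterSystem

variable {k : Type u} [Field k] {W : Type*} [Group W] {U : Type v} [AddCommGroup U] [Module k U]
  {ρ : Representation k W U} {B : Type*} {C : CoxeterMatrix B} (cs : CoxeterSystem C W)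
  {α : B → (regFun k U).carrier} (hα : ∀ i, IsRefl (regAct ρ (cs.simple i)) (α i))
  (hk : (2 : k) ≠ 0) (hρ : ∀ w, w ≠ 1 → ∃ a, regRep ρ w a ≠ a)

/-- Lower bounds for the degrees `δ` of the nonzero functionals on `N` that vanish on `E`, improved
by one for twists for which `t` is not a left descent. -/
def DegreeBound (N : GrBimod (regFun k U) (regFun k U)) (E : Set N.carrier) (P : W → Prop)
    (n : ℤ) (t : B) : Prop :=
  ∀ y, P y → ∀ (g : N.carrier →ₗ[k] (Target.self hρ).S) (δ : ℤ), IsFun (Target.self hρ) N y g →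
    (∀ j, ∀ m ∈ N.gr j, g m ∈ (regFun k U).gr (j + δ)) → g ≠ 0 → (∀ e ∈ E, g e = 0) →
    -n + cs.length y ≤ δ ∧ (¬ cs.length (cs.simple t * y) < cs.length y →
      (n = 0 ∧ y = 1) ∨ -n + cs.length y + 1 ≤ δ)

include hα hk in
-- A functional of degree δ has components of degree δ + 2 with twists y and i y. Adding a letter
-- may lower the bound by only one, so the loss must be compensated by the improvement for twists
-- that do not have t as a left descent. Nonzero functionals that occur have twists shorter than m,
-- so their twists cannot have both i and t as left descents.
theorem DegreeBound.step {N : GrBimod (regFun k U) (regFun k U)} {E : Set N.carrier}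
    {P P' : W → Prop} {n : ℤ} {i t : B} {m : ℕ}
    (hE : ∀ a, ∀ e ∈ E, N.lact a e ∈ E) (hB : DegreeBound cs hρ N E P n t)
    (hP : ∀ y, P' y → P y ∧ P (cs.simple i * y))
    (hm : ∀ y, cs.length (cs.simple i * y) < cs.length y →
      cs.length (cs.simple t * y) < cs.length y → m ≤ cs.length y)
    (hlt : ∀ y, P y → ∀ g, IsFun (Target.self hρ) N y g → g ≠ 0 → (∀ e ∈ E, g e = 0) →
      cs.length y < m) {E' : Set (Ind (regAct ρ (cs.simple i)) N).carrier}
    (hE' : ∀ e ∈ E, ind _ N e ∈ E') :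
    DegreeBound cs hρ (Ind (regAct ρ (cs.simple i)) N) E' P' (n + 1) i := by
  intro y hy g δ hg hd hg0 hgE
  have hs := cs.simple_mul_simple_self i
  have hs1 := simple_ne_one cs i
  obtain ⟨hPy, hPs⟩ := hP y hy
  have hl := cs.length_simple_mul y i
  have hgE' : ∀ e ∈ E, g (ind _ N e) = 0 := fun e he => hgE _ (hE' e he)
  have hdι : ∀ j, ∀ n ∈ N.gr j, g (ind _ N n) ∈ (regFun k U).gr (j + δ) := fun j n hn =>
    hd j _ (ind_mem N hn)
  have hd0 : ∀ j, ∀ n ∈ N.gr j, g (ind _ N (N.lact (α i) n)) ∈ (regFun k U).gr (j + (δ + 2)) :=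
    fun j n hn => by
      have := hdι _ _ (N.lact_mem (hα i).mem hn)
      rwa [show 2 + j + δ = j + (δ + 2) by ring] at this
  have hd1 : ∀ j, ∀ n ∈ N.gr j, (Target.self hρ).Q (α i) * g (ind _ N n) ∈
      (regFun k U).gr (j + (δ + 2)) := fun j n hn => by
      have := (regFun k U).mul_mem (hα i).mem (hdι _ _ hn)
      rwa [show 2 + (j + δ) = j + (δ + 2) by ring] at this
  have hne : g ∘ₗ ind _ N ≠ 0 := fun h =>
    hg0 (hg.eq_zero_of_ind (hα i) hk fun n => LinearMap.congr_fun h n)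
  -- If one component vanishes, n ↦ g(1 ⊗ n), up to applying i, is a functional on N of the same
  -- degree δ, and the bound for N without improvement is enough.
  by_cases h0 : funSame (N := N) (s := cs.simple i) g (α i) = 0
  · have := hB _ hPs _ δ (hg.of_funSame_eq_zero (hα i) hk h0) (fun j n hn =>
      (regAct ρ (cs.simple i)).map_mem _ _ (hdι j n hn)) (fun h => hne <| LinearMap.ext fun n => by
        have := congrArg ((Target.self hρ).act (cs.simple i)) (LinearMap.congr_fun h n)
        simp only [LinearMap.comp_apply, AlgHom.toLinearMap_apply, LinearMap.zero_apply,
          map_zero, (Target.self hρ).act_act hs] at this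
        exact this) (fun e he => by
        simp only [LinearMap.comp_apply, hgE' e he, map_zero])
    exact ⟨by have := this.1; omega, fun h => Or.inr (by have := this.1; omega)⟩
  by_cases h1 : funRefl (N := N) (s := cs.simple i) g (α i) = 0
  · have := hB _ hPy _ δ (hg.of_funRefl_eq_zero hs (hα i) hk h1) hdι hne hgE'
    exact ⟨by have := this.1; omega, fun h => Or.inr (by have := this.1; omega)⟩
  have k0 : ∀ e ∈ E, funSame (N := N) (s := cs.simple i) g (α i) e = 0 := fun e he => by
    rw [funSame_apply, hgE' e he, hgE' _ (hE _ e he), mul_zero, add_zero]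
  have k1 : ∀ e ∈ E, funRefl (N := N) (s := cs.simple i) g (α i) e = 0 := fun e he => by
    rw [funRefl_apply, hgE' e he, hgE' _ (hE _ e he), mul_zero, sub_zero, map_zero]
  have f0 := hg.same (hα i) hk
  have f1 := hg.refl (hα i) hk
  have b0 := hB _ hPy _ (δ + 2) f0 (fun j n hn => add_mem (hd0 j n hn) (hd1 j n hn)) h0 k0
  have b1 := hB _ hPs _ (δ + 2) f1 (fun j n hn => (regAct ρ (cs.simple i)).map_mem _ _
    (sub_mem (hd0 j n hn) (hd1 j n hn))) h1 k1
  have l0 := hlt _ hPy _ f0 h0 k0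
  have l1 := hlt _ hPs _ f1 h1 k1
  -- The longer of y and i y has i as a left descent, so it does not have t, and the improved bound
  -- for its component applies.
  rcases hl with hl | hl
  · have hs2 : cs.simple i * (cs.simple i * y) = y := by rw [← mul_assoc, hs, one_mul]
    have := b1.2 fun h => by
      have := hm (cs.simple i * y) (by rw [hs2]; omega) h
      omega
    rcases this with ⟨-, h⟩ | h
    · rw [h, cs.length_one] at hl; omega
    · exact ⟨by omega, fun _ => Or.inr (by omega)⟩
  · have := b0.2 fun h => by
      have := hm y (by omega) h
      omega
    rcases this with ⟨-, h⟩ | h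
    · rw [h, cs.length_one] at hl; omega
    · exact ⟨by omega, fun h => absurd (by omega) h⟩

theorem regFun_gr_neg {j : ℤ} (hj : j < 0) : (regFun k U).gr j = ⊥ := symGr_eq_bot hj

theorem regFun_gr_zero {x : (regFun k U).carrier} (hx : x ∈ (regFun k U).gr 0) :
    ∃ c : k, x = c • (1 : (regFun k U).carrier) := by
  refine symGr_induction (p := fun (x : (regFun k U).carrier) =>
    ∃ c : k, x = c • (1 : (regFun k U).carrier)) hx ?_
    ⟨0, (zero_smul k (1 : (regFun k U).carrier)).symm⟩ ?_
  · intro n hn a ha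
    obtain rfl : n = 0 := by omega
    rw [pow_zero, Submodule.mem_one] at ha
    obtain ⟨c, rfl⟩ := ha
    exact ⟨c, Algebra.algebraMap_eq_smul_one (A := SymmetricAlgebra k (Module.Dual k U)) c⟩
  · rintro _ _ ⟨a, rfl⟩ ⟨b, rfl⟩
    exact ⟨a + b, (add_smul _ _ _).symm⟩

theorem DegreeBound.nil (t : B) : DegreeBound cs hρ (thetaWord cs ρ []) ∅ (fun _ => True) 0 t := by
  intro y _ g δ hg hd hg0 _
  by_cases hy : y = 1
  · subst hy
    have h1 : g (word1 cs ρ []) ≠ 0 := fun h => hg0 <| LinearMap.ext fun m => by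
      have := hg.left m (word1 cs ρ [])
      rw [h, mul_zero] at this
      exact (congrArg g (mul_one (show (regFun k U).carrier from m)).symm).trans this
    have hδ : 0 ≤ δ := by
      by_contra hneg
      have := hd 0 _ (word1_mem cs [])
      rw [regFun_gr_neg (by omega)] at this
      exact h1 this
    exact ⟨by rw [cs.length_one]; simpa using hδ, fun _ => Or.inl ⟨rfl, rfl⟩⟩
  · exact absurd (hg.nil_eq_zero cs hy) hg0

/-- The alternating word, by recursion from the right. -/
def altList (p q : B) : ℕ → List B
  | 0 => []
  | n + 1 => (if Even n then q else p) :: altList p q n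

theorem altList_eq (p q : B) (n : ℕ) : altList p q n = alternatingWord p q n := by
  induction n with
  | zero => rfl
  | succ n ih => rw [altList, ih, alternatingWord_succ']

variable (p q : B) (m : ℕ)

/-- Elements of `θ_{A_{m + l}}` that are killed by the adjoints of morphisms that kill
`1 ⊗ ⋯ ⊗ 1`. -/
def markSet (ρ : Representation k W U) :
    ∀ l, Set (thetaWord cs ρ (altList p q (m + l))).carrier
  | 0 => {x | ∃ a, x = (thetaWord cs ρ (altList p q m)).lact a (word1 cs ρ (altList p q m))}
  | l + 1 => {x : (Ind (regAct ρ (cs.simple (if Even (m + l) then q else p)))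
        (thetaWord cs ρ (altList p q (m + l)))).carrier | ∃ b, ∃ e ∈ markSet ρ l,
      x = (Ind (regAct ρ (cs.simple (if Even (m + l) then q else p)))
        (thetaWord cs ρ (altList p q (m + l)))).lact b (ind _ _ e)}

theorem lact_mem_markSet (l : ℕ) (a : (regFun k U).carrier)
    {e : (thetaWord cs ρ (altList p q (m + l))).carrier} (he : e ∈ markSet cs p q m ρ l) :
    (thetaWord cs ρ (altList p q (m + l))).lact a e ∈ markSet cs p q m ρ l := by
  cases l with
  | zero =>
    obtain ⟨b, rfl⟩ := he
    exact ⟨a * b, lact_lact _ _ _ _⟩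
  | succ l =>
    obtain ⟨b, e, he, rfl⟩ := he
    exact ⟨a * b, e, he, lact_lact (Ind _ _) _ _ _⟩

variable {p q m} (hm : orderOf (cs.simple p * cs.simple q) = m)

theorem orderOf_simple_comm : orderOf (cs.simple q * cs.simple p) =
    orderOf (cs.simple p * cs.simple q) := by
  rw [← orderOf_inv, mul_inv_rev, cs.inv_simple, cs.inv_simple]

include hm in
theorem le_length_of_descents (n : ℕ) (y : W)
    (h1 : cs.length (cs.simple (if Even n then q else p) * y) < cs.length y)
    (h2 : cs.length (cs.simple (if Even n then p else q) * y) < cs.length y) :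
    m ≤ cs.length y := by
  have h := (orderOf_pos_and_le cs h1 h2).2
  rw [← hm]
  split_ifs at h
  · rwa [orderOf_simple_comm] at h
  · exact h

include hα hk hm in
-- The marked letter is the first letter of the word. A word with fewer than m letters only carries
-- twists of length less than m, so no vanishing condition is needed.
theorem DegreeBound.short (n : ℕ) (hn : n ≤ m) : DegreeBound cs hρ
    (thetaWord cs ρ (altList p q n)) ∅ (fun _ => True) n (if Even n then p else q) := by
  induction n with
  | zero => exact DegreeBound.nil cs hρ _
  | succ n ih =>
    have h := (ih (by omega)).step cs hα hk hρ (i := if Even n then q else p) (P' := fun _ => True)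
      (m := m) (E' := ∅) (fun _ _ h => h.elim) (fun _ _ => ⟨trivial, trivial⟩)
      (le_length_of_descents cs hm n) (fun y _ g hg hg0 _ => by
        have h := (hg.eq_zero_or cs hα hk).resolve_left hg0
        rw [altList_eq, length_alternatingWord] at h
        rcases h with rfl | h
        · have := cs.length_wordProd_le (alternatingWord p q n)
          rw [length_alternatingWord] at this
          omega
        · omega) (fun _ h => h.elim)
    have e : (if Even (n + 1) then p else q) = if Even n then q else p := by
      by_cases h : Even n <;> simp [Nat.even_add_one, h]
    rw [e]
    push_cast
    exact h

include hα hk hm in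
-- Beyond m letters the argument survives if the twist has length at most m - l and the functional
-- kills the marked elements; the latter excludes the longest element of the dihedral group.
theorem DegreeBound.long (l : ℕ) (hl : l ≤ m) : DegreeBound cs hρ
    (thetaWord cs ρ (altList p q (m + l))) (markSet cs p q m ρ l) (fun y => cs.length y + l ≤ m)
    (m + l) (if Even (m + l) then p else q) := by
  induction l with
  | zero =>
    intro y _ g δ hg hd hg0 _
    have := DegreeBound.short cs hα hk hρ hm m le_rfl y trivial g δ hg hd hg0 (fun _ h => h.elim)
    simpa using this
  | succ l ih =>
    have h := (ih (by omega)).step cs hα hk hρ (i := if Even (m + l) then q else p)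
      (P' := fun y => cs.length y + (l + 1) ≤ m) (m := m) (E' := markSet cs p q m ρ (l + 1))
      (fun a _ => lact_mem_markSet cs p q m l a) (fun y hy => ⟨by omega, by
        have := cs.length_simple_mul y (if Even (m + l) then q else p)
        omega⟩)
      (le_length_of_descents cs hm (m + l)) (fun y hy g hg hg0 hgE => by
        -- Only for l = 0 does the length condition allow a twist of length m; this must be the top
        -- twist, at which killing 1⊗⋯⊗1 forces the functional to vanish.
        rcases Nat.eq_zero_or_pos l with rfl | hl0
        · have h := (hg.eq_zero_or cs hα hk).resolve_left hg0
          have hred : cs.IsReduced (altList p q m) := by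
            rw [altList_eq]
            refine isReduced_alternatingWord cs p q m fun l h0 h => ?_
            rw [← hm] at h
            exact pow_ne_one_of_lt_orderOf h0.ne' h
          rcases h with rfl | h
          · exact absurd (IsFun.eq_zero_of_word1 cs hα hk _ hred hg
              (hgE _ ⟨1, (lact_one _ _).symm⟩)) hg0
          · rwa [altList_eq, length_alternatingWord] at h
        · omega) (fun e he => ⟨1, e, he, (lact_one _ _).symm⟩)
    have e : (if Even (m + (l + 1)) then p else q) = if Even (m + l) then q else p := by
      by_cases h : Even (m + l) <;> simp [← add_assoc, Nat.even_add_one, h]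
    rw [e, show (m : ℤ) + ((l + 1 : ℕ) : ℤ) = m + l + 1 by push_cast; ring]
    exact h

include hα hk in
theorem thetaWord_gr_neg (ω : List B) {j : ℤ} (hj : j < 0) {x : (thetaWord cs ρ ω).carrier}
    (hx : x ∈ (thetaWord cs ρ ω).gr j) : x = 0 := by
  induction ω generalizing j with
  | nil =>
    have hx' : x ∈ (regFun k U).gr j := hx
    rw [regFun_gr_neg hj] at hx'
    exact hx'
  | cons i ω ih =>
    have h := ((hα i).mem_gr_iff hk (thetaWord cs ρ ω) j x).1 hx
    exact ((hα i).coord hk (thetaWord cs ρ ω)).map_eq_zero_iff.1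
      (Prod.ext (ih hj h.1) (ih (by omega) h.2))

include hα hk in
theorem thetaWord_gr_zero (ω : List B) {x : (thetaWord cs ρ ω).carrier}
    (hx : x ∈ (thetaWord cs ρ ω).gr 0) : ∃ c : k, x = c • word1 cs ρ ω := by
  induction ω with
  | nil => exact regFun_gr_zero hx
  | cons i ω ih =>
    have h := ((hα i).mem_gr_iff hk (thetaWord cs ρ ω) 0 x).1 hx
    obtain ⟨c, hc⟩ := ih h.1
    have h2 := thetaWord_gr_neg cs hα hk ω (by omega) h.2
    have e := (hα i).eq_add hk (thetaWord cs ρ ω) x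
    rw [h2, hc] at e
    refine ⟨c, ?_⟩
    rw [e, map_zero, map_zero, add_zero, map_smul]; rfl

include hα hk in
/-- Repeated adjunction. -/
theorem exists_adjoint (φ : hom (thetaWord cs ρ (altList p q (m + m))) (unit (regFun k U)))
    (hφ : HasDegree φ (-(2 * m))) (t : ℕ) : ∀ l, t + l = m →
    ∃ F : hom (thetaWord cs ρ (altList p q (m + l))) (thetaWord cs ρ (altList q p t)),
      HasDegree F (-(2 * l)) ∧ ((∀ e ∈ markSet cs p q m ρ l, F.1 e = 0) →
        ∀ e ∈ markSet cs p q m ρ m, φ.1 e = 0) := by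
  induction t with
  | zero =>
    intro l hl
    obtain rfl : l = m := by omega
    exact ⟨φ, hφ, id⟩
  | succ t ih =>
    intro l hl
    obtain ⟨F, hF, hk'⟩ := ih (l + 1) (by omega)
    let i := if Even (m + l) then q else p
    -- The letter moved from the source is the next letter of the target word, because m + l = t + 1
    -- + 2l.
    have e : altList q p (t + 1) = i :: altList q p t := by
      have h : Even (m + l) ↔ ¬ Even t := by
        rw [show m + l = (t + 1) + 2 * l by omega]
        simp [Nat.even_add, Nat.even_add_one]
      simp only [altList, i, h]
      by_cases h' : Even t <;> simp [h']
    rw [e]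
    let N := thetaWord cs ρ (altList p q (m + l))
    let X := thetaWord cs ρ (altList q p t)
    let F' : hom (Ind (regAct ρ (cs.simple i)) N) X := F
    have hF' : HasDegree F' (-(2 * (l + 1 : ℕ))) := hF
    obtain ⟨G, hG⟩ := ((isSemi_hom F').comp (isSemi_ind (φ := regAct ρ (cs.simple i)) N)
      ).exists_coextend (hα i) hk
    refine ⟨G, fun j n hn => ?_, fun h => hk' ?_⟩
    · change G.1 n ∈ (Ind (regAct ρ (cs.simple i)) X).gr (j + -(2 * l))
      rw [hG]
      refine add_mem (ind_mem _ ?_) ?_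
      · have := hF' _ _ (ind_mem (φ := regAct ρ (cs.simple i)) N (N.lact_mem (hα i).mem hn))
        rwa [show 2 + j + -(2 * ((l + 1 : ℕ) : ℤ)) = j + -(2 * l) by push_cast; ring] at this
      · have := (hα i).lact_ind_mem X (hF' _ _ (ind_mem (φ := regAct ρ (cs.simple i)) N hn))
        rwa [show j + -(2 * ((l + 1 : ℕ) : ℤ)) + 2 = j + -(2 * l) by push_cast; ring] at this
    · rintro _ ⟨b, x, hx, rfl⟩
      -- The α-coordinate of G(x) is F(1 ⊗ x), so G kills x only if F kills 1 ⊗ x.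
      have h1 : (show hom N (Ind (regAct ρ (cs.simple i)) X) from G).1 x = 0 := h x hx
      rw [hG] at h1
      have h2 := congrArg ((hα i).coord hk X) h1
      rw [(hα i).coord_add hk, map_zero] at h2
      have h3 : F'.1 (ind _ N x) = 0 := congrArg Prod.snd h2
      exact (F'.2.1 b _).trans (by rw [h3, map_zero])

include hα hk hρ hm in
-- Adjunction turns φ into a degree-0 morphism F, and the degree-0 part of a word is the line
-- through 1⊗⋯⊗1. It remains to show that F does not kill this element.
theorem connects_of_hom (hm0 : 0 < m)
    (φ : hom (thetaWord cs ρ (altList p q (m + m))) (unit (regFun k U)))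
    (hφ : HasDegree φ (-(2 * m))) (h0 : φ ≠ 0) :
    Connects cs ρ (alternatingWord p q m) (alternatingWord q p m) := by
  rw [← altList_eq, ← altList_eq]
  obtain ⟨F, hF, hker⟩ := exists_adjoint cs hα hk φ hφ m 0 (by omega)
  obtain ⟨c, hc⟩ := thetaWord_gr_zero cs hα hk (altList q p m)
    (x := F.1 (word1 cs ρ (altList p q m))) (by
      have := hF _ _ (word1_mem cs (altList p q m))
      simpa using this)
  by_cases hc0 : c = 0
  · exfalso
    rw [hc0, zero_smul] at hc
    have hk' := hker (by
      rintro _ ⟨a, rfl⟩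
      exact (F.2.1 a _).trans (by rw [hc, map_zero]))
    -- If F killed 1⊗⋯⊗1, then φ would kill the marked elements. As φ has twist 1, which has no
    -- descents, the improved bound would give -2m + 1 ≤ -2m.
    have := DegreeBound.long cs hα hk hρ hm m le_rfl 1 (by simp) φ.1 (-(2 * m))
      ⟨fun a x => φ.2.1 a x, fun b x => by
        rw [map_one, AlgHom.one_apply]; exact φ.2.2 b x⟩ hφ
      (fun h => h0 (Subtype.ext h)) hk'
    have h2 := this.2 (by simp)
    rw [cs.length_one] at h2
    omega
  · refine ⟨c⁻¹ • F, ?_⟩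
    change c⁻¹ • F.1 (word1 cs ρ (altList p q m)) = _
    rw [hc, smul_smul, inv_mul_cancel₀ hc0, one_smul]

end DegreeBound

/-! ### Positivity of products of the 1 + T_s -/

section Positivity

open CoxeterSystem

variable {B W : Type*} [Group W] {C : CoxeterMatrix B} (cs : CoxeterSystem C W)

/-- Combinations of the `T_x` whose coefficients are polynomials in `q` with coefficients in `ℕ`. -/
def heckeCone (W : Type*) : AddSubmonoid (W →₀ ℤ[T;T⁻¹]) :=
  AddSubmonoid.closure {h | ∃ (a : ℕ) (x : W), h = Finsupp.single x (heckeQ ^ a)}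

theorem single_mem_heckeCone {W : Type*} (a : ℕ) (x : W) : Finsupp.single x (heckeQ ^ a) ∈ heckeCone W :=
  AddSubmonoid.subset_closure ⟨a, x, rfl⟩

theorem one_add_leftOp_up {i : B} {x : W} (h : cs.length x < cs.length (cs.simple i * x)) (a : ℕ) :
    (1 + leftOp cs i) (Finsupp.single x (heckeQ ^ a)) =
      Finsupp.single (cs.simple i * x) (heckeQ ^ a) + Finsupp.single x (heckeQ ^ a) := by
  have e : Finsupp.single x (heckeQ ^ a) = heckeQ ^ a • Finsupp.single x (1 : ℤ[T;T⁻¹]) := by simp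
  rw [e, map_smul, LinearMap.add_apply, leftOp_pos cs (by omega), Module.End.one_apply, add_comm,
    smul_add]
  simp

theorem one_add_leftOp_down {i : B} {x : W} (h : cs.length (cs.simple i * x) < cs.length x)
    (a : ℕ) : (1 + leftOp cs i) (Finsupp.single x (heckeQ ^ a)) =
      Finsupp.single (cs.simple i * x) (heckeQ ^ (a + 1)) +
        Finsupp.single x (heckeQ ^ (a + 1)) := by
  have e : Finsupp.single x (heckeQ ^ a) = heckeQ ^ a • Finsupp.single x (1 : ℤ[T;T⁻¹]) := by simp
  rw [e, map_smul, LinearMap.add_apply, leftOp_neg cs h, Module.End.one_apply, sub_smul, one_smul]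
  have : Finsupp.single x (1 : ℤ[T;T⁻¹]) + (heckeQ • Finsupp.single (cs.simple i * x) 1 +
      (heckeQ • Finsupp.single x 1 - Finsupp.single x 1)) =
      heckeQ • (Finsupp.single (cs.simple i * x) 1 + Finsupp.single x 1) := by
    rw [smul_add]; abel
  rw [this, smul_smul, ← pow_succ, smul_add]
  simp

/-- The term -1 in T_s² = q + (q - 1)T_s is absorbed by the 1 in 1 + T_s: if s x < x, then (1 +
T_s)T_x = q(T_{sx} + T_x). -/
theorem one_add_leftOp_mem (i : B) {h : W →₀ ℤ[T;T⁻¹]} (hh : h ∈ heckeCone W) :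
    (1 + leftOp cs i) h ∈ heckeCone W := by
  refine AddSubmonoid.closure_induction (motive := fun h _ => (1 + leftOp cs i) h ∈ heckeCone W)
    ?_ (by rw [map_zero]; exact zero_mem _) (fun x y _ _ hx hy => by
      rw [map_add]; exact add_mem hx hy) hh
  rintro _ ⟨a, x, rfl⟩
  rcases cs.length_simple_mul x i with h | h
  · rw [one_add_leftOp_up cs (by omega)]
    exact add_mem (single_mem_heckeCone _ _) (single_mem_heckeCone _ _)
  · rw [one_add_leftOp_down cs (by omega)]
    exact add_mem (single_mem_heckeCone _ _) (single_mem_heckeCone _ _)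

/-- The product `(1 + T_{s_1}) ⋯ (1 + T_{s_n})` in the basis `(T_x)`. -/
def heckeWord (ω : List B) : W →₀ ℤ[T;T⁻¹] :=
  (ω.map fun i => 1 + leftOp cs i).prod (Finsupp.single 1 1)

theorem heckeWord_cons (i : B) (ω : List B) :
    heckeWord cs (i :: ω) = (1 + leftOp cs i) (heckeWord cs ω) := by
  rw [heckeWord, List.map_cons, List.prod_cons]; rfl

theorem heckeTau_word (ω : List B) :
    heckeTau cs (ω.map fun i => 1 + heckeT cs i).prod = heckeWord cs ω 1 := by
  have : heckeRegular cs (ω.map fun i => 1 + heckeT cs i).prod =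
      (ω.map fun i => 1 + leftOp cs i).prod := by
    simp [map_list_prod, List.map_map, Function.comp_def, heckeRegular, heckeT]
  simp only [heckeTau, LinearMap.comp_apply, AlgHom.toLinearMap_apply, this,
    LinearMap.applyₗ_apply_apply, Finsupp.lapply_apply, heckeWord]

/-- `h` contains the term `q^a T_x`. -/
def HasTerm (h : W →₀ ℤ[T;T⁻¹]) (a : ℕ) (x : W) : Prop :=
  ∃ r ∈ heckeCone W, h = Finsupp.single x (heckeQ ^ a) + r

theorem HasTerm.up {h : W →₀ ℤ[T;T⁻¹]} {a : ℕ} {x : W} (hh : HasTerm h a x) {i : B}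
    (hl : cs.length x < cs.length (cs.simple i * x)) :
    HasTerm ((1 + leftOp cs i) h) a (cs.simple i * x) := by
  obtain ⟨r, hr, rfl⟩ := hh
  refine ⟨_, add_mem (single_mem_heckeCone a x) (one_add_leftOp_mem cs i hr), ?_⟩
  rw [map_add, one_add_leftOp_up cs hl, add_assoc]

theorem HasTerm.down {h : W →₀ ℤ[T;T⁻¹]} {a : ℕ} {x : W} (hh : HasTerm h a x) {i : B}
    (hl : cs.length (cs.simple i * x) < cs.length x) :
    HasTerm ((1 + leftOp cs i) h) (a + 1) (cs.simple i * x) := by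
  obtain ⟨r, hr, rfl⟩ := hh
  refine ⟨_, add_mem (single_mem_heckeCone (a + 1) x) (one_add_leftOp_mem cs i hr), ?_⟩
  rw [map_add, one_add_leftOp_down cs hl, add_assoc]

variable {p q : B} {m : ℕ} (hm : orderOf (cs.simple p * cs.simple q) = m)

theorem altList_reduced {p q : B} (hm : orderOf (cs.simple p * cs.simple q) = m) {n : ℕ}
    (hn : n ≤ m) : cs.IsReduced (altList p q n) := by
  rw [altList_eq]
  refine isReduced_alternatingWord cs p q n fun l h0 h => ?_
  exact pow_ne_one_of_lt_orderOf h0.ne' (by omega)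

include hm in
theorem hasTerm_short (n : ℕ) (hn : n ≤ m) :
    HasTerm (heckeWord cs (altList p q n)) 0 (cs.wordProd (altList p q n)) := by
  induction n with
  | zero => exact ⟨0, zero_mem _, by simp [altList, heckeWord]⟩
  | succ n ih =>
    have h := ih (by omega)
    rw [altList, heckeWord_cons, cs.wordProd_cons]
    refine h.up cs ?_
    have h1 := (altList_reduced cs hm hn).eq
    rw [altList, cs.wordProd_cons, List.length_cons] at h1
    rw [h1, (altList_reduced cs hm (by omega : n ≤ m)).eq]
    omega

include hm in
-- The first m factors produce T_w for the longest element w of the dihedral group. Each further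
-- factor is a left descent of the current element and contributes a factor q, so 2m factors yield
-- the term q^m T_1.
theorem hasTerm_long (l : ℕ) : ∀ t, t + l = m →
    HasTerm (heckeWord cs (altList p q (m + l))) l (cs.wordProd (altList q p t)) := by
  induction l with
  | zero =>
    intro t ht
    obtain rfl : t = m := by omega
    have h := hasTerm_short cs hm t le_rfl
    rw [altList_eq p q, wordProd_alternatingWord_comm cs p q t (hm ▸ pow_orderOf_eq_one _)] at h
    rw [altList_eq, altList_eq]
    exact h
  | succ l ih =>
    intro t ht
    have h := ih (t + 1) (by omega)
    have hm' : orderOf (cs.simple q * cs.simple p) = m := by rw [orderOf_simple_comm, hm]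
    have e : altList q p (t + 1) = (if Even (m + l) then q else p) :: altList q p t := by
      have h : Even (m + l) ↔ ¬ Even t := by
        rw [show m + l = (t + 1) + 2 * l by omega]
        simp [Nat.even_add, Nat.even_add_one]
      simp only [altList, h]
      by_cases h' : Even t <;> simp [h']
    have h1 := (altList_reduced cs hm' (by omega : t + 1 ≤ m)).eq
    have h2 := (altList_reduced cs hm' (by omega : t ≤ m)).eq
    rw [e, cs.wordProd_cons] at h h1
    have h3 := h.down cs (i := if Even (m + l) then q else p) (by
      rw [h1, ← mul_assoc, cs.simple_mul_simple_self, one_mul, h2, List.length_cons]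
      omega)
    rw [← mul_assoc, cs.simple_mul_simple_self, one_mul] at h3
    rw [← add_assoc, altList, heckeWord_cons]
    exact h3

theorem coeff_heckeQ_pow (a : ℕ) (j : ℤ) :
    (heckeQ ^ a).coeff j = if -2 * (a : ℤ) = j then 1 else 0 := by
  rw [heckeQ, LaurentPolynomial.T_pow, mul_comm]
  exact Finsupp.single_apply

theorem coeff_nonneg {W : Type*} {h : W →₀ ℤ[T;T⁻¹]} (hh : h ∈ heckeCone W) (x : W) (j : ℤ) :
    0 ≤ (h x).coeff j := by
  classical
  refine AddSubmonoid.closure_induction (motive := fun (h : W →₀ ℤ[T;T⁻¹]) _ => 0 ≤ (h x).coeff j)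
    ?_ (by simp) (fun a b _ _ ha hb => by
      rw [Finsupp.add_apply]; exact add_nonneg ha hb) hh
  rintro _ ⟨a, y, rfl⟩
  rw [Finsupp.single_apply]
  split_ifs
  · rw [coeff_heckeQ_pow]
    split_ifs <;> simp
  · simp

end Positivity

/-! ### Braid morphisms from the Hom formula -/

section Dihedral

open GrBimod CoxeterSystem

variable {k : Type u} [Field k] {W : Type*} [Group W] {U : Type v} [AddCommGroup U] [Module k U]
  {ρ : Representation k W U} {B : Type*} {C : CoxeterMatrix B} (cs : CoxeterSystem C W)
  {α : B → (regFun k U).carrier} (hα : ∀ i, IsRefl (regAct ρ (cs.simple i)) (α i))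
  (hk : (2 : k) ≠ 0) (hρ : ∀ w, w ≠ 1 → ∃ a, regRep ρ w a ≠ a)

theorem exists_hom_of_homFormula (hF : HomFormula cs ρ) {p q : B} {m : ℕ}
    (hm : orderOf (cs.simple p * cs.simple q) = m) :
    ∃ φ : hom (thetaWord cs ρ (altList p q (m + m))) (unit (regFun k U)),
      HasDegree φ (-(2 * m)) ∧ φ ≠ 0 := by
  classical
  obtain ⟨n, hn, e, -, he⟩ := hF (altList p q (m + m))
  have hpos : 0 < n m := by
    rw [heckeTau_word] at hn
    -- The coefficient of q^m in τ is 1 plus a nonnegative integer. As q = v⁻², it is the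
    -- coefficient of v^(-2m).
    obtain ⟨r, hr, h⟩ := hasTerm_long cs hm m 0 (by omega)
    have h1 : (heckeWord cs (altList p q (m + m)) 1).coeff (-2 * (m : ℤ)) =
        1 + (r 1).coeff (-2 * (m : ℤ)) := by
      rw [h]
      simp only [altList, cs.wordProd_nil, Finsupp.add_apply, Finsupp.single_eq_same,
        AddMonoidAlgebra.coeff_add]
      rw [coeff_heckeQ_pow, if_pos rfl]
    have h2 : (heckeWord cs (altList p q (m + m)) 1).coeff (-2 * (m : ℤ)) = n m := by
      have hc : ∀ (c : ℕ) (i j : ℤ), (c • LaurentPolynomial.T i : ℤ[T;T⁻¹]).coeff j =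
          c • (if i = j then 1 else 0 : ℤ) := fun c i j => by
        rw [← LaurentPolynomial.T_apply (R := ℤ), ← Finsupp.smul_apply]
        exact DFunLike.congr_fun
          (map_nsmul (AddMonoidAlgebra.coeffAddEquiv (R := ℤ) (M := ℤ)) c _) j
      rw [hn, Finsupp.sum, AddMonoidAlgebra.coeff_sum, Finsupp.finsetSum_apply,
        Finset.sum_eq_single (m : ℤ)]
      · rw [hc, if_pos rfl]; simp
      · intro i _ hi
        rw [hc, if_neg (by omega), smul_zero]
      · intro hi
        rw [Finsupp.notMem_support_iff.1 hi, zero_smul]; rfl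
    have := coeff_nonneg hr 1 (-2 * (m : ℤ))
    omega
  -- The generator of a summand R(2m) sits in degree -2m.
  refine ⟨e.symm (Finsupp.single ⟨m, ⟨0, hpos⟩⟩ 1), (he _ _).2 fun j => ?_, fun h => ?_⟩
  · rw [LinearEquiv.apply_symm_apply, Finsupp.single_apply]
    split_ifs with hj
    · subst hj
      have := (regFun k U).one_mem
      rwa [show (0 : ℤ) = -(2 * m) + 2 * m by ring] at this
    · exact zero_mem _
  · rw [LinearEquiv.symm_apply_eq, map_zero, Finsupp.single_eq_zero] at h
    exact one_ne_zero h

include hα hk hρ in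
theorem hasBraidMorphisms (hF : HomFormula cs ρ) : HasBraidMorphisms cs ρ :=
  matsumoto cs (E := Connects cs ρ) (Connects.refl cs) (fun _ _ _ => Connects.trans cs)
    (fun i _ _ => Connects.cons cs hα hk i) (fun _ _ z h => Connects.append cs hα hk h z)
    (fun _ _ m h0 hm => by
      obtain ⟨φ, h1, h2⟩ := exists_hom_of_homFormula cs hF hm
      exact connects_of_hom cs hα hk hρ hm h0 φ h1 h2)

end Dihedral

/-! ### Reduction of bimodules -/

section Reduction

open GrBimod

variable {k : Type u} [Field k] {A A' : GrAlg.{u, v} k}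

/-- `M'` is the quotient of `M` by `I M + M I`, for `I` the kernel of `Q`. -/
structure IsRed (Q : GrAlg.Hom A A') (M : GrBimod A A) (M' : GrBimod A' A')
    (π : M.carrier →ₗ[k] M'.carrier) : Prop where
  surj : Function.Surjective π
  left : ∀ a m, π (M.lact a m) = M'.lact (Q.toAlgHom a) (π m)
  right : ∀ a m, π (M.ract a m) = M'.ract (Q.toAlgHom a) (π m)
  mem : ∀ i, ∀ m ∈ M.gr i, π m ∈ M'.gr i
  ker : ∀ m, π m = 0 → m ∈ kerSpan Q.toAlgHom M

variable {Q : GrAlg.Hom A A'} {M N : GrBimod A A} {M' N' : GrBimod A' A'}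
  {π : M.carrier →ₗ[k] M'.carrier} {π₂ : N.carrier →ₗ[k] N'.carrier}

theorem IsRed.eq_zero (hπ : IsRed Q M M' π) {m : M.carrier} (hm : m ∈ kerSpan Q.toAlgHom M) :
    π m = 0 :=
  kerSpan_le (p := LinearMap.ker π) (fun a m ha => by
    rw [LinearMap.mem_ker, LinearMap.mem_ker, hπ.left, hπ.right, ha]; simp) hm

theorem IsRed.grProj (hπ : IsRed Q M M' π) (i : ℤ) (m : M.carrier) :
    Soergel.grProj M'.internal i (π m) = π (Soergel.grProj M.internal i m) := by
  have := grProj_comm M.internal M'.internal π 0 (fun i m hm => by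
    rw [add_zero]; exact hπ.mem i m hm) i m
  rwa [add_zero] at this

theorem IsRed.exists_mem (hπ : IsRed Q M M' π) {i : ℤ} {m' : M'.carrier} (hm' : m' ∈ M'.gr i) :
    ∃ m ∈ M.gr i, π m = m' := by
  obtain ⟨m, rfl⟩ := hπ.surj m'
  exact ⟨_, grProj_mem M.internal i m, by rw [← hπ.grProj, grProj_of_mem _ hm']⟩

/-- Semilinear maps factor through the reduction. -/
theorem IsRed.exists_factor (hQ : Function.Surjective Q.toAlgHom) (hπ : IsRed Q M M' π)
    (g : M.carrier →ₗ[k] N'.carrier) (hl : ∀ a m, g (M.lact a m) = N'.lact (Q.toAlgHom a) (g m))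
    (hr : ∀ a m, g (M.ract a m) = N'.ract (Q.toAlgHom a) (g m)) :
    ∃ h : hom M' N', ∀ m, h.1 (π m) = g m := by
  have hker : LinearMap.ker π ≤ LinearMap.ker g := fun m hm =>
    kerSpan_le (p := LinearMap.ker g) (fun a m ha => by
      rw [LinearMap.mem_ker, LinearMap.mem_ker, hl, hr, ha]; simp) (hπ.ker m hm)
  let h : M'.carrier →ₗ[k] N'.carrier :=
    (LinearMap.ker π).liftQ g hker ∘ₗ (π.quotKerEquivOfSurjective hπ.surj).symm.toLinearMap
  have hh : ∀ m, h (π m) = g m := fun m => by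
    have : (π.quotKerEquivOfSurjective hπ.surj).symm (π m) = (LinearMap.ker π).mkQ m := by
      rw [LinearEquiv.symm_apply_eq]; rfl
    simp only [h, LinearMap.comp_apply, LinearEquiv.coe_coe, this]
    rfl
  refine ⟨⟨h, fun a' m' => ?_, fun a' m' => ?_⟩, hh⟩
  · obtain ⟨a, rfl⟩ := hQ a'
    obtain ⟨m, rfl⟩ := hπ.surj m'
    rw [← hπ.left, hh, hh, hl]
  · obtain ⟨a, rfl⟩ := hQ a'
    obtain ⟨m, rfl⟩ := hπ.surj m'
    rw [← hπ.right, hh, hh, hr]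

/-- Each of the two reductions factors through the other. So 𝔛(M) may be computed by any quotient of
M with the right kernel, without handling tensor products. -/
theorem IsRed.unique (hQ : Function.Surjective Q.toAlgHom) (hπ : IsRed Q M M' π)
    {π' : M.carrier →ₗ[k] N'.carrier} (hπ' : IsRed Q M N' π') : Iso M' N' := by
  obtain ⟨f, hf⟩ := hπ.exists_factor hQ π' hπ'.left hπ'.right
  obtain ⟨g, hg⟩ := hπ'.exists_factor hQ π hπ.left hπ.right
  refine ⟨LinearEquiv.ofLinearMap f.1 g.1 (LinearMap.ext fun x => ?_) (LinearMap.ext fun x => ?_),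
    f.2.1, f.2.2, fun i m' hm' => ?_⟩
  · obtain ⟨m, rfl⟩ := hπ'.surj x
    rw [LinearMap.comp_apply, hg, hf]; rfl
  · obtain ⟨m, rfl⟩ := hπ.surj x
    rw [LinearMap.comp_apply, hf, hg]; rfl
  · obtain ⟨m, hm, rfl⟩ := hπ.exists_mem hm'
    change f.1 _ ∈ _
    rw [hf]
    exact hπ'.mem i m hm

theorem map_mem_kerSpan (f : M.carrier →ₗ[k] N.carrier)
    (hl : ∀ a m, f (M.lact a m) = N.lact a (f m)) (hr : ∀ a m, f (M.ract a m) = N.ract a (f m))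
    {m : M.carrier} (hm : m ∈ kerSpan Q.toAlgHom M) : f m ∈ kerSpan Q.toAlgHom N :=
  kerSpan_le (p := (kerSpan Q.toAlgHom N).comap f) (fun a m ha => by
    rw [Submodule.mem_comap, Submodule.mem_comap, hl, hr]
    exact ⟨lact_mem_kerSpan ha _, ract_mem_kerSpan ha _⟩) hm

theorem IsRed.prod (hπ : IsRed Q M M' π) (hπ₂ : IsRed Q N N' π₂) :
    IsRed Q (directSum M N) (directSum M' N') (π.prodMap π₂) where
  surj := hπ.surj.prodMap hπ₂.surj
  left a m := Prod.ext (hπ.left a m.1) (hπ₂.left a m.2)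
  right a m := Prod.ext (hπ.right a m.1) (hπ₂.right a m.2)
  mem i m hm := ⟨hπ.mem i _ hm.1, hπ₂.mem i _ hm.2⟩
  ker m hm := by
    have h1 := map_mem_kerSpan (N := directSum M N) (LinearMap.inl k M.carrier N.carrier)
      (fun a m => Prod.ext rfl (map_zero (N.lact a)).symm)
      (fun a m => Prod.ext rfl (map_zero (N.ract a)).symm)
      (hπ.ker m.1 (congrArg Prod.fst hm))
    have h2 := map_mem_kerSpan (N := directSum M N) (LinearMap.inr k M.carrier N.carrier)
      (fun a m => Prod.ext (map_zero (M.lact a)).symm rfl)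
      (fun a m => Prod.ext (map_zero (M.ract a)).symm rfl)
      (hπ₂.ker m.2 (congrArg Prod.snd hm))
    have e : m = LinearMap.inl k M.carrier N.carrier m.1 +
      LinearMap.inr k M.carrier N.carrier m.2 := Prod.ext (add_zero _).symm (zero_add _).symm
    rw [e]
    exact add_mem h1 h2

theorem IsRed.shift (hπ : IsRed Q M M' π) (d : ℤ) :
    IsRed Q (GrBimod.shift M d) (GrBimod.shift M' d) π :=
  ⟨hπ.surj, hπ.left, hπ.right, fun i => hπ.mem (i + d), hπ.ker⟩

/-- Direct sums of maps. -/
def sumMap {ι : Type*} {F : ι → GrBimod A A} {F' : ι → GrBimod A' A'}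
    (π : ∀ p, (F p).carrier →ₗ[k] (F' p).carrier) :
    ∀ l : List ι, (GrBimod.sum (l.map F)).carrier →ₗ[k] (GrBimod.sum (l.map F')).carrier
  | [] => (0 : (GrBimod.zero A A).carrier →ₗ[k] (GrBimod.zero A' A').carrier)
  | p :: l => (π p).prodMap (sumMap π l)

theorem IsRed.sum {ι : Type*} {F : ι → GrBimod A A} {F' : ι → GrBimod A' A'}
    {π : ∀ p, (F p).carrier →ₗ[k] (F' p).carrier} (hπ : ∀ p, IsRed Q (F p) (F' p) (π p))
    (l : List ι) :
    IsRed Q (GrBimod.sum (l.map F)) (GrBimod.sum (l.map F')) (sumMap π l) := by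
  induction l with
  | nil => exact ⟨fun _ => ⟨PUnit.unit, rfl⟩, fun _ _ => rfl, fun _ _ => rfl, fun _ _ _ => rfl,
      fun _ _ => zero_mem (kerSpan Q.toAlgHom (GrBimod.zero A A))⟩
  | cons p l ih => exact (hπ p).prod ih

theorem IsRed.comp_iso (hπ₂ : IsRed Q N N' π₂) (e : M.carrier ≃ₗ[k] N.carrier)
    (hl : ∀ a m, e (M.lact a m) = N.lact a (e m)) (hr : ∀ b m, e (M.ract b m) = N.ract b (e m))
    (hg : ∀ (i : ℤ) (m : M.carrier), m ∈ M.gr i → e m ∈ N.gr i) :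
    IsRed Q M N' (π₂ ∘ₗ e.toLinearMap) where
  surj := hπ₂.surj.comp e.surjective
  left a m := by
    simp only [LinearMap.comp_apply, LinearEquiv.coe_coe]; rw [hl, hπ₂.left]
  right a m := by
    simp only [LinearMap.comp_apply, LinearEquiv.coe_coe]; rw [hr, hπ₂.right]
  mem i m hm := hπ₂.mem i _ (hg i m hm)
  ker m hm := by
    have h := map_mem_kerSpan (N := M) (M := N) e.symm.toLinearMap
      (fun a m => by simp [LinearEquiv.symm_apply_eq, hl])
      (fun a m => by simp [LinearEquiv.symm_apply_eq, hr]) (hπ₂.ker _ hm)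
    simpa using h

/-- The reduction of `A ⊗_{A^φ} N`. -/
def redInd {φ : GrAlg.Hom A A} {φ' : GrAlg.Hom A' A'} {α : A.carrier} {α' : A'.carrier}
    (h : IsRefl φ α) (h' : IsRefl φ' α') (hk : (2 : k) ≠ 0) (π₂ : N.carrier →ₗ[k] N'.carrier) :
    (Ind φ N).carrier →ₗ[k] (Ind φ' N').carrier :=
  (h'.coord hk N').symm.toLinearMap ∘ₗ π₂.prodMap π₂ ∘ₗ (h.coord hk N).toLinearMap

section Ind

variable {φ : GrAlg.Hom A A} {φ' : GrAlg.Hom A' A'} {α : A.carrier}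
  (h : IsRefl φ α) (h' : IsRefl φ' (Q.toAlgHom α)) (hk : (2 : k) ≠ 0)
  (hφ : ∀ a, Q.toAlgHom (φ.toAlgHom a) = φ'.toAlgHom (Q.toAlgHom a))

theorem coord_redInd (t : (Ind φ N).carrier) : h'.coord hk N' (redInd h h' hk π₂ t) =
    (π₂ (h.coord hk N t).1, π₂ (h.coord hk N t).2) := by
  rw [redInd, LinearMap.comp_apply, LinearEquiv.coe_coe, LinearEquiv.apply_symm_apply]; rfl

theorem redInd_ind (n : N.carrier) : redInd h h' hk π₂ (ind φ N n) = ind φ' N' (π₂ n) :=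
  (h'.coord hk N').injective (by
    rw [coord_redInd, h.coord_ind, h'.coord_ind, map_zero])

include hφ in
theorem redInd_lact (hπ₂ : IsRed Q N N' π₂) (a : A.carrier) (t : (Ind φ N).carrier) :
    redInd h h' hk π₂ ((Ind φ N).lact a t) =
      (Ind φ' N').lact (Q.toAlgHom a) (redInd h h' hk π₂ t) := by
  refine h.linear_of_root (Ind φ N).lact ((Ind φ' N').lact.comp Q.toAlgHom) _ (fun r hr t => ?_)
    (fun t => ?_) hk a t
  · refine (h'.coord hk N').injective ?_
    have hr' : φ'.toAlgHom (Q.toAlgHom r) = Q.toAlgHom r := by rw [← hφ, hr]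
    rw [AlgHom.comp_apply, coord_redInd, h.coord_lact_fixed hk N hr, h'.coord_lact_fixed hk N' hr',
      coord_redInd, hπ₂.left, hπ₂.left]
  · refine (h'.coord hk N').injective ?_
    rw [AlgHom.comp_apply, coord_redInd, h.coord_lact_root, h'.coord_lact_root, coord_redInd,
      hπ₂.left, map_mul]

include h h' hk hφ in
-- If a = p + α d lies in the kernel of Q, then Q(p) + Q(α)Q(d) = 0, so both p and d lie in the
-- kernel by uniqueness of the decomposition downstairs. Being invariant, they move to the left of 1
-- ⊗ n.
theorem ind_mem_kerSpan {n : N.carrier} (hn : n ∈ kerSpan Q.toAlgHom N) :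
    ind φ N n ∈ kerSpan Q.toAlgHom (Ind φ N) := by
  obtain ⟨p, d, hp, hd, hpd⟩ := h.exists_decomp hk
  refine kerSpan_le (p := (kerSpan Q.toAlgHom (Ind φ N)).comap (ind φ N))
    (fun a n ha => ⟨?_, ?_⟩) hn
  · have e : Q.toAlgHom (p a) + Q.toAlgHom α * Q.toAlgHom (d a) = 0 + Q.toAlgHom α * 0 := by
      rw [← map_mul, ← map_add, ← hpd, ha, mul_zero, add_zero]
    obtain ⟨e1, e2⟩ := h'.decomp_unique hk (by rw [← hφ, hp]) (by rw [← hφ, hd]) (map_zero _)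
      (map_zero _) e
    rw [Submodule.mem_comap, hpd a, lact_add, map_add, ind_lact N (hp a), mul_comm, ← lact_lact,
      ind_lact N (hd a)]
    exact add_mem (lact_mem_kerSpan e1 _) (lact_mem_kerSpan e2 _)
  · rw [Submodule.mem_comap, ind_ract]
    exact ract_mem_kerSpan ha _

include hφ in
theorem IsRed.ind (hπ₂ : IsRed Q N N' π₂) :
    IsRed Q (Ind φ N) (Ind φ' N') (redInd h h' hk π₂) where
  surj := (h'.coord hk N').symm.surjective.comp
    ((hπ₂.surj.prodMap hπ₂.surj).comp (h.coord hk N).surjective)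
  left := redInd_lact h h' hk hφ hπ₂
  right a t := (h'.coord hk N').injective (by
    rw [coord_redInd, h.coord_ract, h'.coord_ract, coord_redInd, hπ₂.right, hπ₂.right])
  mem i t ht := by
    obtain ⟨h0, h1⟩ := (h.mem_gr_iff hk N i t).1 ht
    rw [h'.mem_gr_iff hk, coord_redInd]
    exact ⟨hπ₂.mem _ _ h0, hπ₂.mem _ _ h1⟩
  ker t ht := by
    have e := coord_redInd (π₂ := π₂) h h' hk t
    rw [ht, map_zero] at e
    have h0 := hπ₂.ker _ (congrArg Prod.fst e).symm
    have h1 := hπ₂.ker _ (congrArg Prod.snd e).symm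
    rw [h.eq_add hk N t]
    refine add_mem (ind_mem_kerSpan h h' hk hφ h0) ?_
    refine kerSpan_le (p := (kerSpan Q.toAlgHom (Ind φ N)).comap ((Ind φ N).lact α))
      (fun a n ha => ⟨?_, ?_⟩) (ind_mem_kerSpan h h' hk hφ h1)
    · rw [Submodule.mem_comap, lact_lact, mul_comm, ← lact_lact]
      exact lact_mem_kerSpan ha _
    · rw [Submodule.mem_comap, (Ind φ N).comm]
      exact ract_mem_kerSpan ha _

end Ind

/-- The class of `a ⊗ m` in `A' ⊗_A M`. -/
def ltm (Q : GrAlg.Hom A A') (M : GrBimod A A) :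
    A'.carrier →ₗ[k] M.carrier →ₗ[k] (tensor (ofAlg (GrAlg.Hom.id A') Q) M).carrier :=
  tm (ofAlg (GrAlg.Hom.id A') Q) M

theorem lact_ltm (a b : A'.carrier) (m : M.carrier) :
    (tensor (ofAlg (GrAlg.Hom.id A') Q) M).lact a (ltm Q M b m) = ltm Q M (a * b) m :=
  lact_tm (ofAlg (GrAlg.Hom.id A') Q) M a b m

theorem ract_ltm (a : A.carrier) (b : A'.carrier) (m : M.carrier) :
    (tensor (ofAlg (GrAlg.Hom.id A') Q) M).ract a (ltm Q M b m) = ltm Q M b (M.ract a m) :=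
  ract_tm (ofAlg (GrAlg.Hom.id A') Q) M a b m

theorem ltm_balanced (a : A.carrier) (b : A'.carrier) (m : M.carrier) :
    ltm Q M (Q.toAlgHom a * b) m = ltm Q M b (M.lact a m) :=
  tm_balanced (ofAlg (GrAlg.Hom.id A') Q) M b a m

/-- The class of `t ⊗ b` in `X ⊗_A A'`. -/
def rtm (Q : GrAlg.Hom A A') (X : GrBimod A' A) :
    X.carrier →ₗ[k] A'.carrier →ₗ[k] (tensor X (ofAlg Q (GrAlg.Hom.id A'))).carrier :=
  tm X (ofAlg Q (GrAlg.Hom.id A'))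

theorem lact_rtm {X : GrBimod A' A} (a : A'.carrier) (t : X.carrier) (b : A'.carrier) :
    (tensor X (ofAlg Q (GrAlg.Hom.id A'))).lact a (rtm Q X t b) = rtm Q X (X.lact a t) b :=
  lact_tm X (ofAlg Q (GrAlg.Hom.id A')) a t b

theorem ract_rtm {X : GrBimod A' A} (a : A'.carrier) (t : X.carrier) (b : A'.carrier) :
    (tensor X (ofAlg Q (GrAlg.Hom.id A'))).ract a (rtm Q X t b) = rtm Q X t (a * b) :=
  ract_tm X (ofAlg Q (GrAlg.Hom.id A')) a t b

theorem rtm_balanced {X : GrBimod A' A} (a : A.carrier) (t : X.carrier) (b : A'.carrier) :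
    rtm Q X (X.ract a t) b = rtm Q X t (Q.toAlgHom a * b) :=
  tm_balanced X (ofAlg Q (GrAlg.Hom.id A')) t a b

/-- The bimodule `A' ⊗_A M ⊗_A A'`. -/
abbrev Reduced (Q : GrAlg.Hom A A') (M : GrBimod A A) : GrBimod A' A' :=
  tensor (tensor (ofAlg (GrAlg.Hom.id A') Q) M) (ofAlg Q (GrAlg.Hom.id A'))

/-- The canonical map `M → A' ⊗_A M ⊗_A A'`. -/
def toReduced (Q : GrAlg.Hom A A') (M : GrBimod A A) : M.carrier →ₗ[k] (Reduced Q M).carrier :=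
  (rtm Q (tensor (ofAlg (GrAlg.Hom.id A') Q) M)).flip 1 ∘ₗ ltm Q M 1

theorem toReduced_apply (m : M.carrier) :
    toReduced Q M m = rtm Q (tensor (ofAlg (GrAlg.Hom.id A') Q) M) (ltm Q M 1 m) 1 := rfl

theorem rtm_ltm (a b : A.carrier) (m : M.carrier) :
    rtm Q (tensor (ofAlg (GrAlg.Hom.id A') Q) M) (ltm Q M (Q.toAlgHom a) m) (Q.toAlgHom b) =
      toReduced Q M (M.ract b (M.lact a m)) := by
  rw [toReduced_apply, ← ract_ltm, rtm_balanced, ← ltm_balanced, mul_one, mul_one]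

theorem lact_mk_eq {a b : A.carrier} (h : Q.toAlgHom a = Q.toAlgHom b) (m : M.carrier) :
    (kerSpan Q.toAlgHom M).mkQ (M.lact a m) = (kerSpan Q.toAlgHom M).mkQ (M.lact b m) := by
  rw [← sub_eq_zero, ← map_sub, ← lact_sub, Submodule.mkQ_apply, Submodule.Quotient.mk_eq_zero]
  exact lact_mem_kerSpan (by rw [map_sub, h, sub_self]) m

theorem ract_mk_eq {a b : A.carrier} (h : Q.toAlgHom a = Q.toAlgHom b) (m : M.carrier) :
    (kerSpan Q.toAlgHom M).mkQ (M.ract a m) = (kerSpan Q.toAlgHom M).mkQ (M.ract b m) := by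
  rw [← sub_eq_zero, ← map_sub, ← LinearMap.sub_apply, ← map_sub, Submodule.mkQ_apply,
    Submodule.Quotient.mk_eq_zero]
  exact ract_mem_kerSpan (by rw [map_sub, h, sub_self]) m

/-- This shows that the kernel of M → A' ⊗_A M ⊗_A A' is no larger than I M + M I. -/
theorem exists_retraction (hQ : Function.Surjective Q.toAlgHom) (M : GrBimod A A) :
    ∃ F : (Reduced Q M).carrier →ₗ[k] M.carrier ⧸ kerSpan Q.toAlgHom M,
      ∀ m, F (toReduced Q M m) = (kerSpan Q.toAlgHom M).mkQ m := by
  let K := kerSpan Q.toAlgHom M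
  -- A k-linear section of Q lets A' act on M up to I M + M I; it need not be multiplicative, as the
  -- errors lie in that sub-bimodule.
  obtain ⟨τ, hτ⟩ := Q.toAlgHom.toLinearMap.exists_rightInverse_of_surjective
    (LinearMap.range_eq_top.2 hQ)
  have hτ' : ∀ a, Q.toAlgHom (τ a) = a := fun a => LinearMap.congr_fun hτ a
  let g : A'.carrier →ₗ[k] M.carrier →ₗ[k] M.carrier ⧸ K :=
    (M.lact.toLinearMap ∘ₗ τ).compr₂ K.mkQ
  have hg : ∀ a m, g a m = K.mkQ (M.lact (τ a) m) := fun a m => rfl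
  let G : (tensor (ofAlg (GrAlg.Hom.id A') Q) M).carrier →ₗ[k] M.carrier ⧸ K :=
    tmLift (M := ofAlg (GrAlg.Hom.id A') Q) (N := M) g fun (b : A'.carrier) a m => by
      change g (Q.toAlgHom a * b) m = g b (M.lact a m)
      rw [hg, hg, lact_lact]
      exact lact_mk_eq (by rw [hτ', map_mul, hτ', mul_comm]) m
  have hG : ∀ a m, G (ltm Q M a m) = K.mkQ (M.lact (τ a) m) := fun a m =>
    tmLift_tm (M := ofAlg (GrAlg.Hom.id A') Q) (N := M) g _ a m
  let rb : A.carrier → (M.carrier ⧸ K →ₗ[k] M.carrier ⧸ K) := fun a =>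
    K.mapQ K (M.ract a) (kerSpan_le fun c m hc => ⟨by
      rw [Submodule.mem_comap, ← M.comm]; exact lact_mem_kerSpan hc _, by
      rw [Submodule.mem_comap, ract_ract, mul_comm, ← ract_ract]; exact ract_mem_kerSpan hc _⟩)
  have hrb : ∀ a m, rb a (K.mkQ m) = K.mkQ (M.ract a m) := fun a m => rfl
  have hGr : ∀ a t, G ((tensor (ofAlg (GrAlg.Hom.id A') Q) M).ract a t) = rb a (G t) := by
    intro a t
    refine tm_induction (p := fun t => G ((tensor (ofAlg (GrAlg.Hom.id A') Q) M).ract a t) =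
      rb a (G t)) t (by simp) (fun (b : A'.carrier) m => ?_)
      (fun x y hx hy => by simp only [map_add, hx, hy])
    change G ((tensor (ofAlg (GrAlg.Hom.id A') Q) M).ract a (ltm Q M b m)) =
      rb a (G (ltm Q M b m))
    rw [ract_ltm, hG, hG, hrb, M.comm]
  let f : (tensor (ofAlg (GrAlg.Hom.id A') Q) M).carrier →ₗ[k] A'.carrier →ₗ[k]
      M.carrier ⧸ K := LinearMap.mk₂ k (fun t b => rb (τ b) (G t))
    (fun s t b => by rw [map_add, map_add]) (fun c t b => by rw [map_smul, map_smul])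
    (fun t b b' => by
      obtain ⟨m, hm⟩ := K.mkQ_surjective (G t)
      rw [← hm, hrb, hrb, hrb, map_add, map_add, LinearMap.add_apply, map_add])
    (fun c t b => by
      obtain ⟨m, hm⟩ := K.mkQ_surjective (G t)
      rw [← hm, hrb, hrb, map_smul, map_smul, LinearMap.smul_apply, map_smul])
  refine ⟨tmLift (M := tensor (ofAlg (GrAlg.Hom.id A') Q) M) (N := ofAlg Q (GrAlg.Hom.id A')) f
    (fun t a (b : A'.carrier) => ?_), fun m => ?_⟩
  · change rb (τ b) (G ((tensor (ofAlg (GrAlg.Hom.id A') Q) M).ract a t)) =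
      rb (τ (Q.toAlgHom a * b)) (G t)
    obtain ⟨m, hm⟩ := K.mkQ_surjective (G t)
    rw [hGr, ← hm, hrb, hrb, hrb, ract_ract]
    exact ract_mk_eq (by rw [hτ', map_mul, hτ', mul_comm]) m
  · refine (tmLift_tm (M := tensor (ofAlg (GrAlg.Hom.id A') Q) M)
      (N := ofAlg Q (GrAlg.Hom.id A')) f _ (ltm Q M 1 m) (1 : A'.carrier)).trans ?_
    change rb (τ 1) (G (ltm Q M 1 m)) = K.mkQ m
    rw [hG, hrb, ract_mk_eq (b := 1) (by rw [hτ', map_one]), ract_one,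
      lact_mk_eq (b := 1) (by rw [hτ', map_one]), lact_one]

theorem isRed_toReduced (hQ : Function.Surjective Q.toAlgHom) (M : GrBimod A A) :
    IsRed Q M (Reduced Q M) (toReduced Q M) := by
  refine ⟨fun x => ?_, fun a m => ?_, fun a m => ?_, fun i m hm => ?_, fun m hm => ?_⟩
  · refine tm_induction (p := fun x => ∃ m, toReduced Q M m = x) x ⟨0, map_zero _⟩
      (fun t (b' : A'.carrier) => ?_) ?_
    · obtain ⟨b, rfl⟩ := hQ b'
      refine tm_induction (p := fun t => ∃ m, toReduced Q M m =
        rtm Q (tensor (ofAlg (GrAlg.Hom.id A') Q) M) t (Q.toAlgHom b)) t ⟨0, by simp⟩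
        (fun (a' : A'.carrier) m => ?_) ?_
      · obtain ⟨a, rfl⟩ := hQ a'
        exact ⟨_, (rtm_ltm a b m).symm⟩
      · rintro _ _ ⟨m, hm⟩ ⟨n, hn⟩
        exact ⟨m + n, by rw [map_add, hm, hn, map_add, LinearMap.add_apply]⟩
    · rintro _ _ ⟨m, rfl⟩ ⟨n, rfl⟩
      exact ⟨m + n, map_add _ _ _⟩
  · rw [toReduced_apply, toReduced_apply, lact_rtm, lact_ltm, ltm_balanced]
  · rw [toReduced_apply, toReduced_apply, ract_rtm, ← ract_ltm, rtm_balanced]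
  · have h1 : ltm Q M 1 m ∈ (tensor (ofAlg (GrAlg.Hom.id A') Q) M).gr (0 + i) :=
      tm_mem (ofAlg (GrAlg.Hom.id A') Q) M A'.one_mem hm
    have h2 : toReduced Q M m ∈ (Reduced Q M).gr (0 + i + 0) :=
      tm_mem _ (ofAlg Q (GrAlg.Hom.id A')) h1 A'.one_mem
    rwa [show (0 + i + 0 : ℤ) = i by ring] at h2
  · obtain ⟨F, hF⟩ := exists_retraction hQ M
    rw [← Submodule.Quotient.mk_eq_zero, ← Submodule.mkQ_apply, ← hF, hm, map_zero]

end Reduction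

/-! ### Lifting morphisms along reductions -/

section Lifts

open GrBimod

variable {k : Type u} [Field k] {A A' : GrAlg.{u, v} k}

/-- Morphisms between the reductions come from morphisms. -/
def Lifts {M N : GrBimod A A} {M' N' : GrBimod A' A'} (π : M.carrier →ₗ[k] M'.carrier)
    (π₂ : N.carrier →ₗ[k] N'.carrier) : Prop :=
  ∀ f' : hom M' N', ∃ f : hom M N, ∀ m, π₂ (f.1 m) = f'.1 (π m)

variable {M N P : GrBimod A A} {M' N' P' : GrBimod A' A'}
  {π : M.carrier →ₗ[k] M'.carrier} {π₂ : N.carrier →ₗ[k] N'.carrier}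
  {π₃ : P.carrier →ₗ[k] P'.carrier}

/-- The definition concerns morphisms of all degrees, so the grading plays no role. -/
theorem Lifts.shift (h : Lifts π π₂) (d e : ℤ) :
    Lifts (M := GrBimod.shift M d) (N := GrBimod.shift N e) (M' := GrBimod.shift M' d)
      (N' := GrBimod.shift N' e) π π₂ := h

def homInl (M N : GrBimod A A) : hom M (directSum M N) :=
  ⟨LinearMap.inl k M.carrier N.carrier, fun a _ => Prod.ext rfl (map_zero (N.lact a)).symm,
    fun a _ => Prod.ext rfl (map_zero (N.ract a)).symm⟩

def homInr (M N : GrBimod A A) : hom N (directSum M N) :=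
  ⟨LinearMap.inr k M.carrier N.carrier, fun a _ => Prod.ext (map_zero (M.lact a)).symm rfl,
    fun a _ => Prod.ext (map_zero (M.ract a)).symm rfl⟩

def homFst (M N : GrBimod A A) : hom (directSum M N) M :=
  ⟨LinearMap.fst k M.carrier N.carrier, fun _ _ => rfl, fun _ _ => rfl⟩

def homSnd (M N : GrBimod A A) : hom (directSum M N) N :=
  ⟨LinearMap.snd k M.carrier N.carrier, fun _ _ => rfl, fun _ _ => rfl⟩

theorem Lifts.prod_left (h : Lifts π π₃) (h₂ : Lifts π₂ π₃) :
    Lifts (M := directSum M N) (M' := directSum M' N') (π.prodMap π₂) π₃ := by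
  intro f'
  obtain ⟨f, hf⟩ := h (homComp f' (homInl M' N'))
  obtain ⟨g, hg⟩ := h₂ (homComp f' (homInr M' N'))
  refine ⟨homComp f (homFst M N) + homComp g (homSnd M N), fun m => ?_⟩
  change π₃ (f.1 m.1 + g.1 m.2) = _
  rw [map_add, hf, hg, homComp_apply, homComp_apply, ← map_add]
  exact congrArg f'.1 (Prod.ext (add_zero _) (zero_add _))

theorem Lifts.prod_right (h : Lifts π₃ π) (h₂ : Lifts π₃ π₂) :
    Lifts (N := directSum M N) (N' := directSum M' N') π₃ (π.prodMap π₂) := by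
  intro f'
  obtain ⟨f, hf⟩ := h (homComp (homFst M' N') f')
  obtain ⟨g, hg⟩ := h₂ (homComp (homSnd M' N') f')
  refine ⟨homComp (homInl M N) f + homComp (homInr M N) g, fun m => ?_⟩
  refine Prod.ext ?_ ?_
  · change π (f.1 m + 0) = _
    rw [add_zero, hf]; rfl
  · change π₂ (0 + g.1 m) = _
    rw [zero_add, hg]; rfl

theorem Lifts.sum_left {ι : Type*} {F : ι → GrBimod A A} {F' : ι → GrBimod A' A'}
    {κ : ∀ p, (F p).carrier →ₗ[k] (F' p).carrier} (h : ∀ p, Lifts (κ p) π) (l : List ι) :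
    Lifts (M := GrBimod.sum (l.map F)) (M' := GrBimod.sum (l.map F')) (sumMap κ l) π := by
  induction l with
  | nil =>
    intro f'
    refine ⟨0, fun m => ?_⟩
    exact (map_zero π).trans (map_zero f'.1).symm
  | cons p l ih => exact (h p).prod_left ih

theorem Lifts.sum_right {ι : Type*} {F : ι → GrBimod A A} {F' : ι → GrBimod A' A'}
    {κ : ∀ p, (F p).carrier →ₗ[k] (F' p).carrier} (h : ∀ p, Lifts π (κ p)) (l : List ι) :
    Lifts (N := GrBimod.sum (l.map F)) (N' := GrBimod.sum (l.map F')) π (sumMap κ l) := by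
  induction l with
  | nil => exact fun f' => ⟨0, fun m => rfl⟩
  | cons p l ih => exact (h p).prod_right ih

end Lifts

/-! ### Fullness of the reduction on products of the θ_s -/

section Words

open GrBimod

variable {k : Type u} [Field k] {W : Type*} [Group W] {U : Type v} [AddCommGroup U] [Module k U]
  {ρ : Representation k W U} {B : Type*} {C : CoxeterMatrix B} (cs : CoxeterSystem C W)
  {α : B → (regFun k U).carrier} (hα : ∀ i, IsRefl (regAct ρ (cs.simple i)) (α i))
  (hk : (2 : k) ≠ 0) (σ : Subrepresentation ρ)
  (hα' : ∀ i, IsRefl (regAct σ.toRepresentation (cs.simple i))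
    ((restr σ.toSubmodule).toAlgHom (α i)))

/-- The reduction of `θ_{s_1} ⋯ θ_{s_n}`. -/
def redWord : ∀ ω : List B,
    (thetaWord cs ρ ω).carrier →ₗ[k] (thetaWord cs σ.toRepresentation ω).carrier
  | [] => (restr σ.toSubmodule).toAlgHom.toLinearMap
  | i :: ω => redInd (hα i) (hα' i) hk (redWord ω)

theorem isRed_redWord (ω : List B) :
    IsRed (restr σ.toSubmodule) (thetaWord cs ρ ω) (thetaWord cs σ.toRepresentation ω)
      (redWord cs hα hk σ hα' ω) := by
  induction ω with
  | nil =>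
    refine ⟨restr_surjective σ.toSubmodule, fun a (m : (regFun k U).carrier) => map_mul (restr σ.toSubmodule).toAlgHom a m,
      fun a (m : (regFun k U).carrier) => map_mul (restr σ.toSubmodule).toAlgHom a m,
      (restr σ.toSubmodule).map_mem, fun (m : (regFun k U).carrier) hm => ?_⟩
    have := lact_mem_kerSpan (M := unit (regFun k U)) (Q := (restr σ.toSubmodule).toAlgHom)
      (a := m) hm (1 : (regFun k U).carrier)
    rwa [show (unit (regFun k U)).lact m (1 : (regFun k U).carrier) = m from mul_one m] at this
  | cons i ω ih => exact IsRed.ind _ _ hk (restr_regAct σ _) ih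

/-- Adjunction moves the letters of the source to the target one at a time, whence the induction
with υ arbitrary. For the empty source, a morphism from R' is a central element, which lifts by
`LeafFamily.exists_central`. -/
theorem lifts_redWord [FiniteDimensional k U] (hbr : HasBraidMorphisms cs ρ)
    (hσ : Function.Injective σ.toRepresentation) (ω υ : List B) :
    Lifts (redWord cs hα hk σ hα' ω) (redWord cs hα hk σ hα' υ) := by
  induction ω generalizing υ with
  | nil =>
    intro f'
    have hπ := isRed_redWord cs hα hk σ hα' υ
    obtain ⟨L⟩ := exists_leafFamily cs hα hk hbr υ
    let e : (thetaWord cs σ.toRepresentation []).carrier :=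
      (1 : (regFun k σ.toSubmodule).carrier)
    have he : ∀ a, (thetaWord cs σ.toRepresentation []).lact a e = a := fun a => mul_one a
    have he' : ∀ a, (thetaWord cs σ.toRepresentation []).ract a e = a := fun a => mul_one a
    obtain ⟨m, hm⟩ := hπ.surj (f'.1 e)
    obtain ⟨m', h1, h2⟩ := L.exists_central cs hα hk σ hσ (thetaWord_finite cs hα hk υ) m
      fun b => hπ.ker _ (by
        rw [map_sub, hπ.left, hπ.right, hm, ← f'.2.1, ← f'.2.2, he, he', sub_self])
    have h3 := hπ.eq_zero h2
    rw [map_sub, sub_eq_zero] at h3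
    let N := thetaWord cs ρ υ
    refine ⟨⟨N.lact.toLinearMap.flip m', fun a (b : (regFun k U).carrier) => (lact_lact N a b m').symm,
      fun a (b : (regFun k U).carrier) => ?_⟩, fun (r : (regFun k U).carrier) => ?_⟩
    · change N.lact (a * b) m' = N.ract a (N.lact b m')
      rw [← N.comm, ← h1, lact_lact, mul_comm]
    · change redWord cs hα hk σ hα' υ (N.lact r m') = f'.1 _
      rw [hπ.left, ← h3, hm, ← f'.2.1, he]
      rfl
  | cons i ω ih =>
    intro f₀
    let φ := regAct ρ (cs.simple i)
    let φ' := regAct σ.toRepresentation (cs.simple i)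
    let α' := (restr σ.toSubmodule).toAlgHom (α i)
    let P := thetaWord cs ρ ω
    let P' := thetaWord cs σ.toRepresentation ω
    let N := thetaWord cs ρ υ
    let N' := thetaWord cs σ.toRepresentation υ
    let f' : hom (Ind φ' P') N' := f₀
    have hπ : IsRed _ P P' (redWord cs hα hk σ hα' ω) := isRed_redWord cs hα hk σ hα' ω
    have hπ₂ : IsRed _ N N' (redWord cs hα hk σ hα' υ) := isRed_redWord cs hα hk σ hα' υ
    -- F' is the adjoint of f'; it is lifted by induction, with the letter i added to the target
    -- word.
    obtain ⟨F', hF'⟩ := ((isSemi_hom f').comp (isSemi_ind P')).exists_coextend (hα' i) hk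
    obtain ⟨G₀, hG₀⟩ := ih (i :: υ) F'
    let G : hom P (Ind φ N) := G₀
    have hG : ∀ n, redInd (hα i) (hα' i) hk (redWord cs hα hk σ hα' υ) (G.1 n) =
      F'.1 (redWord cs hα hk σ hα' ω n) := hG₀
    -- The adjoint has the form n ↦ 1 ⊗ g(α n) + α ⊗ g(n), so its α-coordinate recovers the map to
    -- be extended.
    let g : P.carrier →ₗ[k] N.carrier :=
      LinearMap.snd k _ _ ∘ₗ ((hα i).coord hk N).toLinearMap ∘ₗ G.1
    have hg : ∀ n, g n = ((hα i).coord hk N (G.1 n)).2 := fun n => rfl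
    have hsemi : IsSemi φ P N g := ⟨fun r hr n => by
      rw [hg, hg, G.2.1, (hα i).coord_lact_fixed hk N hr], fun b n => by
      rw [hg, hg, G.2.2, (hα i).coord_ract]⟩
    have hπg : ∀ n, redWord cs hα hk σ hα' υ (g n) =
        f'.1 (ind φ' P' (redWord cs hα hk σ hα' ω n)) := fun n => by
      have e := coord_redInd (π₂ := redWord cs hα hk σ hα' υ) (hα i) (hα' i) hk (G.1 n)
      rw [hG, hF', (hα' i).coord_add] at e
      exact (congrArg Prod.snd e).symm
    obtain ⟨f, hf⟩ := hsemi.exists_extend (hα i) hk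
    refine ⟨f, fun t => ?_⟩
    change redWord cs hα hk σ hα' υ (f.1 t) =
      f'.1 (redInd (hα i) (hα' i) hk (redWord cs hα hk σ hα' ω) t)
    rw [(hα i).eq_add hk P t, hf, map_add, map_add, map_add,
      redInd_lact (hα i) (hα' i) hk (restr_regAct σ _) hπ, redInd_ind, redInd_ind, hπ₂.left,
      hπg, hπg, f'.2.1]

end Words

/-! ### Isomorphisms, idempotents and bounded bimodules -/

section Splitting

open GrBimod

variable {k : Type u} [Field k] {A : GrAlg.{u, v} k} {M N P M₁ M₂ N₁ N₂ : GrBimod A A}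

theorem symm_mem (e : M.carrier ≃ₗ[k] N.carrier)
    (he : ∀ (i : ℤ) (m : M.carrier), m ∈ M.gr i → e m ∈ N.gr i) {i : ℤ} {n : N.carrier}
    (hn : n ∈ N.gr i) : e.symm n ∈ M.gr i := by
  have := grProj_comm M.internal N.internal e.toLinearMap 0
    (fun i m hm => by rw [add_zero]; exact he i m hm) i (e.symm n)
  rw [add_zero, LinearEquiv.coe_coe, LinearEquiv.apply_symm_apply, grProj_of_mem _ hn,
    ← LinearEquiv.symm_apply_eq] at this
  rw [this]
  exact grProj_mem _ _ _

theorem Iso.symm (h : Iso M N) : Iso N M := by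
  obtain ⟨e, hl, hr, hg⟩ := h
  exact ⟨e.symm, fun a m => by simp [LinearEquiv.symm_apply_eq, hl],
    fun a m => by simp [LinearEquiv.symm_apply_eq, hr], fun i m hm => symm_mem e hg hm⟩

theorem Iso.trans (h : Iso M N) (h' : Iso N P) : Iso M P := by
  obtain ⟨e, hl, hr, hg⟩ := h
  obtain ⟨e', hl', hr', hg'⟩ := h'
  exact ⟨e.trans e', fun a m => by simp [hl, hl'], fun a m => by simp [hr, hr'],
    fun i m hm => hg' i _ (hg i m hm)⟩

theorem Iso.refl (M : GrBimod A A) : Iso M M :=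
  ⟨LinearEquiv.refl k M.carrier, fun _ _ => rfl, fun _ _ => rfl, fun _ _ h => h⟩

theorem Iso.prod (h₁ : Iso M₁ N₁) (h₂ : Iso M₂ N₂) :
    Iso (directSum M₁ M₂) (directSum N₁ N₂) := by
  obtain ⟨e, hl, hr, hg⟩ := h₁
  obtain ⟨e', hl', hr', hg'⟩ := h₂
  exact ⟨e.prodCongr e', fun a m => Prod.ext (hl a m.1) (hl' a m.2),
    fun a m => Prod.ext (hr a m.1) (hr' a m.2), fun i m hm => ⟨hg i _ hm.1, hg' i _ hm.2⟩⟩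

theorem Iso.comm (M N : GrBimod A A) : Iso (directSum M N) (directSum N M) :=
  ⟨LinearEquiv.prodComm k M.carrier N.carrier, fun _ _ => rfl, fun _ _ => rfl,
    fun _ _ h => ⟨h.2, h.1⟩⟩

theorem Iso.assoc (M N P : GrBimod A A) :
    Iso (directSum (directSum M N) P) (directSum M (directSum N P)) :=
  ⟨LinearEquiv.prodAssoc k M.carrier N.carrier P.carrier, fun _ _ => rfl, fun _ _ => rfl,
    fun _ _ h => ⟨h.1.1, h.1.2, h.2⟩⟩

/-- The endomorphisms of degree `0`. -/
def endAlg (M : GrBimod A A) : Subalgebra k (Module.End k M.carrier) where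
  carrier := {f | f ∈ hom M M ∧ ∀ i, ∀ m ∈ M.gr i, f m ∈ M.gr i}
  mul_mem' := fun {f g} hf hg => ⟨⟨fun a m => by
    rw [Module.End.mul_apply, Module.End.mul_apply, hg.1.1, hf.1.1], fun a m => by
    rw [Module.End.mul_apply, Module.End.mul_apply, hg.1.2, hf.1.2]⟩,
    fun i m hm => hf.2 i _ (hg.2 i m hm)⟩
  add_mem' := fun {f g} hf hg => ⟨add_mem hf.1 hg.1,
    fun i m hm => add_mem (hf.2 i m hm) (hg.2 i m hm)⟩
  algebraMap_mem' := fun c => ⟨⟨fun a m => by simp [Module.algebraMap_end_apply],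
    fun a m => by simp [Module.algebraMap_end_apply]⟩,
    fun i m hm => by rw [Module.algebraMap_end_apply]; exact Submodule.smul_mem _ _ hm⟩

/-- The image of an idempotent. -/
def image {e : Module.End k M.carrier} (he : e ∈ endAlg M) : GrBimod A A where
  carrier := LinearMap.range e
  lact := AlgHom.ofLinearMap
    { toFun := fun a => (M.lact a).restrict (p := LinearMap.range e) (q := LinearMap.range e)
        (by rintro _ ⟨m, rfl⟩; exact ⟨M.lact a m, he.1.1 a m⟩)
      map_add' := fun a b => by ext; simp
      map_smul' := fun a b => by ext; simp }
    (by ext; simp) (fun a b => by ext; simp)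
  ract := AlgHom.ofLinearMap
    { toFun := fun a => (M.ract a).restrict (p := LinearMap.range e) (q := LinearMap.range e)
        (by rintro _ ⟨m, rfl⟩; exact ⟨M.ract a m, he.1.2 a m⟩)
      map_add' := fun a b => by ext; simp
      map_smul' := fun a b => by ext; simp }
    (by ext; simp) (fun a b => by ext; simp)
  comm := fun a b m => Subtype.ext (M.comm a b m.1)
  gr := fun i => (M.gr i).comap (LinearMap.range e).subtype
  internal := by
    have h := fun i m => grProj_comm M.internal M.internal e 0
      (fun i m hm => by rw [add_zero]; exact he.2 i m hm) i m
    simp only [add_zero] at h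
    refine isInternal_of_proj _ (fun i => (grProj M.internal i).restrict
      (p := LinearMap.range e) (q := LinearMap.range e)
      (by rintro _ ⟨m, rfl⟩; exact ⟨_, (h i m).symm⟩))
      (fun i m hm => Subtype.ext (grProj_of_mem _ hm))
      (fun i j hij m hm => Subtype.ext (grProj_of_mem_ne _ hij hm)) ?_
    rw [eq_top_iff]
    rintro ⟨_, m, rfl⟩ -
    change e.rangeRestrict m ∈ _
    refine gr_induction M.internal (p := fun m => e.rangeRestrict m ∈ _) m
      (fun i m hm => Submodule.mem_iSup_of_mem i (he.2 i m hm)) (by simp)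
      (fun a b ha hb => by rw [map_add]; exact add_mem ha hb)
  lact_mem := fun ha hm => M.lact_mem ha hm
  ract_mem := fun ha hm => M.ract_mem ha hm

theorem iso_image {e : Module.End k M.carrier} (he : e ∈ endAlg M) (h : IsIdempotentElem e) :
    Iso M (directSum (image he) (image (sub_mem (one_mem (endAlg M)) he))) := by
  let e₂ : Module.End k M.carrier := 1 - e
  have h1 : ∀ m, e (e m) = e m := fun m => LinearMap.congr_fun h m
  have h2 : ∀ m, e₂ m = m - e m := fun m => rfl
  let f : M.carrier →ₗ[k] LinearMap.range e × LinearMap.range e₂ :=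
    e.rangeRestrict.prod e₂.rangeRestrict
  let g : LinearMap.range e × LinearMap.range e₂ →ₗ[k] M.carrier :=
    (LinearMap.range e).subtype.coprod (LinearMap.range e₂).subtype
  refine ⟨LinearEquiv.ofLinearMap f g (LinearMap.ext ?_) (LinearMap.ext fun m => ?_),
    fun a m => ?_, fun a m => ?_, fun i m hm => ?_⟩
  · rintro ⟨⟨_, m, rfl⟩, _, n, rfl⟩
    refine Prod.ext (Subtype.ext ?_) (Subtype.ext ?_)
    · change e (e m + e₂ n) = e m
      rw [h2, map_add, map_sub, h1, h1, sub_self, add_zero]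
    · change e₂ (e m + e₂ n) = e₂ n
      simp only [h2, map_add, map_sub, h1, sub_self, add_zero]
      abel
  · change e m + e₂ m = m
    rw [h2, add_sub_cancel]
  · exact Prod.ext (Subtype.ext (he.1.1 a m))
      (Subtype.ext ((sub_mem (one_mem (endAlg M)) he).1.1 a m))
  · exact Prod.ext (Subtype.ext (he.1.2 a m))
      (Subtype.ext ((sub_mem (one_mem (endAlg M)) he).1.2 a m))
  · exact ⟨he.2 i m hm, (sub_mem (one_mem (endAlg M)) he).2 i m hm⟩

/-- Bimodules that vanish in low degrees and are generated in bounded degrees. -/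
def IsBounded (M : GrBimod A A) : Prop :=
  ∃ lo hi : ℤ, (∀ j < lo, ∀ m ∈ M.gr j, m = 0) ∧
    ∀ p : Submodule k M.carrier, (∀ j ≤ hi, M.gr j ≤ p) →
      (∀ a, ∀ m ∈ p, M.lact a m ∈ p) → ∀ m, m ∈ p

theorem IsBounded.prod (hM : IsBounded M) (hN : IsBounded N) : IsBounded (directSum M N) := by
  obtain ⟨lo, hi, h1, h2⟩ := hM
  obtain ⟨lo', hi', h1', h2'⟩ := hN
  refine ⟨min lo lo', max hi hi', fun j hj m hm => Prod.ext
    (h1 j (hj.trans_le (min_le_left _ _)) _ hm.1) (h1' j (hj.trans_le (min_le_right _ _)) _ hm.2),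
    fun p hp hl m => ?_⟩
  have e1 := h2 (p.comap (homInl M N).1)
    (fun j hj m hm => hp j (hj.trans (le_max_left _ _)) ⟨hm, zero_mem _⟩)
    (fun a m hm => by
      rw [Submodule.mem_comap, (homInl M N).2.1]; exact hl a _ hm) m.1
  have e2 := h2' (p.comap (homInr M N).1)
    (fun j hj m hm => hp j (hj.trans (le_max_right _ _)) ⟨zero_mem _, hm⟩)
    (fun a m hm => by
      rw [Submodule.mem_comap, (homInr M N).2.1]; exact hl a _ hm) m.2
  have e : (homInl M N).1 m.1 + (homInr M N).1 m.2 ∈ p := add_mem (S := Submodule k (directSum M N).carrier) e1 e2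
  rwa [show (homInl M N).1 m.1 + (homInr M N).1 m.2 = m from
    Prod.ext (add_zero _) (zero_add _)] at e

theorem IsBounded.shift (hM : IsBounded M) (d : ℤ) : IsBounded (GrBimod.shift M d) := by
  obtain ⟨lo, hi, h1, h2⟩ := hM
  refine ⟨lo - d, hi - d, fun j hj m hm => h1 (j + d) (by omega) m hm, fun p hp hl => ?_⟩
  refine h2 p (fun j hj m hm => hp (j - d) (by omega) ?_) hl
  change m ∈ M.gr (j - d + d)
  rwa [sub_add_cancel]

theorem IsBounded.sum {l : List (GrBimod A A)} (h : ∀ M ∈ l, IsBounded M) :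
    IsBounded (GrBimod.sum l) := by
  induction l with
  | nil => exact ⟨0, 0, fun _ _ _ _ => rfl, fun p _ _ _ => zero_mem p⟩
  | cons M l ih =>
    exact (h M List.mem_cons_self).prod (ih fun N hN => h N (List.mem_cons_of_mem _ hN))

/-- A direct factor is also a quotient, so it inherits generation in bounded degrees as well as the
lower bound. -/
theorem IsBounded.of_iso (hP : IsBounded P) (h : Iso (directSum M N) P) : IsBounded M := by
  obtain ⟨e, hl, -, hg⟩ := h
  obtain ⟨lo, hi, h1, h2⟩ := hP
  refine ⟨lo, hi, fun j hj m hm => ?_, fun p hp hl' m => ?_⟩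
  · have := h1 j hj _ (hg j ((homInl M N).1 m) ⟨hm, zero_mem _⟩)
    rw [LinearEquiv.map_eq_zero_iff] at this
    exact congrArg Prod.fst this
  · have := h2 (p.comap ((homFst M N).1 ∘ₗ e.symm.toLinearMap))
      (fun j hj m hm => hp j hj (symm_mem e hg hm).1)
      (fun a m hm => by
        have h3 : e.symm (P.lact a m) = (directSum M N).lact a (e.symm m) := by
          simp [LinearEquiv.symm_apply_eq, hl]
        rw [Submodule.mem_comap, LinearMap.comp_apply, LinearEquiv.coe_coe, h3,
          (homFst M N).2.1]
        exact hl' a _ hm) (e ((homInl M N).1 m))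
    rw [Submodule.mem_comap, LinearMap.comp_apply, LinearEquiv.coe_coe,
      LinearEquiv.symm_apply_apply] at this
    exact this

variable {A' : GrAlg.{u, v} k} {Q : GrAlg.Hom A A'} {M' : GrBimod A' A'}
  {π : M.carrier →ₗ[k] M'.carrier}

theorem grProj_lact (j l : ℤ) (a : A.carrier) {m : M.carrier} (hm : m ∈ M.gr l) :
    grProj M.internal j (M.lact a m) = M.lact (grProj A.internal (j - l) a) m := by
  have := grProj_comm A.internal M.internal (M.lact.toLinearMap.flip m) l
    (fun i a ha => M.lact_mem ha hm) (j - l) a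
  rwa [sub_add_cancel] at this

theorem grProj_ract (j l : ℤ) (a : A.carrier) {m : M.carrier} (hm : m ∈ M.gr l) :
    grProj M.internal j (M.ract a m) = M.ract (grProj A.internal (j - l) a) m := by
  have := grProj_comm A.internal M.internal (M.ract.toLinearMap.flip m) l
    (fun i a ha => M.ract_mem ha hm) (j - l) a
  rwa [sub_add_cancel] at this

/-- The kernel of Q has only components of positive degree, so an element of degree j in I M + M I
is a combination of elements of lower degree, all killed by g. -/
theorem eq_zero_of_mem_kerSpan
    (hpos : ∀ a, Q.toAlgHom a = 0 → ∀ i ≤ 0, grProj A.internal i a = 0)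
    (g : hom M M) {j : ℤ} (hg : ∀ i < j, ∀ m ∈ M.gr i, g.1 m = 0) {m : M.carrier}
    (hm : m ∈ M.gr j) (hm' : m ∈ kerSpan Q.toAlgHom M) : g.1 m = 0 := by
  rw [← grProj_of_mem M.internal hm]
  refine kerSpan_le (p := LinearMap.ker (g.1 ∘ₗ grProj M.internal j)) (fun a m ha => ?_) hm'
  refine gr_induction M.internal (p := fun m =>
    M.lact a m ∈ LinearMap.ker (g.1 ∘ₗ grProj M.internal j) ∧
      M.ract a m ∈ LinearMap.ker (g.1 ∘ₗ grProj M.internal j)) m (fun l m hm => ?_)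
    (by simp only [map_zero, zero_mem, and_self])
    (fun x y hx hy => by
      rw [map_add, map_add]; exact ⟨add_mem hx.1 hy.1, add_mem hx.2 hy.2⟩)
  rw [LinearMap.mem_ker, LinearMap.mem_ker, LinearMap.comp_apply, LinearMap.comp_apply,
    grProj_lact j l a hm, grProj_ract j l a hm, g.2.1, g.2.2]
  rcases le_or_gt (j - l) 0 with h | h
  · rw [hpos a ha _ h]
    simp
  · rw [hg l (by omega) m hm, map_zero, map_zero]
    exact ⟨rfl, rfl⟩

/-- Endomorphisms of degree `0` that vanish on the reduction are uniformly nilpotent. -/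
theorem IsBounded.exists_pow_eq_zero (hM : IsBounded M) (hπ : IsRed Q M M' π)
    (hpos : ∀ a, Q.toAlgHom a = 0 → ∀ i ≤ 0, grProj A.internal i a = 0)
    {f : Module.End k M.carrier} (hf : f ∈ endAlg M) (hf0 : ∀ m, π (f m) = 0) :
    ∃ n : ℕ, f ^ n = 0 := by
  obtain ⟨lo, hi, h1, h2⟩ := hM
  have key : ∀ n : ℕ, ∀ j < lo + n, ∀ m ∈ M.gr j, (f ^ n) m = 0 := by
    intro n
    induction n with
    | zero => exact fun j hj m hm => by rw [h1 j (by simpa using hj) m hm, map_zero]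
    | succ n ih =>
      intro j hj m hm
      rw [pow_succ, Module.End.mul_apply]
      exact eq_zero_of_mem_kerSpan hpos ⟨f ^ n, (pow_mem hf n).1⟩
        (fun i hi => ih i (by push_cast at hj; omega)) (hf.2 j m hm) (hπ.ker _ (hf0 m))
  -- The n-th power kills all degrees below lo + n, so this exponent suffices to kill the
  -- generators, which have degree at most hi; if the difference is negative, the generators are
  -- already zero.
  refine ⟨(hi + 1 - lo).toNat, LinearMap.ext fun m => ?_⟩
  exact h2 (LinearMap.ker (f ^ (hi + 1 - lo).toNat))
    (fun j hj m hm => key _ j (by omega) m hm) (fun a m hm => by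
      rw [LinearMap.mem_ker, (pow_mem hf _).1.1, LinearMap.mem_ker.1 hm, map_zero]) m

/-- If the reduction is zero, the identity vanishes on it and is therefore nilpotent, a form of
Nakayama's lemma. -/
theorem IsBounded.subsingleton (hM : IsBounded M) (hπ : IsRed Q M M' π)
    (hpos : ∀ a, Q.toAlgHom a = 0 → ∀ i ≤ 0, grProj A.internal i a = 0)
    (h : Subsingleton M'.carrier) : Subsingleton M.carrier := by
  obtain ⟨n, hn⟩ := hM.exists_pow_eq_zero hπ hpos (one_mem _) fun m => Subsingleton.elim _ _
  rw [one_pow] at hn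
  exact ⟨fun x y => (LinearMap.congr_fun hn x).trans (LinearMap.congr_fun hn y).symm⟩

/-- Idempotents of degree `0` lift along reductions. -/
theorem IsBounded.exists_idempotent (hM : IsBounded M) (hπ : IsRed Q M M' π) (hL : Lifts π π)
    (hpos : ∀ a, Q.toAlgHom a = 0 → ∀ i ≤ 0, grProj A.internal i a = 0)
    {f' : Module.End k M'.carrier} (hf' : f' ∈ endAlg M') (hi : IsIdempotentElem f') :
    ∃ e ∈ endAlg M, IsIdempotentElem e ∧ ∀ m, π (e m) = f' (π m) := by
  obtain ⟨f₀, hf₀⟩ := hL ⟨f', hf'.1⟩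
  obtain ⟨⟨f, hf1⟩, hf2, hf3⟩ := exists_component f₀ 0
  have hf : f ∈ endAlg M := ⟨hf1, fun i m hm => by have := hf2 i m hm; rwa [add_zero] at this⟩
  have hπf : ∀ m, π (f m) = f' (π m) := fun m => by
    refine gr_induction M.internal (p := fun m => π (f m) = f' (π m)) m (fun i m hm => ?_)
      (by simp) (fun x y hx hy => by simp only [map_add, hx, hy])
    have := hf3 i m hm
    change f m = _ at this
    rw [this, add_zero, ← hπ.grProj, hf₀]
    exact grProj_of_mem _ (hf'.2 i _ (hπ.mem i m hm))
  have hpow : ∀ {g : Module.End k M.carrier} {g' : Module.End k M'.carrier},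
      (∀ m, π (g m) = g' (π m)) → ∀ n m, π ((g ^ n) m) = (g' ^ n) (π m) := by
    intro g g' h n
    induction n with
    | zero => exact fun m => rfl
    | succ n ih =>
      exact fun m => by rw [pow_succ, pow_succ, Module.End.mul_apply, Module.End.mul_apply, ih, h]
  have hsub : ∀ {g : Module.End k M.carrier} {g' : Module.End k M'.carrier},
      (∀ m, π (g m) = g' (π m)) → ∀ m, π ((1 - g) m) = (1 - g') (π m) := fun h m => by
    rw [LinearMap.sub_apply, LinearMap.sub_apply, map_sub, h]; rfl
  -- The degree-0 lift f satisfies f = f² on the reduction, so f - f² is nilpotent and f can be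
  -- corrected to the idempotent 1 - (1 - f^N)^N.
  obtain ⟨n, hn⟩ := hM.exists_pow_eq_zero hπ hpos (sub_mem hf (pow_mem hf 2)) fun m => by
    rw [LinearMap.sub_apply, map_sub, hπf, hpow hπf, pow_two, hi.eq, sub_self]
  -- The exponent must be positive for the powers of f' and 1 - f' to be the same idempotents.
  have hn' : (f - f ^ 2) ^ (n + 1) = 0 := by rw [pow_succ, hn, zero_mul]
  refine ⟨1 - (1 - f ^ (n + 1)) ^ (n + 1),
    sub_mem (one_mem _) (pow_mem (sub_mem (one_mem _) (pow_mem hf _)) _),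
    isIdempotentElem_one_sub_one_sub_pow_pow f (n + 1) hn', fun m => ?_⟩
  rw [hsub (hpow (hsub (hpow hπf _)) _), hi.pow_succ_eq, hi.one_sub.pow_succ_eq, sub_sub_cancel]

/-- Decompositions lift along reductions. -/
theorem IsBounded.exists_splitting (hM : IsBounded M) (hπ : IsRed Q M M' π) (hL : Lifts π π)
    (hpos : ∀ a, Q.toAlgHom a = 0 → ∀ i ≤ 0, grProj A.internal i a = 0)
    {M₁' M₂' : GrBimod A' A'} (h : Iso M' (directSum M₁' M₂')) :
    ∃ N₁ N₂ : GrBimod A A, Iso M (directSum N₁ N₂) ∧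
      (Subsingleton N₁.carrier → Subsingleton M₁'.carrier) ∧
      (Subsingleton N₂.carrier → Subsingleton M₂'.carrier) := by
  obtain ⟨ε, hl, hr, hg⟩ := h
  let p : Module.End k M'.carrier :=
    ε.symm.toLinearMap ∘ₗ (homInl M₁' M₂').1 ∘ₗ (homFst M₁' M₂').1 ∘ₗ ε.toLinearMap
  have hp' : ∀ m, ε (p m) = ((ε m).1, (0 : M₂'.carrier)) := fun m => ε.apply_symm_apply _
  have hp : p ∈ endAlg M' := by
    refine ⟨⟨fun a m => ε.injective ?_, fun a m => ε.injective ?_⟩, fun i m hm =>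
      symm_mem ε hg ⟨(hg i m hm).1, zero_mem _⟩⟩
    · rw [hp', hl, hl, hp']
      exact Prod.ext rfl (map_zero (M₂'.lact a)).symm
    · rw [hp', hr, hr, hp']
      exact Prod.ext rfl (map_zero (M₂'.ract a)).symm
  have hpi : IsIdempotentElem p := LinearMap.ext fun m => ε.injective (by
    rw [Module.End.mul_apply, hp', hp'])
  obtain ⟨e, he, hei, hπe⟩ := hM.exists_idempotent hπ hL hpos hp hpi
  refine ⟨_, _, iso_image he hei, fun h1 => ?_, fun h1 => ?_⟩
  · have h0 : ∀ m, e m = 0 := fun m =>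
      congrArg Subtype.val (h1.elim ⟨e m, m, rfl⟩ ⟨0, zero_mem (LinearMap.range e)⟩)
    refine subsingleton_of_forall_eq 0 fun x => ?_
    obtain ⟨y, hy⟩ := ε.surjective (x, (0 : M₂'.carrier))
    obtain ⟨m, rfl⟩ := hπ.surj y
    have := hp' (π m)
    rw [← hπe, h0, map_zero, map_zero, hy] at this
    exact (congrArg Prod.fst this).symm
  · have h0 : ∀ m, (1 - e) m = 0 := fun m =>
      congrArg Subtype.val (h1.elim ⟨(1 - e) m, m, rfl⟩ ⟨0, zero_mem (LinearMap.range (1 - e))⟩)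
    refine subsingleton_of_forall_eq 0 fun x => ?_
    obtain ⟨y, hy⟩ := ε.surjective ((0 : M₁'.carrier), x)
    obtain ⟨m, rfl⟩ := hπ.surj y
    have := hp' (π m)
    rw [← hπe, ← sub_eq_zero.1 (h0 m), Module.End.one_apply, hy] at this
    exact congrArg Prod.snd this

/-- Fullness passes to direct factors: a morphism of the reduced factor is extended by zero to the
reduced sum, lifted, and cut down again. -/
theorem Lifts.of_iso {N' P' : GrBimod A' A'} {π₂ : N.carrier →ₗ[k] N'.carrier}
    {κ : P.carrier →ₗ[k] P'.carrier} (hQ : Function.Surjective Q.toAlgHom)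
    (hπ : IsRed Q M M' π) (hπ₂ : IsRed Q N N' π₂) (hκ : IsRed Q P P' κ)
    (h : Iso (directSum M N) P) (hL : Lifts κ κ) : Lifts π π := by
  obtain ⟨e, hl, hr, hg⟩ := h
  have hs := hπ.prod hπ₂
  have hκe := hκ.comp_iso e hl hr hg
  obtain ⟨a, ha⟩ := hs.exists_factor hQ _ hκe.left hκe.right
  obtain ⟨b, hb⟩ := hκe.exists_factor (N' := directSum M' N') hQ (π.prodMap π₂) hs.left hs.right
  intro f'
  obtain ⟨F, hF⟩ := hL (homComp a (homComp (homInl M' N') (homComp f'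
    (homComp (homFst M' N') b))))
  let e₁ : hom (directSum M N) P := ⟨e.toLinearMap, hl, hr⟩
  let e₂ : hom P (directSum M N) := ⟨e.symm.toLinearMap,
    fun a m => by simp [LinearEquiv.symm_apply_eq, hl],
    fun a m => by simp [LinearEquiv.symm_apply_eq, hr]⟩
  refine ⟨homComp (homFst M N) (homComp e₂ (homComp F (homComp e₁ (homInl M N)))), fun m => ?_⟩
  have h1 : ∀ x, (π.prodMap π₂) (e₂.1 x) = b.1 (κ x) := fun x => by
    have := hb (e.symm x)
    rw [LinearMap.comp_apply, LinearEquiv.coe_coe, LinearEquiv.apply_symm_apply] at this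
    exact this.symm
  have h2 : ∀ y, b.1 (a.1 y) = y := fun y => by
    obtain ⟨x, rfl⟩ := hs.surj y
    rw [ha, hb]
  have h3 : b.1 (κ (e ((homInl M N).1 m))) = (π.prodMap π₂) ((homInl M N).1 m) := hb _
  have h4 := h1 (F.1 (e ((homInl M N).1 m)))
  rw [hF] at h4
  simp only [homComp_apply, h2, h3] at h4
  exact congrArg Prod.fst h4

end Splitting

/-! ### Soergel bimodules of a good pair -/

section GoodPair

open GrBimod

variable {k : Type u} [Field k] {W : Type*} [Group W] {U : Type v} [AddCommGroup U] [Module k U]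
  {ρ : Representation k W U} {B : Type*} {C : CoxeterMatrix B} (cs : CoxeterSystem C W)
  {M N M₁ M₂ : GrBimod (regFun k U) (regFun k U)}

/-- Regular functions have no negative degrees, and restriction is injective on constants. -/
theorem grProj_eq_zero_of_restr_eq_zero (V' : Submodule k U) (a : (regFun k U).carrier)
    (ha : (restr V').toAlgHom a = 0) (i : ℤ) (hi : i ≤ 0) :
    grProj (regFun k U).internal i a = 0 := by
  have hm := grProj_mem (regFun k U).internal i a
  rcases hi.lt_or_eq with hi | rfl
  · rwa [regFun_gr_neg hi, Submodule.mem_bot] at hm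
  · have h := grProj_comm (regFun k U).internal (regFun k V').internal
      (restr V').toAlgHom.toLinearMap 0
      (fun i m hm => by rw [add_zero]; exact (restr V').map_mem i m hm) 0 a
    obtain ⟨c, hc⟩ := regFun_gr_zero hm
    have ha' : (restr V').toAlgHom.toLinearMap a = 0 := ha
    rw [ha', map_zero, hc, map_smul, AlgHom.toLinearMap_apply, map_one] at h
    have hc0 : c = 0 := (smul_eq_zero.1 h.symm).resolve_right one_ne_zero
    rw [hc, hc0, zero_smul]

variable {cs} in
theorem IsSoergel.left (hM : IsSoergel cs ρ M) (h : Iso M (directSum M₁ M₂)) :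
    IsSoergel cs ρ M₁ := by
  obtain ⟨l, N, hN⟩ := hM
  exact ⟨l, directSum M₂ N, Iso.trans (Iso.symm (Iso.assoc _ _ _))
    (Iso.trans (Iso.prod (Iso.symm h) (Iso.refl N)) hN)⟩

variable {cs} in
theorem IsSoergel.right (hM : IsSoergel cs ρ M) (h : Iso M (directSum M₁ M₂)) :
    IsSoergel cs ρ M₂ :=
  hM.left (Iso.trans h (Iso.comm _ _))

variable {α : B → (regFun k U).carrier} (hα : ∀ i, IsRefl (regAct ρ (cs.simple i)) (α i))
  (hk : (2 : k) ≠ 0) (σ : Subrepresentation ρ)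
  (hα' : ∀ i, IsRefl (regAct σ.toRepresentation (cs.simple i))
    ((restr σ.toSubmodule).toAlgHom (α i)))

include hα hk hα' in
theorem IsSoergel.reduction (hM : IsSoergel cs ρ M) :
    IsSoergel cs σ.toRepresentation (Soergel.reduction σ.toSubmodule M) := by
  obtain ⟨l, N, e, hl, hr, hg⟩ := hM
  have hQ := restr_surjective σ.toSubmodule
  have hX := IsRed.sum (fun p : List B × ℤ => (isRed_redWord cs hα hk σ hα' p.1).shift p.2) l
  exact ⟨l, Soergel.reduction σ.toSubmodule N,
    ((isRed_toReduced hQ M).prod (isRed_toReduced hQ N)).unique hQ (hX.comp_iso e hl hr hg)⟩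

include hα hk in
-- A word vanishes in negative degrees and is generated by its finite light leaf basis.
theorem IsSoergel.isBounded [FiniteDimensional k U] (hbr : HasBraidMorphisms cs ρ)
    (hρ : ∀ w, w ≠ 1 → ∃ a, regRep ρ w a ≠ a) (hM : IsSoergel cs ρ M) : IsBounded M := by
  obtain ⟨l, N, hN⟩ := hM
  refine IsBounded.of_iso (IsBounded.sum fun X hX => ?_) hN
  obtain ⟨⟨ω, d⟩, -, rfl⟩ := List.mem_map.1 hX
  refine IsBounded.shift ?_ d
  obtain ⟨L⟩ := exists_leafFamily cs hα hk hbr ω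
  obtain ⟨c, hc⟩ := Finite.exists_le L.d
  refine ⟨0, c, fun j hj m hm => thetaWord_gr_neg cs hα hk ω hj hm, fun p hp hl m => ?_⟩
  obtain ⟨a, rfl⟩ := L.exists_sum cs hα hk hρ (thetaWord_finite cs hα hk ω) m
  exact sum_mem fun j _ => hl _ _ (hp _ (hc j) (L.b_mem cs j))

include hα hk hα' in
theorem IsSoergel.lifts [FiniteDimensional k U] (hbr : HasBraidMorphisms cs ρ)
    (hσ : Function.Injective σ.toRepresentation) (hM : IsSoergel cs ρ M) :
    Lifts (toReduced (restr σ.toSubmodule) M) (toReduced (restr σ.toSubmodule) M) := by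
  obtain ⟨l, N, hN⟩ := hM
  have hQ := restr_surjective σ.toSubmodule
  have hX := IsRed.sum (fun p : List B × ℤ => (isRed_redWord cs hα hk σ hα' p.1).shift p.2) l
  refine Lifts.of_iso hQ (isRed_toReduced hQ M) (isRed_toReduced hQ N) hX hN ?_
  exact Lifts.sum_left (fun p => Lifts.sum_right (fun p' =>
    (lifts_redWord cs hα hk σ hα' hbr hσ p.1 p'.1).shift p.2 p'.2) l) l

/-- The reduction to a faithful subrepresentation preserves and reflects indecomposability. -/
theorem IsGoodPair.isIndecomposableIn_iff [FiniteDimensional k U] (hk : (2 : k) ≠ 0)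
    (σ : Subrepresentation ρ) (hpair : IsGoodPair cs ρ σ)
    (hfaithful : Function.Injective σ.toRepresentation) (hM : IsSoergel cs ρ M) :
    IsSoergel cs σ.toRepresentation (reduction σ.toSubmodule M) ∧
      (IsIndecomposableIn (IsSoergel cs ρ) M ↔
        IsIndecomposableIn (IsSoergel cs σ.toRepresentation) (reduction σ.toSubmodule M)) := by
  obtain ⟨α, hα, hα'⟩ := exists_roots σ cs hpair.refl hpair.refl_sub
  have hρ := fun w hw => exists_regRep_ne σ hfaithful (w := w) hw
  have hbr := hasBraidMorphisms cs hα hk hρ hpair.homFormula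
  have hQ := restr_surjective σ.toSubmodule
  have hpos := grProj_eq_zero_of_restr_eq_zero σ.toSubmodule
  have hM' := hM.reduction cs hα hk σ hα'
  have hb : ∀ {N : GrBimod (regFun k U) (regFun k U)}, IsSoergel cs ρ N → IsBounded N :=
    fun hN => hN.isBounded cs hα hk hbr hρ
  have hπ := isRed_toReduced hQ M
  refine ⟨hM', fun ⟨_, hne, h⟩ => ⟨hM', fun hs => hne ((hb hM).subsingleton hπ hpos hs), ?_⟩,
    fun ⟨_, hne, h⟩ => ⟨hM, fun hs => hne hπ.surj.subsingleton, ?_⟩⟩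
  -- A splitting of 𝔛(M) lifts to a splitting of M, whose factors are again Soergel bimodules.
  · intro M₁ M₂ _ _ hI'
    obtain ⟨N₁, N₂, hI, h1, h2⟩ := (hb hM).exists_splitting hπ
      (hM.lifts cs hα hk σ hα' hbr hfaithful) hpos hI'
    exact (h _ _ (hM.left hI) (hM.right hI) hI).imp h1 h2
  -- A splitting of M reduces to one of 𝔛(M), and a Soergel bimodule with zero reduction is zero.
  · rintro M₁ M₂ h₁ h₂ ⟨ε, hl, hr, hg⟩
    have hπ₁ := isRed_toReduced hQ M₁
    have hπ₂ := isRed_toReduced hQ M₂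
    exact (h _ _ (h₁.reduction cs hα hk σ hα') (h₂.reduction cs hα hk σ hα')
      (hπ.unique hQ ((hπ₁.prod hπ₂).comp_iso ε hl hr hg))).imp
      ((hb h₁).subsingleton hπ₁ hpos) ((hb h₂).subsingleton hπ₂ hpos)

end GoodPair

end Soergel

end

theorem mainTheorem2 {k : Type*} [Field k] (hk : (2 : k) ≠ 0)
    {B : Type*} {W : Type*} [Group W] {C : CoxeterMatrix B} (cs : CoxeterSystem C W)
    {V : Type*} [AddCommGroup V] [Module k V] [FiniteDimensional k V]
    (ρ : Representation k W V) (σ : Subrepresentation ρ)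
    (hpair : Soergel.IsGoodPair cs ρ σ)
    (hfaithful : Function.Injective σ.toRepresentation)
    (M : Soergel.GrBimod (Soergel.regFun k V) (Soergel.regFun k V))
    (hM : Soergel.IsSoergel cs ρ M) :
    Soergel.IsSoergel cs σ.toRepresentation (Soergel.reduction σ.toSubmodule M) ∧
      (Soergel.IsIndecomposableIn (Soergel.IsSoergel cs ρ) M ↔
        Soergel.IsIndecomposableIn (Soergel.IsSoergel cs σ.toRepresentation)
          (Soergel.reduction σ.toSubmodule M)) :=
  hpair.isIndecomposableIn_iff cs hk σ hfaithful hM
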